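/- For a group $G$, a field $F$ and $i\ge 0$ let $\beta_i(G;F)=\dim_F H_i(G;F)$ (trivial action). A finitely generated group $G$ is \emph{homologically balanced} if $\beta_2(G;F)\le\beta_1(G;F)$ for every field $F$. The Hirsch length $h(G)$ of a solvable group $G$ is the sum of the torsion-free ranks of the factors of its derived series (equivalently, of any finite subnormal series with abelian factors). With $[g,h]=ghg^{-1}h^{-1}$, let $\Gamma_q=\langle x,y,z\mid [x,y]=z^q,\ xz=zx,\ yz=zy\rangle$ for $q\ge 1$, and let $\Omega=\langle t,u\mid [t,[t,[t,u]]]=[u,[t,u]]=1\rangle$. \textbf{Theorem.} Let $G$ be a homologically balanced nilpotent group with $\beta_1(G;\mathbb{Q})=2$, and let $T$ be its torsion subgroup (the subgroup of all elements of finite order). Then: (1) if $h(G)=2$ and $T$ is abelian, then $G\cong\mathbb{Z}^2$; (2) if $h(G)=3$ and the outer action $G\to\mathrm{Out}(T)=\mathrm{Aut}(T)/\mathrm{Inn}(T)$ determined by conjugation in $G$ factors through $\mathbb{Z}^2$ (that is, it is a composite of homomorphisms $G\to\mathbb{Z}^2\to\mathrm{Out}(T)$), then $G\cong\Gamma_q$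 for some $q\ge 1$; (3) if $h(G)=4$ and $G$ has an abelian normal subgroup $A$ with $G/AT\cong\mathbb{Z}^2$, then $G\cong\Omega$. \textbf{Corollary.} Let $G$ be a homologically balanced nilpotent group with $\beta_1(G;\mathbb{Q})=2$. If $G$ has an abelian normal subgroup $A$ with $G/A\cong\mathbb{Z}^2$, then $G\cong\mathbb{Z}^2$, $G\cong\Gamma_q$ for some $q\ge 1$, or $G\cong\Omega$. -/

import Mathlib

universe u

namespace NilGrp

open scoped commutatorElement

/-- The Betti number `β_n(G; F) = dim_F H_n(G; F)` of a group `G` with coefficients in a field `F`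
(with trivial `G`-action), as a cardinal. -/
noncomputable def bettiNumber (F G : Type u) [Field F] [Group G] (n : ℕ) : Cardinal.{u} :=
  Module.rank F (groupHomology (Rep.trivial F G F) n)

/-- A finitely generated group `G` is homologically balanced if `β_2(G; F) ≤ β_1(G; F)` for every
field `F` of coefficients. -/
def HomologicallyBalanced (G : Type u) [Group G] : Prop :=
  Group.FG G ∧ ∀ (F : Type u) [Field F], bettiNumber F G 2 ≤ bettiNumber F G 1

/-- The Hirsch length of a solvable group: the sum of the (torsion-free) ranks of the abelian
sections `G⁽ⁱ⁾ / G⁽ⁱ⁺¹⁾` of its derived series. Note that `G⁽ⁱ⁺¹⁾` is the commutator subgroup of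
`G⁽ⁱ⁾`, so that the `i`-th section is the abelianization of `G⁽ⁱ⁾`; the sections of a solvable
group are trivial from some point on. -/
noncomputable def hirschLength (G : Type u) [Group G] : Cardinal.{u} :=
  Cardinal.sum fun i : ℕ => Module.rank ℤ (Additive (Abelianization (derivedSeries G i)))

/-- The subgroup generated by the elements of finite order. In a nilpotent group the elements of
finite order already form a subgroup, so there it is the set of all elements of finite order. -/
def torsionSubgroup (G : Type u) [Group G] : Subgroup G :=
  Subgroup.closure {g : G | IsOfFinOrder g}

instance torsionSubgroup_normal (G : Type u) [Group G] : (torsionSubgroup G).Normal where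
  conj_mem n hn g := by
    have h : (torsionSubgroup G).map (MulAut.conj g).toMonoidHom ≤ torsionSubgroup G := by
      rw [torsionSubgroup, MonoidHom.map_closure]
      refine Subgroup.closure_mono ?_
      rintro _ ⟨x, hx, rfl⟩
      exact MonoidHom.isOfFinOrder _ hx
    exact h ⟨n, hn, rfl⟩

/-- The inner automorphisms of `T`. -/
def innerAut (T : Type u) [Group T] : Subgroup (MulAut T) :=
  (MulAut.conj : T →* MulAut T).range

instance innerAut_normal (T : Type u) [Group T] : (innerAut T).Normal where
  conj_mem := by
    rintro _ ⟨t, rfl⟩ φ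
    refine ⟨φ t, ?_⟩
    ext x
    simp [MulAut.conj_apply, MulAut.mul_apply]

/-- The group `Out(T) = Aut(T) / Inn(T)` of outer automorphism classes of `T`. -/
abbrev OuterAut (T : Type u) [Group T] : Type u := MulAut T ⧸ innerAut T

/-- The homomorphism `G → Out(T)` determined by conjugation in `G` on a normal subgroup `T`. -/
def outerAction {G : Type u} [Group G] (T : Subgroup G) [T.Normal] : G →* OuterAut T :=
  (QuotientGroup.mk' (innerAut T)).comp MulAut.conjNormal

/-- The free abelian group `ℤ²`, written multiplicatively. -/
abbrev ZSq : Type := Multiplicative (ℤ × ℤ)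

/-- The relators of `⟨x, y, z | [x, y] = z^q, xz = zx, yz = zy⟩`, with `x, y, z` the generators
`0, 1, 2`. -/
def gammaRels (q : ℕ) : Set (FreeGroup (Fin 3)) :=
  let x : FreeGroup (Fin 3) := FreeGroup.of 0
  let y : FreeGroup (Fin 3) := FreeGroup.of 1
  let z : FreeGroup (Fin 3) := FreeGroup.of 2
  {⁅x, y⁆ * (z ^ q)⁻¹, ⁅x, z⁆, ⁅y, z⁆}

/-- The group `Γ_q = ⟨x, y, z | [x, y] = z^q, xz = zx, yz = zy⟩`. -/
abbrev GammaGrp (q : ℕ) : Type := PresentedGroup (gammaRels q)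

/-- The relators of `⟨t, u | [t, [t, [t, u]]] = [u, [t, u]] = 1⟩`, with `t, u` the generators
`0, 1`. -/
def omegaRels : Set (FreeGroup (Fin 2)) :=
  let t : FreeGroup (Fin 2) := FreeGroup.of 0
  let u : FreeGroup (Fin 2) := FreeGroup.of 1
  {⁅t, ⁅t, ⁅t, u⁆⁆⁆, ⁅u, ⁅t, u⁆⁆}

/-- The group `Ω = ⟨t, u | [t, [t, [t, u]]] = [u, [t, u]] = 1⟩`. -/
abbrev OmegaGrp : Type := PresentedGroup omegaRels

end NilGrp

namespace NilGrp

open scoped commutatorElement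

open Polynomial

/-! Let K be the kernel of a surjection G → ℤ² that is torsion modulo the commutator subgroup, and
let B be the abelianization of K. Lifts of a basis of ℤ² act on B by conjugation, which makes B a
module over R = ℤ[x][y] with 1 + x and 1 + y acting as the two conjugations. Since G is nilpotent, x
and y act nilpotently and B is finitely generated, even over ℤ.

All restrictions on G come from one inequality. For a central extension E of G by a
finite-dimensional F-vector space V, the five-term sequence and β₂ ≤ β₁ give dim V ≤ dim Hom(E, F)
(`HomologicallyBalanced.finrank_le_of_central`). Such an E can be built from a central extension of
K to which the two conjugations and the commutator of the basis lift compatibly (`CentralLift`). For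
a prime field F the inequality then says that dim V exceeds the dimension of the space of invariant
homomorphisms to F by at most one (`CentralLift.finrank_le`).

Torsion. Write B = Rⁿ/P and 𝔪 = (p, x, y). Pulling back Rⁿ/𝔪P → B along K → B extends K by P/𝔪P, and
the inequality shows that n + 1 elements generate P near 𝔪. The kernel of Rⁿ⁺¹ → Rⁿ is cyclic
because R is factorial, so B has projective dimension at most two over a local ring of dimension
three, and hence no socle. Made explicit with the Koszul complex of (p, x, y), this is
`BiPoly.mem_of_socle`. As x and y are nilpotent, B has no p-torsion for any p.

Abelian kernel. If K is abelian, then K = B is free of finite rank, and it can be extended by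
biadditive cocycles. The inequality makes the Koszul map (χ, ψ) ↦ χ(σy − 1) − ψ(σx − 1) on dual
spaces have corank at most one, and it excludes any cocycle with nonzero alternating part compatible
with the conjugations and the commutator (`AddModel.no_quadratic`). If the rank were at least three,
such a cocycle could be written down modulo a large prime. Rank 0 gives ℤ² and rank 1 gives some
Γ_q. In rank 2 the conjugations become transvections of ℤ²; the corank bound and the excluded
cocycle normalise them and the commutator, which gives Ω.

Reduction to abelian K. The rank of B is at most h(G) − 2. If it is at most one, B is cyclic, and a
nilpotent group with cyclic abelianization is abelian. If K = AT, then T lies in [K, K] because B is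
torsion-free, so K/A is perfect and nilpotent, hence trivial. Once K is abelian, h(G) − 2 is exactly
the rank of B and selects the group. -/

/-- The ring `ℤ[x][y]`. -/
abbrev BiPoly : Type := Polynomial (Polynomial ℤ)

/-! ### Commutative algebra of ℤ[x][y] near (p, x, y): a presentation with few relations has no
socle. -/

namespace BiPoly

/-- The inner variable of `ℤ[x][y]`. -/
noncomputable def x : BiPoly := C X

/-- The outer variable of `ℤ[x][y]`. -/
noncomputable def y : BiPoly := X

/-- The ideal `(p, x, y)` of `ℤ[x][y]`. -/
noncomputable def maxIdeal (p : ℕ) : Ideal BiPoly := Ideal.span {(p : BiPoly), x, y}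

theorem one_notMem_maxIdeal (p : ℕ) [hp : Fact p.Prime] : (1 : BiPoly) ∉ maxIdeal p := by
  let ev : BiPoly →+* ZMod p := eval₂RingHom (eval₂RingHom (Int.castRingHom (ZMod p)) 0) 0
  have h : maxIdeal p ≤ RingHom.ker ev := by
    rw [maxIdeal, Ideal.span_le]
    rintro z (rfl | rfl | rfl) <;> simp [ev, x, y, RingHom.mem_ker]
  intro h1
  have := h h1
  simp [RingHom.mem_ker] at this

theorem prime_natCast (p : ℕ) [hp : Fact p.Prime] : Prime (p : BiPoly) := by
  have h : Prime (p : ℤ) := Nat.prime_iff_prime_int.mp hp.out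
  have := Polynomial.prime_C_iff.mpr (Polynomial.prime_C_iff.mpr h)
  simpa using this

theorem natCast_dvd_iff (p : ℕ) (f : BiPoly) : (p : BiPoly) ∣ f ↔ ∀ i, (p : ℤ[X]) ∣ f.coeff i := by
  have := Polynomial.C_dvd_iff_dvd_coeff (p : ℤ[X]) f
  simpa using this

theorem not_natCast_dvd_x (p : ℕ) [hp : Fact p.Prime] : ¬ (p : BiPoly) ∣ x := by
  rw [natCast_dvd_iff]
  intro h
  have h0 := h 0
  simp only [x, coeff_C_zero] at h0
  have h1 := (Polynomial.C_dvd_iff_dvd_coeff (p : ℤ) X).mp (by simpa using h0) 1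
  simp only [coeff_X_one] at h1
  exact hp.out.one_lt.ne' (by exact_mod_cast Int.eq_one_of_dvd_one (by positivity) h1)

theorem dvd_of_dvd_x_mul {p : ℕ} [hp : Fact p.Prime] {f : BiPoly} (h : (p : BiPoly) ∣ x * f) :
    (p : BiPoly) ∣ f :=
  ((prime_natCast p).dvd_or_dvd h).resolve_left (not_natCast_dvd_x p)

/-- Exactness of the Koszul complex of the regular sequence y, p, x in the degree of first syzygies,
obtained by dividing by one variable at a time. -/
theorem koszul_exact {p : ℕ} [hp : Fact p.Prime] {a b c : BiPoly}
    (h : y * a - x * b + p * c = 0) :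
    ∃ e f g : BiPoly, a = x * e - p * f ∧ b = y * e - p * g ∧ c = y * f - x * g := by
  have hp0 : (p : BiPoly) ≠ 0 := (prime_natCast p).ne_zero
  have hb := (Polynomial.divX_mul_X_add b)
  set b1 := b.divX
  -- At y = 0 the relation says that p divides x times the constant term of b.
  have hb0 : (p : BiPoly) ∣ C (b.coeff 0) := by
    apply dvd_of_dvd_x_mul
    have h2 : (p : BiPoly) ∣ y * a - x * b := ⟨-c, by linear_combination h⟩
    rw [natCast_dvd_iff] at h2 ⊢
    intro i
    rcases i with _ | i
    · have := h2 0
      simp only [y, x, coeff_sub, coeff_X_mul_zero, coeff_C_mul, zero_sub, dvd_neg] at this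
      simpa [x] using this
    · simp only [x, coeff_C_mul, coeff_C_succ, mul_zero, dvd_zero]
  obtain ⟨g, hg⟩ := hb0
  have ha : (p : BiPoly) ∣ a - x * b1 := by
    have h2 : (p : BiPoly) ∣ y * (a - x * b1) :=
      ⟨x * g - c, by simp only [y] at *; linear_combination h + x * hg - x * hb⟩
    rw [natCast_dvd_iff] at h2 ⊢
    intro i
    have := h2 (i + 1)
    simpa only [y, coeff_X_mul] using this
  obtain ⟨f, hf⟩ := ha
  refine ⟨b1, -f, -g, by linear_combination hf, ?_, ?_⟩
  · simp only [y] at *; linear_combination hg - hb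
  · apply mul_left_cancel₀ hp0
    simp only [y] at *
    linear_combination h - X * hf + x * hg - x * hb

/-- The kernel of a map `Λ^(n+1) → Λ^n` of full rank over a factorial domain is contained in a
cyclic submodule. -/
theorem exists_generator_ker {R : Type*} [CommRing R] [IsDomain R] [IsNoetherianRing R]
    [UniqueFactorizationMonoid R]
    {n : ℕ} (φ : (Fin (n + 1) → R) →ₗ[R] (Fin n → R)) {d : R} (hd : d ≠ 0)
    (hdφ : ∀ v, d • v ∈ LinearMap.range φ) :
    ∃ δ : Fin (n + 1) → R, δ ≠ 0 ∧ φ δ = 0 ∧ ∀ w, φ w = 0 → ∃ c : R, w = c • δ := by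
  classical
  let _ : StrongNormalizationMonoid R := UniqueFactorizationMonoid.strongNormalizationMonoid
  let _ : NormalizedGCDMonoid R := UniqueFactorizationMonoid.toNormalizedGCDMonoid R
  have hrange : n ≤ Module.finrank R (LinearMap.range φ) := by
    let m : (Fin n → R) →ₗ[R] LinearMap.range φ :=
      (LinearMap.lsmul R (Fin n → R) d).codRestrict _ hdφ
    have hm : Function.Injective m := by
      intro v w h
      have := congrArg Subtype.val h
      simpa [m, hd] using smul_right_injective _ hd this
    simpa using LinearMap.finrank_le_finrank_of_injective hm
  have hker : Module.finrank R (LinearMap.ker φ) = 1 := by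
    have h1 := (LinearMap.ker φ).finrank_quotient_add_finrank
    rw [φ.quotKerEquivRange.finrank_eq] at h1
    have h2 : Module.finrank R (LinearMap.range φ) ≤ n := by
      simpa using Submodule.finrank_le (LinearMap.range φ)
    simp at h1
    omega
  have hdep : ∀ u w : LinearMap.ker φ, ∃ a b : R, (a ≠ 0 ∨ b ≠ 0) ∧ a • u + b • w = 0 := by
    intro u w
    by_contra! hcon
    have hli : LinearIndependent R ![u, w] := by
      rw [LinearIndependent.pair_iff]
      intro a b hab
      by_contra hne
      exact hcon a b (by tauto) hab
    have := hli.fintype_card_le_finrank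
    simp [hker] at this
  obtain ⟨u, hu⟩ : ∃ u : LinearMap.ker φ, u ≠ 0 := by
    by_contra! hcon
    have : Subsingleton (LinearMap.ker φ) := ⟨fun a b => by rw [hcon a, hcon b]⟩
    simp [Module.finrank_zero_of_subsingleton] at hker
  obtain ⟨g, hg, hg1⟩ := Finset.extract_gcd (s := Finset.univ) u.1 ⟨0, Finset.mem_univ _⟩
  set e := Finset.univ.gcd u.1
  have hue : u.1 = e • g := funext fun i => hg i (Finset.mem_univ _)
  have he : e ≠ 0 := fun h => hu (Subtype.ext (by rw [hue, h, zero_smul]; rfl))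
  have hg0 : g ≠ 0 := fun h => hu (Subtype.ext (by rw [hue, h, smul_zero]; rfl))
  have hφg : φ g = 0 := by
    have : e • φ g = 0 := by rw [← map_smul, ← hue]; exact u.2
    exact (smul_eq_zero.mp this).resolve_left he
  refine ⟨g, hg0, hφg, fun w hw => ?_⟩
  obtain ⟨a, b, hab, h⟩ := hdep ⟨g, hφg⟩ ⟨w, hw⟩
  have h' : a • g + b • w = 0 := congrArg Subtype.val h
  have hb : b ≠ 0 := by
    rintro rfl
    rw [zero_smul, add_zero] at h'
    exact (smul_ne_zero (by simpa using hab) hg0) h'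
  -- Here b divides every a * g i, hence a times the gcd of the coordinates of g, which is 1.
  have hdvd : b ∣ a := by
    have : b ∣ Finset.univ.gcd fun i => a * g i := by
      refine Finset.dvd_gcd fun i _ => ⟨-w i, ?_⟩
      have := congrFun h' i
      simp only [Pi.add_apply, Pi.smul_apply, smul_eq_mul, Pi.zero_apply] at this
      linear_combination this
    have h2 := this.trans (Finset.gcd_mul_left' Finset.univ g a).dvd
    rwa [hg1, mul_one] at h2
  obtain ⟨c, rfl⟩ := hdvd
  refine ⟨-c, ?_⟩
  have : b • (w - (-c) • g) = 0 := by
    rw [← h']; module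
  exact sub_eq_zero.mp ((smul_eq_zero.mp this).resolve_left hb)

/-- Says that the quotient by P has no nonzero element killed by (p, x, y) when n + 1 elements
generate P modulo (p, x, y)P: locally the quotient has a free resolution of length two, one less
than the length of the Koszul complex. The proof chases the class of v through that complex. -/
theorem mem_of_socle {n : ℕ} (P : Submodule BiPoly (Fin n → BiPoly)) (p : ℕ) [hp : Fact p.Prime]
    {d : BiPoly} (hd : d ≠ 0) (hdP : ∀ v, d • v ∈ P)
    (r : Fin (n + 1) → Fin n → BiPoly) (hr : ∀ i, r i ∈ P)
    (hP : P ≤ Submodule.span BiPoly (Set.range r) ⊔ maxIdeal p • P) {v : Fin n → BiPoly}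
    (hpv : (p : BiPoly) • v ∈ P) (hxv : x • v ∈ P) (hyv : y • v ∈ P) : v ∈ P := by
  have hp0 : (p : BiPoly) ≠ 0 := (prime_natCast p).ne_zero
  -- Nakayama without localizing: s ≡ 1 modulo the ideal plays the role of a unit, and s • P lies in
  -- the span of the r i.
  obtain ⟨s, hs1, hs⟩ := Submodule.exists_sub_one_mem_and_smul_le_of_fg_of_le_sup
    (IsNoetherian.noetherian P) le_rfl hP
  let φ := Fintype.linearCombination BiPoly r
  have hφ : LinearMap.range φ = Submodule.span BiPoly (Set.range r) :=
    Fintype.range_linearCombination BiPoly r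
  have hsP : ∀ w ∈ P, ∃ a, φ a = s • w := by
    intro w hw
    have : s • w ∈ LinearMap.range φ := by
      rw [hφ]
      exact hs (Submodule.smul_mem_pointwise_smul _ _ _ hw)
    exact this
  have hφP : ∀ a, φ a ∈ P := by
    intro a
    have : LinearMap.range φ ≤ P := by
      rw [hφ, Submodule.span_le]
      rintro _ ⟨i, rfl⟩
      exact hr i
    exact this ⟨a, rfl⟩
  have hs0 : s ≠ 0 := by
    rintro rfl
    apply one_notMem_maxIdeal p
    simpa using (maxIdeal p).neg_mem hs1
  obtain ⟨δ, hδ0, hφδ, hδ⟩ := exists_generator_ker φ (mul_ne_zero hs0 hd) (fun w => by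
    obtain ⟨a, ha⟩ := hsP _ (hdP w)
    exact ⟨a, by rw [ha, smul_smul]⟩)
  obtain ⟨α, hα⟩ := hsP _ hpv
  obtain ⟨β, hβ⟩ := hsP _ hxv
  obtain ⟨γ, hγ⟩ := hsP _ hyv
  obtain ⟨a, ha⟩ := hδ (x • α - (p : BiPoly) • β) (by
    simp only [map_sub, map_smul, hα, hβ]; module)
  obtain ⟨b, hb⟩ := hδ (y • α - (p : BiPoly) • γ) (by
    simp only [map_sub, map_smul, hα, hγ]; module)
  obtain ⟨c, hc⟩ := hδ (y • β - x • γ) (by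
    simp only [map_sub, map_smul, hβ, hγ]; module)
  -- The Koszul syzygies of the lifts α, β, γ of s p v, s x v, s y v are multiples of δ, and their
  -- coefficients form a cycle; since it is a boundary, the lifts can be corrected by multiples of
  -- δ.
  have hrel : y * a - x * b + p * c = 0 := by
    have h : (y * a - x * b + p * c) • δ = 0 := by
      rw [add_smul, _root_.sub_smul, mul_smul, mul_smul, mul_smul, ← ha, ← hb, ← hc]
      module
    exact (smul_eq_zero.mp h).resolve_right hδ0
  obtain ⟨e, f, g, rfl, rfl, rfl⟩ := koszul_exact hrel
  have hxα : x • (α - e • δ) = (p : BiPoly) • (β - f • δ) := by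
    rw [← sub_eq_zero, ← sub_eq_zero.mpr ha]; module
  have hdvd : ∀ i, (p : BiPoly) ∣ (α - e • δ) i := fun i =>
    dvd_of_dvd_x_mul ⟨_, congrFun hxα i⟩
  choose α' hα' using hdvd
  have hα'' : α - e • δ = (p : BiPoly) • α' := funext hα'
  have hsv : s • v = φ α' := by
    have h : (p : BiPoly) • (s • v) = (p : BiPoly) • φ α' := by
      rw [← map_smul, ← hα'', map_sub, map_smul, hφδ, hα]
      module
    exact smul_right_injective _ hp0 h
  have hle : ∀ z ∈ maxIdeal p, z • v ∈ P := by
    intro z hz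
    refine Submodule.span_induction (p := fun z _ => z • v ∈ P) ?_ ?_ ?_ ?_ hz
    · rintro z (rfl | rfl | rfl) <;> assumption
    · simp
    · intro a b _ _ h1 h2
      rw [add_smul]; exact P.add_mem h1 h2
    · intro a b _ h1
      rw [smul_assoc]; exact P.smul_mem _ h1
  have h2 : v = s • v - (s - 1) • v := by module
  rw [h2]
  exact P.sub_mem (hsv ▸ hφP _) (hle _ hs1)

end BiPoly

end NilGrp


namespace NilGrp

open scoped commutatorElement

/-! ### Low-degree homology and the inequality for central extensions. -/

section Homology

open groupHomology

variable {F G : Type u} [Field F] [Group G]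

/-- Two-cocycles pair with second homology, and over a field a cocycle that pairs to zero is a
coboundary; U absorbs these. -/
theorem finrank_le_of_cocycles {W : Type*} [AddCommGroup W] [Module F W] [FiniteDimensional F W]
    (Θ : W →ₗ[F] (G × G → F))
    (hΘ : ∀ w g h j, Θ w (h, j) - Θ w (g * h, j) + Θ w (g, h * j) - Θ w (g, h) = 0)
    (U : Submodule F W)
    (hU : ∀ w, (∃ f : G → F, ∀ g h, Θ w (g, h) = f g + f h - f (g * h)) → w ∈ U)
    [Module.Finite F (groupHomology (Rep.trivial F G F) 2)] :
    Module.finrank F W ≤ Module.finrank F (groupHomology (Rep.trivial F G F) 2) +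
      Module.finrank F U := by
  let A := Rep.trivial F G F
  let L : W →ₗ[F] (G × G →₀ F) →ₗ[F] F :=
    (Finsupp.lsum F (M := F) (N := F) (α := G × G)).toLinearMap ∘ₗ
      (LinearMap.pi fun q => (LinearMap.toSpanSingleton F (F →ₗ[F] F) LinearMap.id) ∘ₗ
        LinearMap.proj q ∘ₗ Θ)
  have hL : ∀ w q a, L w (Finsupp.single q a) = Θ w q * a := by
    intro w q a
    simp [L]
  have hLb : ∀ w, ∀ z ∈ boundaries₂ A, L w z = 0 := by
    rintro w _ ⟨z, rfl⟩
    have : (L w) ∘ₗ (d₃₂ A).hom = 0 := by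
      apply Finsupp.lhom_ext
      rintro ⟨g, h, j⟩ a
      have := hΘ w g h j
      have h3 := d₃₂_single (A := A) (g, h, j) a
      simp only [LinearMap.comp_apply]
      erw [h3]
      simp only [map_add, map_sub]
      erw [hL, hL, hL, hL]
      have h4 : A.ρ g⁻¹ a = a := rfl
      simp only [h4, LinearMap.zero_apply]
      linear_combination a * this
    exact LinearMap.congr_fun this z
  have hsurj : Function.Surjective (H2π A).hom := by
    intro z
    induction z using H2_induction_on with
    | h x => exact ⟨x, rfl⟩
  -- A linear section of the projection from cycles turns functionals on chains into functionals on
  -- homology; the choice is irrelevant because `L w` kills boundaries.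
  obtain ⟨σ, hσ⟩ := (H2π A).hom.exists_rightInverse_of_surjective (LinearMap.range_eq_top.mpr hsurj)
  let Ψ : W →ₗ[F] Module.Dual F (H2 A) :=
    (LinearMap.lcomp F F ((cycles₂ A).subtype ∘ₗ σ)) ∘ₗ L
  have hker : LinearMap.ker Ψ ≤ U := by
    intro w hw
    apply hU
    have hz : LinearMap.ker (d₂₁ A).hom ≤ LinearMap.ker (L w) := by
      intro z hz
      have h1 : (H2π A).hom (⟨z, hz⟩ - σ ((H2π A).hom ⟨z, hz⟩)) = 0 := by
        rw [map_sub, sub_eq_zero]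
        exact (LinearMap.congr_fun hσ ((H2π A).hom ⟨z, hz⟩)).symm
      have h2 := hLb w _ ((H2π_eq_zero_iff _).mp h1)
      have h3 : L w (σ ((H2π A).hom ⟨z, hz⟩)).1 = 0 :=
        LinearMap.congr_fun (LinearMap.mem_ker.mp hw) ((H2π A).hom ⟨z, hz⟩)
      have h4 := map_sub (L w) z (σ ((H2π A).hom ⟨z, hz⟩)).1
      rw [h3, sub_zero] at h4
      exact h4.symm.trans h2
    obtain ⟨ψ, hψ⟩ : ∃ ψ : (G →₀ F) →ₗ[F] F, L w = ψ ∘ₗ (d₂₁ A).hom := by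
      have := LinearMap.range_dualMap_eq_dualAnnihilator_ker (d₂₁ A).hom
      have hm : L w ∈ LinearMap.range (LinearMap.dualMap (d₂₁ A).hom) := by
        rw [this, Submodule.mem_dualAnnihilator]
        exact fun z hz' => hz hz'
      obtain ⟨ψ, hψ⟩ := hm
      exact ⟨ψ, hψ.symm⟩
    refine ⟨fun g => ψ (Finsupp.single g 1), fun g h => ?_⟩
    have h1 := hL w (g, h) 1
    rw [mul_one] at h1
    rw [← h1, hψ, LinearMap.comp_apply]
    have h3 := d₂₁_single (A := A) (g, h) 1
    erw [h3]
    simp only [map_add, map_sub]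
    have h4 : A.ρ g⁻¹ (1 : F) = (1 : F) := rfl
    erw [h4]
    ring
  calc Module.finrank F W = Module.finrank F (LinearMap.range Ψ) + Module.finrank F (LinearMap.ker Ψ) :=
        (LinearMap.finrank_range_add_finrank_ker Ψ).symm
    _ ≤ Module.finrank F (Module.Dual F (H2 A)) + Module.finrank F U :=
        add_le_add (Submodule.finrank_le _) (Submodule.finrank_mono hker)
    _ = _ := by rw [Subspace.dual_finrank_eq]

/-- A functional on first homology is determined by its values on the classes of group elements, and
these form a homomorphism. -/
theorem rank_H1_le (F G : Type u) [Field F] [Group G] [FiniteDimensional F (Additive G →+ F)] :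
    bettiNumber F G 1 ≤ Module.finrank F (Additive G →+ F) := by
  let A := Rep.trivial F G F
  have hA : ∀ z : G →₀ F, z ∈ cycles₁ A := fun z => by
    rw [cycles₁_eq_top_of_isTrivial]; trivial
  let m (g : G) (a : F) : H1 A := mkH1OfIsTrivial A (Additive.ofMul (Abelianization.of g)) a
  have hm : ∀ g a, m g a = H1π A ⟨Finsupp.single g a, hA _⟩ := fun g a => by
    simp only [m]; erw [mkH1OfIsTrivial_apply]
  let Ψ : Module.Dual F (H1 A) →ₗ[F] (Additive G →+ F) :=
    { toFun := fun ℓ =>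
        { toFun := fun g => ℓ (m g.toMul 1)
          map_zero' := by simp [m, -mkH1OfIsTrivial_apply]
          map_add' := fun g h => by simp [m, -mkH1OfIsTrivial_apply] }
      map_add' := fun _ _ => rfl
      map_smul' := fun _ _ => rfl }
  have hΨ : Function.Injective Ψ := by
    rw [← LinearMap.ker_eq_bot, LinearMap.ker_eq_bot']
    intro ℓ hℓ
    let c : (G →₀ F) →ₗ[F] cycles₁ A := LinearMap.codRestrict _ LinearMap.id hA
    have h0 : ℓ ∘ₗ (H1π A).hom ∘ₗ c = 0 := by
      apply Finsupp.lhom_ext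
      intro g a
      have h1 : ℓ (m g 1) = 0 := DFunLike.congr_fun hℓ (Additive.ofMul g)
      rw [hm] at h1
      have h2 : Finsupp.single g a = a • Finsupp.single g (1 : F) := by simp
      rw [h2, map_smul]
      exact (congrArg (a • ·) h1).trans (smul_zero a)
    ext z
    induction z using H1_induction_on with
    | h x => exact LinearMap.congr_fun h0 x.1
  have : FiniteDimensional F (Module.Dual F (H1 A)) := FiniteDimensional.of_injective Ψ hΨ
  have : FiniteDimensional F (H1 A) := Module.finite_dual_iff F |>.mp this
  have h := LinearMap.finrank_le_finrank_of_injective hΨ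
  rw [Subspace.dual_finrank_eq] at h
  rw [bettiNumber, ← Module.finrank_eq_rank]
  exact_mod_cast h

theorem finiteDimensional_hom (F : Type*) [Field F] (G : Type*) [Group G] [Group.FG G] :
    FiniteDimensional F (Additive G →+ F) := by
  obtain ⟨S, hS⟩ := Group.fg_def.mp ‹Group.FG G›
  let Ψ : (Additive G →+ F) →ₗ[F] (S → F) :=
    { toFun := fun φ s => φ (Additive.ofMul s.1)
      map_add' := fun _ _ => rfl
      map_smul' := fun _ _ => rfl }
  refine FiniteDimensional.of_injective Ψ ?_
  rw [← LinearMap.ker_eq_bot, LinearMap.ker_eq_bot']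
  intro φ hφ
  refine AddMonoidHom.ext fun g => ?_
  have hg : g.toMul ∈ Subgroup.closure (S : Set G) := by rw [hS]; trivial
  change φ (Additive.ofMul g.toMul) = 0
  generalize g.toMul = g at hg
  induction hg using Subgroup.closure_induction with
  | mem s hs => exact congrFun hφ ⟨s, hs⟩
  | one => exact map_zero φ
  | mul a b _ _ ha hb => rw [ofMul_mul, map_add, ha, hb, add_zero]
  | inv a _ ha => rw [ofMul_inv, map_neg, ha, neg_zero]

/-- A central extension of a homologically balanced group by a vector space of dimension `k` has
at least `k` independent homomorphisms to the field. -/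
theorem HomologicallyBalanced.finrank_le_of_central (hG : HomologicallyBalanced G)
    {E V : Type*} [Group E] [AddCommGroup V] [Module F V] [FiniteDimensional F V]
    (π : E →* G) (hπ : Function.Surjective π) (ι : Multiplicative V →* E)
    (hι : Function.Injective ι) (hker : ι.range = π.ker) (hc : ∀ v e, ι v * e = e * ι v)
    [FiniteDimensional F (Additive E →+ F)] :
    Module.finrank F V ≤ Module.finrank F (Additive E →+ F) := by
  have := hG.1
  have := finiteDimensional_hom F G
  have hb1 := rank_H1_le F G
  have hb2 := (hG.2 F).trans hb1
  rw [bettiNumber] at hb2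
  have : Module.Finite F (groupHomology (Rep.trivial F G F) 2) :=
    Module.rank_lt_aleph0_iff.mp (hb2.trans_lt (Cardinal.natCast_lt_aleph0))
  rw [← Module.finrank_eq_rank, Nat.cast_le] at hb2
  choose s hs using hπ
  have hex : ∀ e, ∃ v : V, e = ι (Multiplicative.ofAdd v) * s (π e) := by
    intro e
    have : e * (s (π e))⁻¹ ∈ ι.range := by
      rw [hker, MonoidHom.mem_ker, map_mul, map_inv, hs, mul_inv_cancel]
    obtain ⟨v, hv⟩ := this
    exact ⟨v.toAdd, by simp [hv]⟩
  choose v hv using hex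
  have hvuniq : ∀ (w : V) (g : G), v (ι (Multiplicative.ofAdd w) * s g) = w := by
    intro w g
    have h := hv (ι (Multiplicative.ofAdd w) * s g)
    have hg : π (ι (Multiplicative.ofAdd w) * s g) = g := by
      rw [map_mul, hs]
      have : ι (Multiplicative.ofAdd w) ∈ π.ker := hker ▸ ⟨_, rfl⟩
      rw [MonoidHom.mem_ker.mp this, one_mul]
    rw [hg] at h
    exact (hι (mul_right_cancel h)).symm
  have hvmul : ∀ e e', v (e * e') = v e + v e' + v (s (π e) * s (π e')) := by
    intro e e'
    have h : e * e' = ι (Multiplicative.ofAdd (v e + v e' + v (s (π e) * s (π e')))) *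
        s (π e * π e') := by
      have h3 := hv (s (π e) * s (π e'))
      rw [map_mul, hs, hs] at h3
      rw [ofAdd_add, ofAdd_add, map_mul, map_mul, mul_assoc _ _ (s _), ← h3]
      conv_lhs => rw [hv e, hv e']
      rw [mul_assoc, ← mul_assoc (s _), ← hc _ (s _)]
      group
    rw [h, hvuniq]
  have hvs : ∀ g, v (s g) = 0 := fun g => by simpa using hvuniq 0 g
  -- The transgression: a functional on V applied to the factor set of the section s.
  let Θ : Module.Dual F V →ₗ[F] (G × G → F) :=
    { toFun := fun ξ q => ξ (v (s q.1 * s q.2))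
      map_add' := fun _ _ => rfl
      map_smul' := fun _ _ => rfl }
  -- Only homomorphisms that are F-linear on V restrict to elements of the dual of V; their
  -- restrictions contain the kernel of the transgression to second cohomology.
  let H : Submodule F (Additive E →+ F) :=
    { carrier := {φ | ∀ (a : F) (w : V), φ (Additive.ofMul (ι (Multiplicative.ofAdd (a • w)))) =
        a * φ (Additive.ofMul (ι (Multiplicative.ofAdd w)))}
      zero_mem' := fun a w => by simp
      add_mem' := fun {φ ψ} h1 h2 a w => by
        simp only [AddMonoidHom.add_apply, h1 a w, h2 a w, mul_add]
      smul_mem' := fun b φ h1 a w => by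
        simp only [AddMonoidHom.smul_apply, smul_eq_mul, h1 a w]; ring }
  let res : H →ₗ[F] Module.Dual F V :=
    { toFun := fun φ =>
        { toFun := fun w => φ.1 (Additive.ofMul (ι (Multiplicative.ofAdd w)))
          map_add' := fun a b => by rw [ofAdd_add, map_mul, ofMul_mul, map_add]
          map_smul' := fun a w => φ.2 a w }
      map_add' := fun _ _ => rfl
      map_smul' := fun _ _ => rfl }
  have h1 := finrank_le_of_cocycles Θ (fun ξ g h j => by
      have e1 := hvmul (s g * s h) (s j)
      have e2 := hvmul (s g) (s h * s j)
      rw [mul_assoc, e2] at e1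
      simp only [map_mul, hs, hvs] at e1
      have e3 := congrArg ξ e1
      simp only [map_add, map_zero] at e3
      change ξ _ - ξ _ + ξ _ - ξ _ = 0
      linear_combination e3) (LinearMap.range res) (by
    rintro ξ ⟨f, hf⟩
    let Φ : Additive E →+ F := AddMonoidHom.mk' (fun e => ξ (v e.toMul) + f (π e.toMul)) (by
      intro e e'
      have := hf (π e.toMul) (π e'.toMul)
      change ξ _ = _ at this
      rw [toMul_add, hvmul, map_add, map_add, map_mul, this]
      ring)
    have hΦ : ∀ w : V, Φ (Additive.ofMul (ι (Multiplicative.ofAdd w))) = ξ w := by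
      intro w
      have e1 : Φ (Additive.ofMul (s 1)) = f 1 := by
        simp [Φ, hvs, hs]
      have e2 : Φ (Additive.ofMul (ι (Multiplicative.ofAdd w) * s 1)) = ξ w + f 1 := by
        have : π (ι (Multiplicative.ofAdd w)) = 1 :=
          MonoidHom.mem_ker.mp (hker ▸ ⟨_, rfl⟩)
        simp [Φ, hvuniq, hs, this]
      rw [ofMul_mul, map_add, e1] at e2
      exact add_right_cancel e2
    exact ⟨⟨Φ, fun a w => by rw [hΦ, hΦ, map_smul, smul_eq_mul]⟩, LinearMap.ext hΦ⟩)
  have h2 : Module.finrank F (Additive G →+ F) ≤ Module.finrank F (LinearMap.ker res) := by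
    let m : (Additive G →+ F) →ₗ[F] LinearMap.ker res :=
      { toFun := fun φ => ⟨⟨φ.comp π.toAdditive, fun a w => by
            have : ∀ w, π (ι w) = 1 := fun w => MonoidHom.mem_ker.mp (hker ▸ ⟨_, rfl⟩)
            simp [this]⟩, by
          have : ∀ w, π (ι w) = 1 := fun w => MonoidHom.mem_ker.mp (hker ▸ ⟨_, rfl⟩)
          ext w
          simp [res, this]⟩
        map_add' := fun _ _ => rfl
        map_smul' := fun _ _ => rfl }
    refine LinearMap.finrank_le_finrank_of_injective (f := m) ?_
    intro φ ψ h
    refine AddMonoidHom.ext fun g => ?_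
    have := DFunLike.congr_fun (congrArg (fun z => z.1.1) h) (Additive.ofMul (s g.toMul))
    simpa [m, hs] using this
  have h3 := LinearMap.finrank_range_add_finrank_ker (K := F) (V := H) res
  have h4 := Submodule.finrank_le H
  rw [Subspace.dual_finrank_eq] at h1
  omega

end Homology

end NilGrp


universe v

namespace NilGrp

open scoped commutatorElement

/-! ### Central extensions of G assembled from a central extension of K. -/

section ZSemidirect

variable {N H : Type*} [Group N] [Group H]

theorem map_zpow_aut (β : MulAut N) (θ : N →* H) (s : H) (h : ∀ k, θ (β k) = s * θ k * s⁻¹)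
    (n : ℤ) (k : N) : θ ((β ^ n) k) = s ^ n * θ k * (s ^ n)⁻¹ := by
  induction n using Int.induction_on generalizing k with
  | zero => simp
  | succ n ih =>
    rw [zpow_add_one, MulAut.mul_apply, ih, h, zpow_add_one]
    group
  | pred n ih =>
    have h' : θ (β⁻¹ k) = s⁻¹ * θ k * s := by
      have := h (β⁻¹ k)
      rw [MulAut.apply_inv_self] at this
      rw [this]; group
    rw [zpow_sub_one, MulAut.mul_apply, ih, h', zpow_sub_one]
    group

/-- The semidirect product of `N` with the infinite cyclic group generated by an automorphism. -/
abbrev ZSemi (β : MulAut N) : Type _ := N ⋊[zpowersHom (MulAut N) β] Multiplicative ℤ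

namespace ZSemi

variable {β : MulAut N}

/-- The generator of the complement of `N` in `ZSemi β`. -/
def gen : ZSemi β := SemidirectProduct.inr (Multiplicative.ofAdd 1)

/-- The universal property of `ZSemi β`. -/
def lift (θ : N →* H) (s : H) (h : ∀ k, θ (β k) = s * θ k * s⁻¹) : ZSemi β →* H :=
  SemidirectProduct.lift θ (zpowersHom H s) (by
    intro n
    ext k
    simpa [zpowersHom_apply, ← map_zpow] using map_zpow_aut β θ s h n.toAdd k)

theorem lift_inl (θ : N →* H) (s : H) (h : ∀ k, θ (β k) = s * θ k * s⁻¹) (k : N) :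
    lift θ s h (SemidirectProduct.inl k) = θ k := by
  simp [lift]

theorem lift_gen (θ : N →* H) (s : H) (h : ∀ k, θ (β k) = s * θ k * s⁻¹) :
    lift θ s h gen = s := by
  simp [lift, gen]

theorem hom_ext {θ ψ : ZSemi β →* H}
    (h1 : ∀ k, θ (SemidirectProduct.inl k) = ψ (SemidirectProduct.inl k))
    (h2 : θ gen = ψ gen) : θ = ψ :=
  SemidirectProduct.hom_ext (MonoidHom.ext h1) (MonoidHom.ext_mint h2)

theorem eq_inl_mul_gen_zpow (e : ZSemi β) :
    e = SemidirectProduct.inl e.left * gen ^ e.right.toAdd := by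
  conv_lhs => rw [← SemidirectProduct.inl_left_mul_inr_right e]
  rw [gen, ← map_zpow, ← ofAdd_zsmul]
  simp

theorem gen_mul_inl (k : N) :
    (gen : ZSemi β) * SemidirectProduct.inl k * gen⁻¹ = SemidirectProduct.inl (β k) := by
  have := SemidirectProduct.inl_aut (φ := zpowersHom (MulAut N) β) (Multiplicative.ofAdd 1) k
  simpa [gen, zpowersHom_apply] using this.symm

end ZSemi

end ZSemidirect

/-- The elements `x` and `y` of `G` map to a basis of a free abelian quotient `G / K`. -/
structure IsZSqBasis {G : Type*} [Group G] (K : Subgroup G) (x y : G) : Prop where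
  commutator_mem : ⁅x, y⁆ ∈ K
  exists_eq : ∀ g : G, ∃ k ∈ K, ∃ i j : ℤ, g = k * y ^ j * x ^ i
  eq_zero : ∀ i j : ℤ, y ^ j * x ^ i ∈ K → i = 0 ∧ j = 0

/-- A central extension by `V` of a normal subgroup `K` of `G`, with the data that extend it to a
central extension of `G` when `G / K` is free abelian with basis `x`, `y`. -/
structure CentralLift {G : Type*} [Group G] (K : Subgroup G) (x y : G) (V Kt : Type*)
    [AddCommGroup V] [Group Kt] where
  /-- The projection to `K`. -/
  π : Kt →* G
  /-- The inclusion of the kernel. -/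
  ι : Multiplicative V →* Kt
  /-- The lift of conjugation by `x`. -/
  α : Kt →* Kt
  /-- The lift of conjugation by `y`. -/
  β : Kt →* Kt
  /-- The lift of the commutator of `x` and `y`. -/
  τ : Kt
  range_π : π.range = K
  ι_inj : Function.Injective ι
  range_ι : ι.range = π.ker
  ι_central : ∀ v k, ι v * k = k * ι v
  α_ι : ∀ v, α (ι v) = ι v
  β_ι : ∀ v, β (ι v) = ι v
  π_α : ∀ k, π (α k) = x * π k * x⁻¹
  π_β : ∀ k, π (β k) = y * π k * y⁻¹
  π_τ : π τ = ⁅x, y⁆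
  comm : ∀ k, α (β k) = τ * β (α k) * τ⁻¹

namespace CentralLift

variable {G : Type*} [Group G] {K : Subgroup G} {x y : G} {V Kt : Type*}
    [AddCommGroup V] [Group Kt]

theorem π_ι (D : CentralLift K x y V Kt) (v : Multiplicative V) : D.π (D.ι v) = 1 :=
  MonoidHom.mem_ker.mp (D.range_ι ▸ ⟨v, rfl⟩)

theorem π_mem (D : CentralLift K x y V Kt) (k : Kt) : D.π k ∈ K :=
  (SetLike.ext_iff.mp D.range_π _).mp ⟨k, rfl⟩

theorem exists_π (D : CentralLift K x y V Kt) {g : G} (hg : g ∈ K) : ∃ k, D.π k = g :=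
  (SetLike.ext_iff.mp D.range_π _).mpr hg

theorem exists_ι (D : CentralLift K x y V Kt) {k : Kt} (hk : D.π k = 1) : ∃ v, D.ι v = k :=
  (SetLike.ext_iff.mp D.range_ι _).mpr hk

/-- The five lemma: γ is the identity on the central kernel and a conjugation on K. -/
theorem bijective_of_lift [K.Normal] (D : CentralLift K x y V Kt) (γ : Kt →* Kt) (g : G)
    (hι : ∀ v, γ (D.ι v) = D.ι v) (hπ : ∀ k, D.π (γ k) = g * D.π k * g⁻¹) :
    Function.Bijective γ := by
  constructor
  · rw [injective_iff_map_eq_one]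
    intro k hk
    have h1 := hπ k
    rw [hk, map_one] at h1
    have h2 : D.π k = 1 := by
      have : D.π k = g⁻¹ * (g * D.π k * g⁻¹) * g := by group
      rw [this, ← h1]; group
    obtain ⟨v, rfl⟩ := D.exists_ι h2
    rwa [hι] at hk
  · intro k
    obtain ⟨k', hk'⟩ := D.exists_π (g := g⁻¹ * D.π k * g) (by
      simpa using Subgroup.Normal.conj_mem inferInstance _ (D.π_mem k) g⁻¹)
    obtain ⟨v, hv⟩ := D.exists_ι (k := k * (γ k')⁻¹) (by
      rw [map_mul, map_inv, hπ, hk']; group)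
    exact ⟨D.ι v * k', by rw [map_mul, hι, hv]; group⟩

/-- The homomorphisms from `Kt` to `F` that are invariant under the two lifts. -/
def invariantHom (D : CentralLift K x y V Kt) (F : Type*) [Field F] : Submodule F (Kt → F) where
  carrier := {φ | (∀ k l, φ (k * l) = φ k + φ l) ∧ (∀ k, φ (D.α k) = φ k) ∧
    (∀ k, φ (D.β k) = φ k)}
  zero_mem' := by simp
  add_mem' := by
    rintro φ ψ ⟨h1, h2, h3⟩ ⟨h4, h5, h6⟩
    refine ⟨fun k l => ?_, fun k => ?_, fun k => ?_⟩ <;> simp only [Pi.add_apply, *]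
    ring
  smul_mem' := by
    rintro c φ ⟨h1, h2, h3⟩
    refine ⟨fun k l => ?_, fun k => ?_, fun k => ?_⟩ <;> simp only [Pi.smul_apply, *, smul_add]

/-- The invariant homomorphisms that vanish on the lift of the commutator. -/
def vanishingHom (D : CentralLift K x y V Kt) (F : Type*) [Field F] : Submodule F (Kt → F) where
  carrier := {φ | φ ∈ D.invariantHom F ∧ φ D.τ = 0}
  zero_mem' := ⟨zero_mem _, rfl⟩
  add_mem' := by
    rintro φ ψ ⟨h1, h2⟩ ⟨h4, h5⟩
    exact ⟨add_mem h1 h4, by rw [Pi.add_apply, h2, h5, add_zero]⟩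
  smul_mem' := by
    rintro c φ ⟨h1, h2⟩
    exact ⟨Submodule.smul_mem _ _ h1, by rw [Pi.smul_apply, h2, smul_zero]⟩

end CentralLift

-- The extension is an iterated semidirect product (Kt ⋊ ℤ) ⋊ ℤ: the first generator Y acts by β,
-- the second generator X acts by α on Kt and sends Y to τY. The field `comm` is exactly what makes
-- the second action well defined.
open SemidirectProduct in
theorem CentralLift.exists_extension {G : Type*} [Group G] {K : Subgroup G} [K.Normal] {x y : G}
    {V : Type*} {Kt : Type v} [AddCommGroup V] [Group Kt] (D : CentralLift K x y V Kt) :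
    ∃ (E : Type v) (_ : Group E) (πE : E →* G) (m : Kt →* E) (X Y : E),
      Function.Injective m ∧ (∀ k, πE (m k) = D.π k) ∧ πE X = x ∧ πE Y = y ∧
      (∀ k, X * m k * X⁻¹ = m (D.α k)) ∧ (∀ k, Y * m k * Y⁻¹ = m (D.β k)) ∧
      X * Y * X⁻¹ = m D.τ * Y ∧ ∀ e, ∃ k, ∃ i j : ℤ, e = m k * Y ^ j * X ^ i := by
  let a : MulAut Kt := MulEquiv.ofBijective D.α (D.bijective_of_lift _ _ D.α_ι D.π_α)
  let b : MulAut Kt := MulEquiv.ofBijective D.β (D.bijective_of_lift _ _ D.β_ι D.π_β)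
  have hab : ∀ k, a (b k) = D.τ * b (a k) * D.τ⁻¹ := D.comm
  have hπa : ∀ k, D.π (a k) = x * D.π k * x⁻¹ := D.π_α
  have hπb : ∀ k, D.π (b k) = y * D.π k * y⁻¹ := D.π_β
  have hA1 : ∀ k, (inl.comp a.toMonoidHom) (b k) = (inl D.τ * ZSemi.gen : ZSemi b) *
      (inl.comp a.toMonoidHom) k * (inl D.τ * ZSemi.gen)⁻¹ := by
      intro k
      have := ZSemi.gen_mul_inl (β := b) (a k)
      simp only [MonoidHom.comp_apply, MulEquiv.coe_toMonoidHom, hab, map_mul, map_inv, ← this]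
      group
  let A1 : ZSemi b →* ZSemi b := ZSemi.lift (inl.comp a.toMonoidHom) (inl D.τ * ZSemi.gen) hA1
  -- The inverse of `A1`; the image of the generator is forced by solving A1(k · gen) = gen for k.
  let A2 : ZSemi b →* ZSemi b :=
    ZSemi.lift (inl.comp a⁻¹.toMonoidHom) (inl (a⁻¹ D.τ)⁻¹ * ZSemi.gen) (by
      intro k
      have h1 := ZSemi.gen_mul_inl (β := b) (a⁻¹ k)
      have h2 := hab (a⁻¹ k)
      have h3 : a⁻¹ (b k) = (a⁻¹ D.τ)⁻¹ * b (a⁻¹ k) * a⁻¹ D.τ := by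
        apply a.injective
        rw [map_mul, map_mul, map_inv, MulAut.apply_inv_self, MulAut.apply_inv_self, h2,
          MulAut.apply_inv_self]
        group
      simp only [MonoidHom.comp_apply, MulEquiv.coe_toMonoidHom, h3, map_mul, map_inv, ← h1]
      group)
  have h12 : A1.comp A2 = MonoidHom.id _ := by
    apply ZSemi.hom_ext
    · intro k; simp [A1, A2, ZSemi.lift_inl]
    · simp [A1, A2, ZSemi.lift_inl, ZSemi.lift_gen]
  have h21 : A2.comp A1 = MonoidHom.id _ := by
    apply ZSemi.hom_ext
    · intro k; simp [A1, A2, ZSemi.lift_inl]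
    · simp [A1, A2, ZSemi.lift_inl, ZSemi.lift_gen]
  let A : MulAut (ZSemi b) := MonoidHom.toMulEquiv A1 A2 h21 h12
  have hAinl : ∀ k, A (inl k) = inl (a k) := fun k => ZSemi.lift_inl _ _ hA1 k
  have hAgen : A ZSemi.gen = inl D.τ * ZSemi.gen := ZSemi.lift_gen _ _ hA1
  let πL : ZSemi b →* G := ZSemi.lift D.π y hπb
  have hπLinl : ∀ k, πL (inl k) = D.π k := fun k => ZSemi.lift_inl _ _ _ k
  have hπLgen : πL ZSemi.gen = y := ZSemi.lift_gen _ _ _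
  have hπL : ∀ l, πL (A l) = x * πL l * x⁻¹ := by
    have : πL.comp A.toMonoidHom = (MulAut.conj x).toMonoidHom.comp πL := by
      apply ZSemi.hom_ext
      · intro k
        simp [hAinl, hπLinl, hπa]
      · simp [hAgen, hπLinl, hπLgen, D.π_τ, commutatorElement_def]
    exact fun l => DFunLike.congr_fun this l
  refine ⟨ZSemi A, inferInstance, ZSemi.lift πL x hπL, inl.comp inl, ZSemi.gen, inl ZSemi.gen,
    inl_injective.comp inl_injective, fun k => ?_, ZSemi.lift_gen _ _ _, ?_, fun k => ?_,
    fun k => ?_, ?_, fun e => ?_⟩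
  · simp [ZSemi.lift_inl, hπLinl]
  · rw [ZSemi.lift_inl, hπLgen]
  · exact (ZSemi.gen_mul_inl _).trans (congrArg inl (hAinl k))
  · exact (congrArg (inl (φ := zpowersHom _ A)) (ZSemi.gen_mul_inl (β := b) k) :)
  · exact (ZSemi.gen_mul_inl _).trans ((congrArg inl hAgen).trans (map_mul inl _ _))
  · refine ⟨e.left.left, e.right.toAdd, e.left.right.toAdd, ?_⟩
    conv_lhs => rw [ZSemi.eq_inl_mul_gen_zpow e, ZSemi.eq_inl_mul_gen_zpow e.left]
    rw [map_mul, map_zpow]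
    rfl

/-- A homomorphism from the extension to F is given by its values at X and Y, which account for the
2, and its restriction to Kt, which is invariant and kills τ because XYX⁻¹ = τY. -/
theorem CentralLift.finrank_le_vanishing {G : Type u} [Group G] (hG : HomologicallyBalanced G)
    {K : Subgroup G} [K.Normal] {x y : G} (hxy : IsZSqBasis K x y) {F : Type u} [Field F]
    {V Kt : Type*} [AddCommGroup V] [Module F V] [FiniteDimensional F V] [Group Kt]
    (D : CentralLift K x y V Kt) [FiniteDimensional F (D.vanishingHom F)] :
    Module.finrank F V ≤ Module.finrank F (D.vanishingHom F) + 2 := by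
  obtain ⟨E, _, πE, m, X, Y, hm, hπm, hπX, hπY, hX, hY, hXY, hdec⟩ := D.exists_extension
  have hinv : ∀ (φ : Additive E →+ F) (g h : E), φ (.ofMul (g * h * g⁻¹)) = φ (.ofMul h) := by
    intro φ g h; simp
  let res : (Additive E →+ F) →ₗ[F] (D.vanishingHom F × (F × F)) :=
    { toFun := fun φ => ⟨⟨fun k => φ (.ofMul (m k)), by
          refine ⟨⟨fun k l => ?_, fun k => ?_, fun k => ?_⟩, ?_⟩
          · beta_reduce; rw [map_mul, ofMul_mul, map_add]
          · have := hinv φ X (m k)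
            rwa [hX] at this
          · have := hinv φ Y (m k)
            rwa [hY] at this
          · have := hinv φ X Y
            rw [hXY, ofMul_mul, map_add] at this
            exact add_eq_right.mp this⟩, φ (.ofMul Y), φ (.ofMul X)⟩
      map_add' := fun _ _ => rfl
      map_smul' := fun _ _ => rfl }
  have hres : Function.Injective res := by
    rw [injective_iff_map_eq_zero]
    intro φ hφ
    have h1 := congrArg (fun z => z.1.1) hφ
    have h2 : φ (.ofMul Y) = 0 := congrArg (fun z => z.2.1) hφ
    have h3 : φ (.ofMul X) = 0 := congrArg (fun z => z.2.2) hφ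
    have h4 : ∀ k, φ (.ofMul (m k)) = 0 := fun k => congrFun h1 k
    refine AddMonoidHom.ext fun e => ?_
    obtain ⟨k, i, j, h⟩ := hdec e.toMul
    rw [← ofMul_toMul e, h]
    simp [h2, h3, h4]
  have : FiniteDimensional F (Additive E →+ F) := FiniteDimensional.of_injective res hres
  have hdim := LinearMap.finrank_le_finrank_of_injective hres
  have hbal := hG.finrank_le_of_central (F := F) πE (fun g => by
      obtain ⟨k, hk, i, j, rfl⟩ := hxy.exists_eq g
      obtain ⟨k, rfl⟩ := D.exists_π hk
      exact ⟨m k * Y ^ j * X ^ i, by simp only [map_mul, map_zpow, hπm, hπX, hπY]⟩)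
    (m.comp D.ι) (hm.comp D.ι_inj) (by
      apply le_antisymm
      · rintro _ ⟨v, rfl⟩
        simp [MonoidHom.mem_ker, hπm, D.π_ι]
      · intro e he
        rw [MonoidHom.mem_ker] at he
        obtain ⟨k, i, j, rfl⟩ := hdec e
        simp only [map_mul, map_zpow, hπm, hπX, hπY] at he
        have h6 : y ^ j * x ^ i ∈ K := by
          have h7 : y ^ j * x ^ i = D.π k⁻¹ := by
            rw [map_inv, eq_inv_iff_mul_eq_one, mul_eq_one_iff_eq_inv', ← mul_eq_one_iff_eq_inv',
              mul_eq_one_iff_eq_inv, eq_comm, inv_eq_iff_mul_eq_one, ← mul_assoc, he]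
          exact h7 ▸ D.π_mem _
        obtain ⟨rfl, rfl⟩ := hxy.eq_zero _ _ h6
        simp only [zpow_zero, mul_one] at he
        obtain ⟨v, rfl⟩ := D.exists_ι he
        exact ⟨v, by simp⟩) (by
      intro v e
      obtain ⟨k, i, j, rfl⟩ := hdec e
      have h1 : Commute (m (D.ι v)) (m k) := by
        change m _ * m _ = m _ * m _
        rw [← map_mul, D.ι_central, map_mul]
      have h2 : Commute (m (D.ι v)) Y := by
        have := hY (D.ι v)
        rw [D.β_ι] at this
        exact (mul_inv_eq_iff_eq_mul.mp this).symm
      have h3 : Commute (m (D.ι v)) X := by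
        have := hX (D.ι v)
        rw [D.α_ι] at this
        exact (mul_inv_eq_iff_eq_mul.mp this).symm
      exact (h1.mul_right (h2.zpow_right j)).mul_right (h3.zpow_right i))
  simp only [Module.finrank_prod, Module.finrank_self] at hdim
  omega

/-- The central lift obtained by adding a new central element to the lift of the commutator. -/
def CentralLift.prod {G : Type*} [Group G] {K : Subgroup G} {x y : G} {V Kt : Type*}
    [AddCommGroup V] [Group Kt] (D : CentralLift K x y V Kt) (F : Type*) [Field F] :
    CentralLift K x y (V × F) (Kt × Multiplicative F) where
  π := D.π.comp (MonoidHom.fst _ _)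
  ι :=
    { toFun := fun v => (D.ι (.ofAdd v.toAdd.1), .ofAdd v.toAdd.2)
      map_one' := Prod.ext (map_one D.ι) rfl
      map_mul' := fun v w => Prod.ext (map_mul D.ι _ _) rfl }
  α := D.α.prodMap (MonoidHom.id _)
  β := D.β.prodMap (MonoidHom.id _)
  τ := (D.τ, .ofAdd 1)
  range_π := le_antisymm (by rintro _ ⟨k, rfl⟩; exact D.π_mem k.1) fun g hg => by
    obtain ⟨k, rfl⟩ := D.exists_π hg
    exact ⟨(k, 1), rfl⟩
  ι_inj := by
    intro v w h
    have h1 := D.ι_inj (congrArg Prod.fst h)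
    have h2 := congrArg Prod.snd h
    exact Prod.ext h1 h2
  range_ι := by
    ext k
    constructor
    · rintro ⟨v, rfl⟩
      exact D.π_ι _
    · intro hk
      obtain ⟨v, hv⟩ := D.exists_ι hk
      exact ⟨.ofAdd (v.toAdd, k.2.toAdd), Prod.ext hv rfl⟩
  ι_central := fun v k => Prod.ext (D.ι_central _ _) (mul_comm _ _)
  α_ι := fun v => Prod.ext (D.α_ι _) rfl
  β_ι := fun v => Prod.ext (D.β_ι _) rfl
  π_α := fun k => D.π_α k.1
  π_β := fun k => D.π_β k.1
  π_τ := D.π_τ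
  comm := fun k => Prod.ext (D.comm k.1) (by simp)

/-- Enlarging V by F and twisting τ by a generator of F raises the left side by one, while the
condition at the new τ determines a homomorphism on the added factor. This trades the vanishing
condition for one unit in the bound. That F is a prime field is used to recover a homomorphism on F
from its value at 1. -/
theorem CentralLift.finrank_le {G : Type u} [Group G] (hG : HomologicallyBalanced G)
    {K : Subgroup G} [K.Normal] {x y : G} (hxy : IsZSqBasis K x y) {F : Type u} [Field F]
    (hF : ∀ c : F, ∃ n : ℕ, c = n) {V Kt : Type*} [AddCommGroup V] [Module F V]
    [FiniteDimensional F V] [Group Kt] (D : CentralLift K x y V Kt)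
    [FiniteDimensional F (D.invariantHom F)] :
    Module.finrank F V ≤ Module.finrank F (D.invariantHom F) + 1 := by
  let res : (D.prod F).vanishingHom F →ₗ[F] D.invariantHom F :=
    { toFun := fun φ => ⟨fun k => φ.1 (k, 1), fun k l => by
          rw [← φ.2.1.1]; simp, fun k => φ.2.1.2.1 (k, 1), fun k => φ.2.1.2.2 (k, 1)⟩
      map_add' := fun _ _ => rfl
      map_smul' := fun _ _ => rfl }
  have hres : Function.Injective res := by
    rw [injective_iff_map_eq_zero]
    rintro ⟨φ, hφ1, hφ2⟩ hφ
    have hmul : ∀ a b, φ (a * b) = φ a + φ b := hφ1.1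
    have h1 : ∀ k : Kt, φ (k, 1) = 0 := fun k => congrFun (congrArg Subtype.val hφ) k
    have h2 : φ ((1 : Kt), Multiplicative.ofAdd (1 : F)) = 0 := by
      have h3 : ((D.prod F).τ) = (D.τ, 1) * (1, .ofAdd 1) :=
        Prod.ext (mul_one _).symm (one_mul _).symm
      rwa [h3, hmul, h1, zero_add] at hφ2
    apply Subtype.ext
    funext ⟨k, c⟩
    have h4 : ∀ n : ℕ, φ ((1 : Kt), Multiplicative.ofAdd (n : F)) = 0 := by
      intro n
      induction n with
      | zero => simpa using h1 1
      | succ n ih =>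
        have : ((1 : Kt), Multiplicative.ofAdd ((n + 1 : ℕ) : F)) =
            (1, Multiplicative.ofAdd (n : F)) * (1, Multiplicative.ofAdd (1 : F)) :=
          Prod.ext (one_mul _).symm (by simp)
        rw [this, hmul, ih, h2, add_zero]
    obtain ⟨n, hn⟩ := hF c.toAdd
    have h5 : c = Multiplicative.ofAdd (n : F) := hn
    have h6 : ((k, c) : Kt × Multiplicative F) = (k, 1) * (1, c) :=
      Prod.ext (mul_one _).symm (one_mul _).symm
    change φ (k, c) = 0
    rw [h6, hmul, h1, h5, h4, add_zero]
  have : FiniteDimensional F ((D.prod F).vanishingHom F) := FiniteDimensional.of_injective res hres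
  have h1 := LinearMap.finrank_le_finrank_of_injective hres
  have h2 := (D.prod F).finrank_le_vanishing hG hxy (F := F)
  simp only [Module.finrank_prod, Module.finrank_self] at h2
  omega

end NilGrp


/-! ### The extension given by a presentation of the abelianization of K, and its torsion-freeness.
-/

namespace NilGrp

open scoped commutatorElement

open Polynomial

theorem BiPoly.exists_eq_int_add (z : BiPoly) :
    ∃ (n : ℤ) (a b : BiPoly), z = (n : BiPoly) + x * a + y * b := by
  refine ⟨(z.coeff 0).coeff 0, C (z.coeff 0).divX, z.divX, ?_⟩
  have h1 := Polynomial.X_mul_divX_add z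
  have h2 := congrArg C (Polynomial.X_mul_divX_add (z.coeff 0))
  rw [map_add, map_mul] at h2
  have h3 : (((z.coeff 0).coeff 0 : ℤ) : BiPoly) = C (C ((z.coeff 0).coeff 0)) := by simp
  rw [h3, x, y]
  linear_combination -h1 - h2

section Extension

/-- The class of an element of `K` in the abelianization of `K`, written additively. -/
def abMk {K : Type*} [Group K] (k : K) : Additive (Abelianization K) :=
  Additive.ofMul (Abelianization.of k)

theorem abMk_mul {K : Type*} [Group K] (k l : K) : abMk (k * l) = abMk k + abMk l := rfl

theorem abMk_inv {K : Type*} [Group K] (k : K) : abMk k⁻¹ = -abMk k := rfl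

theorem abMk_one {K : Type*} [Group K] : abMk (1 : K) = 0 := rfl

theorem abMk_surjective {K : Type*} [Group K] :
    Function.Surjective (abMk : K → Additive (Abelianization K)) :=
  fun b => QuotientGroup.mk_surjective b.toMul

theorem abMk_eq_zero {K : Type*} [Group K] {k : K} : abMk k = 0 ↔ k ∈ commutator K :=
  QuotientGroup.eq_one_iff k

variable {G : Type*} [Group G] {K : Subgroup G} [K.Normal] {W : Type*} [AddCommGroup W]

/-- The pullback of the abelianization of `K` along a homomorphism `q`. -/
def abPullback (q : W →+ Additive (Abelianization K)) : Subgroup (K × Multiplicative W) where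
  carrier := {z | abMk z.1 = q z.2.toAdd}
  one_mem' := (map_zero q).symm
  mul_mem' := by
    intro a b ha hb
    simp only [Set.mem_ofPred_eq] at *
    rw [Prod.fst_mul, Prod.snd_mul, abMk_mul, ha, hb, toAdd_mul, map_add]
  inv_mem' := by
    intro a ha
    simp only [Set.mem_ofPred_eq] at *
    rw [Prod.fst_inv, Prod.snd_inv, abMk_inv, ha, toAdd_inv, map_neg]

variable [Module BiPoly W]

/-- The endomorphism of the pullback given by conjugation with `g` and by multiplication with
`1 + c`. -/
noncomputable def abPullbackMap (q : W →+ Additive (Abelianization K)) (g : G) (c : BiPoly)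
    (h : ∀ k w, abMk k = q w → abMk (MulAut.conjNormal g k : K) = q ((1 + c) • w)) :
    abPullback q →* abPullback q where
  toFun z := ⟨(MulAut.conjNormal g z.1.1, .ofAdd ((1 + c) • z.1.2.toAdd)), h _ _ z.2⟩
  map_one' := Subtype.ext (Prod.ext (map_one _) (smul_zero (A := W) _))
  map_mul' _ _ := Subtype.ext (Prod.ext (map_mul _ _ _) (smul_add (A := W) _ _ _))

/-- The central lift defined by a presentation of the abelianization of `K`. -/
noncomputable def abCentralLift {x y : G} (hxy : IsZSqBasis K x y)
    [Module BiPoly (Additive (Abelianization K))]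
    (hx : ∀ k : K, BiPoly.x • abMk k = abMk (MulAut.conjNormal x k) - abMk k)
    (hy : ∀ k : K, BiPoly.y • abMk k = abMk (MulAut.conjNormal y k) - abMk k)
    (q : W →ₗ[BiPoly] Additive (Abelianization K)) (hq : Function.Surjective q)
    (hU : ∀ u, q u = 0 → BiPoly.x • u = 0 ∧ BiPoly.y • u = 0) :
    CentralLift K x y (LinearMap.ker q) (abPullback q.toAddMonoidHom) where
  π := K.subtype.comp ((MonoidHom.fst _ _).comp (abPullback q.toAddMonoidHom).subtype)
  ι :=
    { toFun := fun u => ⟨(1, .ofAdd u.toAdd.1), u.toAdd.2.symm⟩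
      map_one' := rfl
      map_mul' := fun a b => Subtype.ext (Prod.ext (one_mul _).symm rfl) }
  α := abPullbackMap _ x BiPoly.x (fun k w h => by
    have h1 := hx k
    rw [h] at h1
    change _ = q _
    rw [map_smul, add_smul, one_smul]
    exact (eq_add_of_sub_eq' h1.symm))
  β := abPullbackMap _ y BiPoly.y (fun k w h => by
    have h1 := hy k
    rw [h] at h1
    change _ = q _
    rw [map_smul, add_smul, one_smul]
    exact (eq_add_of_sub_eq' h1.symm))
  τ := ⟨(⟨⁅x, y⁆, hxy.commutator_mem⟩,
    .ofAdd (hq (abMk ⟨⁅x, y⁆, hxy.commutator_mem⟩)).choose), 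
    (hq (abMk ⟨⁅x, y⁆, hxy.commutator_mem⟩)).choose_spec.symm⟩
  range_π := le_antisymm (by rintro _ ⟨z, rfl⟩; exact z.1.1.2) fun g hg => by
    obtain ⟨w, hw⟩ := hq (abMk ⟨g, hg⟩)
    exact ⟨⟨(⟨g, hg⟩, .ofAdd w), hw.symm⟩, rfl⟩
  ι_inj := fun u v h => Subtype.ext (congrArg (fun z => z.1.2.toAdd) h)
  range_ι := by
    apply le_antisymm
    · rintro _ ⟨u, rfl⟩; rfl
    · rintro ⟨⟨k, w⟩, hz⟩ h
      have hk : k = 1 := Subtype.ext h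
      subst hk
      exact ⟨.ofAdd ⟨w.toAdd, hz.symm⟩, rfl⟩
  ι_central := fun u z => Subtype.ext (Prod.ext ((one_mul _).trans (mul_one _).symm) (mul_comm _ _))
  α_ι := fun u => Subtype.ext (Prod.ext (map_one _) (by
    change (1 + BiPoly.x) • u.toAdd.1 = u.toAdd.1
    rw [add_smul, one_smul, (hU _ u.toAdd.2).1, add_zero]))
  β_ι := fun u => Subtype.ext (Prod.ext (map_one _) (by
    change (1 + BiPoly.y) • u.toAdd.1 = u.toAdd.1
    rw [add_smul, one_smul, (hU _ u.toAdd.2).2, add_zero]))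
  π_α := fun k => rfl
  π_β := fun k => rfl
  π_τ := rfl
  comm := fun z => Subtype.ext (Prod.ext (Subtype.ext (by
      change x * (y * _ * y⁻¹) * x⁻¹ = ⁅x, y⁆ * (y * (x * _ * x⁻¹) * y⁻¹) * ⁅x, y⁆⁻¹
      rw [commutatorElement_def]; group)) (by
      set w0 := (hq (abMk ⟨⁅x, y⁆, hxy.commutator_mem⟩)).choose
      change (1 + BiPoly.x) • (1 + BiPoly.y) • _ =
        w0 + (1 + BiPoly.y) • (1 + BiPoly.x) • z.1.2.toAdd + - w0
      rw [smul_comm]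
      abel))

/-- Invariant homomorphisms on the pullback factor through W modulo xW + yW, so they are determined
by their values on the n generators. -/
theorem finrank_ker_le {G : Type u} [Group G] (hG : HomologicallyBalanced G)
    {K : Subgroup G} [K.Normal] {x y : G} (hxy : IsZSqBasis K x y) {F : Type u} [Field F]
    (hF : ∀ c : F, ∃ n : ℕ, c = n) {W : Type*} [AddCommGroup W] [Module BiPoly W]
    [Module BiPoly (Additive (Abelianization K))]
    (hx : ∀ k : K, BiPoly.x • abMk k = abMk (MulAut.conjNormal x k) - abMk k)
    (hy : ∀ k : K, BiPoly.y • abMk k = abMk (MulAut.conjNormal y k) - abMk k)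
    (q : W →ₗ[BiPoly] Additive (Abelianization K)) (hq : Function.Surjective q)
    (hU : ∀ u, q u = 0 → BiPoly.x • u = 0 ∧ BiPoly.y • u = 0)
    {n : ℕ} (e : Fin n → W) (he : Submodule.span BiPoly (Set.range e) = ⊤)
    [Module F (LinearMap.ker q)] [FiniteDimensional F (LinearMap.ker q)] :
    Module.finrank F (LinearMap.ker q) ≤ n + 1 := by
  let D := abCentralLift hxy hx hy q hq hU
  let Q := abPullback q.toAddMonoidHom
  have hlift : ∀ w : W, ∃ k : K, ((k, .ofAdd w) : K × Multiplicative W) ∈ Q := fun w =>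
    abMk_surjective (q w)
  choose s hs using hlift
  -- Two elements with the same W-component differ by an element of [K, K] × 1, which is the
  -- commutator subgroup of the pullback since the pullback surjects onto K and W is abelian.
  have hwd : ∀ φ ∈ D.invariantHom F, ∀ z z' : Q, z.1.2 = z'.1.2 → φ z = φ z' := by
    rintro φ ⟨hmul, -, -⟩ z z' hzz
    let Φ : Q →* Multiplicative F :=
      MonoidHom.mk' (fun z => .ofAdd (φ z)) (fun a b => congrArg _ (hmul a b))
    have hsurj : Function.Surjective ((MonoidHom.fst _ _).comp Q.subtype) := by
      intro k
      obtain ⟨w, hw⟩ := hq (abMk k)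
      exact ⟨⟨(k, .ofAdd w), hw.symm⟩, rfl⟩
    have hmem : (z * z'⁻¹).1.1 ∈ commutator K := by
      rw [← abMk_eq_zero]
      have h : abMk (z * z'⁻¹).1.1 = q (z * z'⁻¹).1.2.toAdd := (z * z'⁻¹).2
      rw [h]
      have : (z * z'⁻¹).1.2 = 1 := by simp [hzz]
      rw [this, toAdd_one, map_zero]
    rw [commutator_def, ← Subgroup.map_top_of_surjective _ hsurj, ← Subgroup.map_commutator,
      ← commutator_def] at hmem
    obtain ⟨c, hc, hcz⟩ := hmem
    have h1 : Φ c = 1 := Abelianization.commutator_subset_ker Φ hc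
    have h2 : c.1.2 = 1 :=
      Abelianization.commutator_subset_ker ((MonoidHom.snd _ _).comp Q.subtype) hc
    have h3 : z = c * z' := by
      have : c = z * z'⁻¹ := by
        apply Subtype.ext
        apply Prod.ext hcz
        change c.1.2 = _
        rw [h2]
        simp [hzz]
      rw [this]; group
    rw [h3, hmul]
    have : φ c = 0 := h1
    rw [this, zero_add]
  let res : D.invariantHom F →ₗ[F] (Fin n → F) :=
    { toFun := fun φ i => φ.1 ⟨_, hs (e i)⟩
      map_add' := fun _ _ => rfl
      map_smul' := fun _ _ => rfl }
  have hres : Function.Injective res := by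
    rw [injective_iff_map_eq_zero]
    rintro ⟨φ, hφ⟩ h0
    have hw := hwd φ hφ
    let ψ : W → F := fun w => φ ⟨_, hs w⟩
    have hψ : ∀ z : Q, φ z = ψ z.1.2.toAdd := fun z => hw _ _ rfl
    have hadd : ∀ v w, ψ (v + w) = ψ v + ψ w := by
      intro v w
      have := hφ.1 ⟨_, hs v⟩ ⟨_, hs w⟩
      rw [hψ] at this
      exact this
    let ψ' : W →+ F := AddMonoidHom.mk' ψ hadd
    have hψx : ∀ w, ψ' (BiPoly.x • w) = 0 := by
      intro w
      have h1 : φ (D.α ⟨_, hs w⟩) = ψ w := hφ.2.1 ⟨_, hs w⟩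
      rw [hψ] at h1
      have h2 : ψ' ((1 + BiPoly.x) • w) = ψ' w := h1
      rw [add_smul, one_smul, map_add] at h2
      exact add_eq_left.mp h2
    have hψy : ∀ w, ψ' (BiPoly.y • w) = 0 := by
      intro w
      have h1 : φ (D.β ⟨_, hs w⟩) = ψ w := hφ.2.2 ⟨_, hs w⟩
      rw [hψ] at h1
      have h2 : ψ' ((1 + BiPoly.y) • w) = ψ' w := h1
      rw [add_smul, one_smul, map_add] at h2
      exact add_eq_left.mp h2
    have hψ0 : ∀ w, ψ' w = 0 := by
      intro w
      have : w ∈ Submodule.span BiPoly (Set.range e) := he ▸ trivial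
      induction this using Submodule.span_induction with
      | mem w hw' =>
        obtain ⟨i, rfl⟩ := hw'
        exact congrFun h0 i
      | zero => exact map_zero _
      | add v w _ _ hv hw' => rw [map_add, hv, hw', add_zero]
      | smul z w _ hw' =>
        obtain ⟨m, a, b, rfl⟩ := BiPoly.exists_eq_int_add z
        rw [add_smul, add_smul, mul_smul, mul_smul, map_add, map_add, hψx, hψy,
          Int.cast_smul_eq_zsmul, map_zsmul, hw']
        simp
    apply Subtype.ext
    funext z
    exact (hψ z).trans (hψ0 _)
  have : FiniteDimensional F (D.invariantHom F) := FiniteDimensional.of_injective res hres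
  have h1 := LinearMap.finrank_le_finrank_of_injective hres
  have h2 := D.finrank_le hG hxy hF
  simp only [Module.finrank_pi, Fintype.card_fin] at h1
  omega

/-- Applies the inequality to W = Rⁿ/𝔪P: the kernel of W → B is P/𝔪P, so its dimension, the local
number of relations, is at most n + 1. -/
theorem eq_zero_of_socle {G : Type u} [Group G] (hG : HomologicallyBalanced G)
    {K : Subgroup G} [K.Normal] {x y : G} (hxy : IsZSqBasis K x y) (p : ℕ) [hp : Fact p.Prime]
    [Module BiPoly (Additive (Abelianization K))]
    [Module.Finite BiPoly (Additive (Abelianization K))]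
    (hx : ∀ k : K, BiPoly.x • abMk k = abMk (MulAut.conjNormal x k) - abMk k)
    (hy : ∀ k : K, BiPoly.y • abMk k = abMk (MulAut.conjNormal y k) - abMk k)
    {N : ℕ} (hN : ∀ b : Additive (Abelianization K), BiPoly.x ^ N • b = 0)
    {b : Additive (Abelianization K)} (hpb : p • b = 0) (hxb : BiPoly.x • b = 0)
    (hyb : BiPoly.y • b = 0) : b = 0 := by
  -- Balance quantifies over fields in the universe of G, hence the lift.
  let F := ULift.{u} (ZMod p)
  have hF : ∀ c : F, ∃ n : ℕ, c = n := fun c =>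
    ⟨c.down.val, ULift.ext _ _ (ZMod.natCast_zmod_val c.down).symm⟩
  obtain ⟨n, π, hπ⟩ := Module.Finite.exists_fin' BiPoly (Additive (Abelianization K))
  let P := LinearMap.ker π
  let 𝔪 := BiPoly.maxIdeal p
  let W := (Fin n → BiPoly) ⧸ (𝔪 • P)
  let q : W →ₗ[BiPoly] Additive (Abelianization K) :=
    (𝔪 • P).liftQ π Submodule.smul_le_right
  have hq : Function.Surjective q := by
    intro b
    obtain ⟨v, hv⟩ := hπ b
    exact ⟨Submodule.Quotient.mk v, hv⟩
  let U := LinearMap.ker q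
  have hU𝔪 : ∀ z ∈ 𝔪, ∀ u : W, q u = 0 → z • u = 0 := by
    intro z hz u hu
    obtain ⟨v, rfl⟩ := Submodule.Quotient.mk_surjective _ u
    rw [← Submodule.Quotient.mk_smul, Submodule.Quotient.mk_eq_zero]
    exact Submodule.smul_mem_smul hz hu
  have hxm : BiPoly.x ∈ 𝔪 := Ideal.subset_span (by simp)
  have hym : BiPoly.y ∈ 𝔪 := Ideal.subset_span (by simp)
  have hpm : (p : BiPoly) ∈ 𝔪 := Ideal.subset_span (by simp)
  have hU : ∀ u, q u = 0 → BiPoly.x • u = 0 ∧ BiPoly.y • u = 0 := fun u hu =>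
    ⟨hU𝔪 _ hxm u hu, hU𝔪 _ hym u hu⟩
  let _ : Module (ZMod p) U := AddCommGroup.zmodModule (fun u => by
    apply Subtype.ext
    have := hU𝔪 _ hpm u.1 u.2
    rwa [Nat.cast_smul_eq_nsmul] at this)
  let _ : Module F U := inferInstanceAs (Module (ULift (ZMod p)) U)
  have hfin : FiniteDimensional F U := by
    obtain ⟨S, hS⟩ := (IsNoetherian.noetherian (⊤ : Submodule BiPoly U))
    refine ⟨⟨S, ?_⟩⟩
    rw [eq_top_iff]
    intro u _
    have hu : u ∈ Submodule.span BiPoly (S : Set U) := hS ▸ trivial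
    induction hu using Submodule.span_induction with
    | mem u h => exact Submodule.subset_span h
    | zero => exact zero_mem _
    | add u v _ _ h1 h2 => exact add_mem (h1 trivial) (h2 trivial)
    | smul z u _ h =>
      obtain ⟨m, a, b, rfl⟩ := BiPoly.exists_eq_int_add z
      have h1 : BiPoly.x • u = 0 := Subtype.ext (hU _ u.2).1
      have h2 : BiPoly.y • u = 0 := Subtype.ext (hU _ u.2).2
      rw [add_smul, add_smul, mul_comm, mul_smul, mul_comm BiPoly.y, mul_smul, h1, h2, smul_zero,
        smul_zero, add_zero, add_zero, Int.cast_smul_eq_zsmul]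
      exact zsmul_mem (h trivial) m
  have hdim := finrank_ker_le hG hxy hF hx hy q hq hU
    (fun i => (Submodule.Quotient.mk (Pi.single i 1) : W)) (by
      rw [eq_top_iff]
      intro w _
      obtain ⟨v, rfl⟩ := Submodule.Quotient.mk_surjective _ w
      have : v = ∑ i, v i • Pi.single i (1 : BiPoly) := by
        simpa using (pi_eq_sum_univ' v)
      rw [this, ← Submodule.mkQ_apply, map_sum]
      refine Submodule.sum_mem _ fun i _ => ?_
      rw [map_smul]
      exact Submodule.smul_mem _ _ (Submodule.subset_span ⟨i, rfl⟩))
  change Module.finrank F U ≤ n + 1 at hdim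
  -- A basis padded by zeros to exactly n + 1 vectors.
  obtain ⟨r, hr⟩ : ∃ r : Fin (n + 1) → U, Submodule.span F (Set.range r) = ⊤ := by
    let bas := Module.finBasis F U
    refine ⟨fun i => if h : i.1 < Module.finrank F U then bas ⟨i.1, h⟩ else 0, ?_⟩
    rw [eq_top_iff, ← bas.span_eq, Submodule.span_le]
    rintro _ ⟨i, rfl⟩
    apply Submodule.subset_span
    exact ⟨⟨i.1, by omega⟩, by simp⟩
  choose r' hr' using fun i => Submodule.Quotient.mk_surjective (𝔪 • P) (r i).1
  have hr'P : ∀ i, r' i ∈ P := by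
    intro i
    have h1 : q (r i).1 = 0 := (r i).2
    rw [← hr'] at h1
    exact h1
  have hP : P ≤ Submodule.span BiPoly (Set.range r') ⊔ 𝔪 • P := by
    intro v hv
    have hvU : (⟨Submodule.Quotient.mk v, hv⟩ : U) ∈ Submodule.span F (Set.range r) := hr ▸ trivial
    rw [Submodule.mem_span_range_iff_exists_fun] at hvU
    obtain ⟨c, hc⟩ := hvU
    choose m hm using fun i => hF (c i)
    have h1 : (Submodule.Quotient.mk v : W) = Submodule.Quotient.mk (∑ i, m i • r' i) := by
      have h2 := congrArg (Subtype.val) hc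
      refine h2.symm.trans ?_
      rw [← Submodule.mkQ_apply, map_sum, AddSubmonoidClass.coe_finsetSum]
      refine Finset.sum_congr rfl fun i _ => ?_
      rw [map_nsmul, Submodule.mkQ_apply, hr', hm, Nat.cast_smul_eq_nsmul]
      rfl
    rw [Submodule.Quotient.eq] at h1
    have h3 : v = (∑ i, m i • r' i) + (v - ∑ i, m i • r' i) := by abel
    rw [h3]
    refine Submodule.add_mem_sup (Submodule.sum_mem _ fun i _ => ?_) h1
    have h4 : r' i ∈ Submodule.span BiPoly (Set.range r') := Submodule.subset_span ⟨i, rfl⟩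
    exact nsmul_mem h4 _
  obtain ⟨v, rfl⟩ := hπ b
  have hx0 : BiPoly.x ^ N ≠ 0 := pow_ne_zero _ (by simp [BiPoly.x])
  -- Nilpotence of x supplies the nonzero scalar x ^ N that multiplies Rⁿ into P.
  have h := BiPoly.mem_of_socle P p hx0 (fun v => by
    change π _ = 0
    rw [map_smul, hN]) r' hr'P hP (v := v) (by
      change π _ = 0
      rw [map_smul, Nat.cast_smul_eq_nsmul, hpb]) (by
      change π _ = 0
      rw [map_smul, hxb]) (by
      change π _ = 0
      rw [map_smul, hyb])
  exact h

/-- If there were p-torsion, applying powers of the nilpotent operators x and y to it would produce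
a nonzero socle element. -/
theorem torsionFree_abelianization {G : Type u} [Group G] (hG : HomologicallyBalanced G)
    {K : Subgroup G} [K.Normal] {x y : G} (hxy : IsZSqBasis K x y)
    [Module BiPoly (Additive (Abelianization K))]
    [Module.Finite BiPoly (Additive (Abelianization K))]
    (hx : ∀ k : K, BiPoly.x • abMk k = abMk (MulAut.conjNormal x k) - abMk k)
    (hy : ∀ k : K, BiPoly.y • abMk k = abMk (MulAut.conjNormal y k) - abMk k)
    {N : ℕ} (hNx : ∀ b : Additive (Abelianization K), BiPoly.x ^ N • b = 0)
    (hNy : ∀ b : Additive (Abelianization K), BiPoly.y ^ N • b = 0) :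
    ∀ (n : ℕ), n ≠ 0 → ∀ b : Additive (Abelianization K), n • b = 0 → b = 0 := by
  have hprime : ∀ p : ℕ, p.Prime → ∀ b : Additive (Abelianization K), p • b = 0 → b = 0 := by
    intro p hp
    have : Fact p.Prime := ⟨hp⟩
    have h0 : ∀ j, ∀ b : Additive (Abelianization K), p • b = 0 → BiPoly.x • b = 0 →
        BiPoly.y ^ j • b = 0 → b = 0 := by
      intro j
      induction j with
      | zero => intro b _ _ h; simpa using h
      | succ j ih =>
        intro b hb hxb hyb
        refine ih b hb hxb (eq_zero_of_socle hG hxy p hx hy hNx ?_ ?_ ?_)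
        · rw [smul_comm, hb, smul_zero]
        · rw [smul_comm, hxb, smul_zero]
        · rw [smul_smul, ← pow_succ', hyb]
    have h1 : ∀ i, ∀ b : Additive (Abelianization K), p • b = 0 → BiPoly.x ^ i • b = 0 →
        b = 0 := by
      intro i
      induction i with
      | zero => intro b _ h; simpa using h
      | succ i ih =>
        intro b hb hxb
        refine ih b hb (h0 N _ ?_ ?_ (hNy _))
        · rw [smul_comm, hb, smul_zero]
        · rw [smul_smul, ← pow_succ', hxb]
    exact fun b hb => h1 N b hb (hNx b)
  intro n
  induction n using Nat.recOnMul with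
  | zero => exact fun h => absurd rfl h
  | one => intro _ b hb; simpa using hb
  | prime p hp => exact fun _ => hprime p hp
  | mul m n hm hn =>
    intro h b hb
    rw [mul_smul] at hb
    exact hn (right_ne_zero_of_mul h) b (hm (left_ne_zero_of_mul h) _ hb)

end Extension

end NilGrp


/-! ### The ℤ[x][y]-module structure on the abelianization of K and its finiteness. -/

namespace NilGrp

open scoped commutatorElement

open Polynomial

section Action

variable {G : Type*} [Group G] {K : Subgroup G} [K.Normal]

/-- The endomorphism of the abelianization of `K` induced by conjugation. -/
def abConj (K : Subgroup G) [K.Normal] (g : G) : AddMonoid.End (Additive (Abelianization K)) :=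
  (Abelianization.map (MulAut.conjNormal g : MulAut K).toMonoidHom).toAdditive

theorem abConj_abMk (g : G) (k : K) : abConj K g (abMk k) = abMk (MulAut.conjNormal g k) := rfl

theorem abConj_mul (g h : G) : abConj K (g * h) = abConj K g * abConj K h := by
  refine AddMonoidHom.ext fun b => ?_
  obtain ⟨k, rfl⟩ := abMk_surjective b
  change abMk _ = abMk (MulAut.conjNormal g (MulAut.conjNormal h k))
  rw [map_mul]
  rfl

theorem abConj_of_mem {g : G} (hg : g ∈ K) : abConj K g = 1 := by
  refine AddMonoidHom.ext fun b => ?_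
  obtain ⟨k, rfl⟩ := abMk_surjective b
  have h : (MulAut.conjNormal g k : K) = ⟨g, hg⟩ * k * ⟨g, hg⟩⁻¹ := Subtype.ext rfl
  change abMk (MulAut.conjNormal g k) = abMk k
  rw [h, abMk_mul, abMk_mul, abMk_inv, add_comm, neg_add_cancel_left]

theorem abConj_commute {x y : G} (hxy : IsZSqBasis K x y) :
    Commute (abConj K x - 1) (abConj K y - 1) := by
  have h : Commute (abConj K x) (abConj K y) := by
    rw [commute_iff_eq, ← abConj_mul, ← abConj_mul]
    have : x * y = ⁅x, y⁆ * (y * x) := by rw [commutatorElement_def]; group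
    rw [this, abConj_mul, abConj_of_mem hxy.commutator_mem, one_mul]
  exact (h.sub_left (Commute.one_left _)).sub_right
    ((Commute.one_right _).sub_left (Commute.one_left _))

/-- The ring homomorphism `ℤ[x][y] → End B` given by two commuting endomorphisms. -/
noncomputable def biPolyHom {B : Type*} [AddCommGroup B] (X Y : AddMonoid.End B)
    (h : Commute X Y) : BiPoly →+* AddMonoid.End B :=
  let f : ℤ[X] →+* AddMonoid.End B :=
    eval₂RingHom' (Int.castRingHom _) X (fun a => Int.cast_commute a X)
  eval₂RingHom' f Y (fun a => by
    induction a using Polynomial.induction_on' with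
    | add p q hp hq => rw [map_add]; exact hp.add_left hq
    | monomial n a =>
      have : f (monomial n a) = (a : AddMonoid.End B) * X ^ n := by
        simp [f, eval₂RingHom', eval₂_monomial]
      rw [this]
      exact (Int.cast_commute a Y).mul_left (h.pow_left n))

theorem biPolyHom_x {B : Type*} [AddCommGroup B] (X Y : AddMonoid.End B) (h : Commute X Y) :
    biPolyHom X Y h BiPoly.x = X := by
  simp [biPolyHom, BiPoly.x, eval₂RingHom']

theorem biPolyHom_y {B : Type*} [AddCommGroup B] (X Y : AddMonoid.End B) (h : Commute X Y) :
    biPolyHom X Y h BiPoly.y = Y := by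
  simp [biPolyHom, BiPoly.y, eval₂RingHom']

/-- The module structure over `ℤ[x][y]` on the abelianization of `K`, for which `x + 1` and
`y + 1` act by conjugation. -/
@[reducible]
noncomputable def abModule {x y : G} (hxy : IsZSqBasis K x y) :
    Module BiPoly (Additive (Abelianization K)) :=
  Module.compHom _ (biPolyHom _ _ (abConj_commute hxy))

theorem abModule_x {x y : G} (hxy : IsZSqBasis K x y) (k : K) :
    (abModule hxy).smul BiPoly.x (abMk k) = abMk (MulAut.conjNormal x k) - abMk k := by
  change biPolyHom _ _ (abConj_commute hxy) BiPoly.x (abMk k) = _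
  rw [biPolyHom_x]
  rfl

theorem abModule_y {x y : G} (hxy : IsZSqBasis K x y) (k : K) :
    (abModule hxy).smul BiPoly.y (abMk k) = abMk (MulAut.conjNormal y k) - abMk k := by
  change biPolyHom _ _ (abConj_commute hxy) BiPoly.y (abMk k) = _
  rw [biPolyHom_y]
  rfl

theorem conjNormal_sub_eq (g : G) (k : K) :
    abMk (MulAut.conjNormal g k) - abMk k = abMk (MulAut.conjNormal g k * k⁻¹ : K) := by
  rw [abMk_mul, abMk_inv, sub_eq_add_neg]

/-- The operator z is the commutator with g, so each application moves representatives one step down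
the lower central series. -/
theorem exists_pow_smul_eq_zero [Group.IsNilpotent G] [Module BiPoly (Additive (Abelianization K))]
    (g : G) (z : BiPoly)
    (hz : ∀ k : K, z • abMk k = abMk (MulAut.conjNormal g k) - abMk k) :
    ∃ N : ℕ, ∀ b : Additive (Abelianization K), z ^ N • b = 0 := by
  obtain ⟨N, hN⟩ := (Subgroup.nilpotent_iff_lowerCentralSeries (G := G)).mp inferInstance
  have key : ∀ n, ∀ k : K, ∃ k' : K, z ^ n • abMk k = abMk k' ∧
      (k' : G) ∈ (⊤ : Subgroup G).lowerCentralSeries n := by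
    intro n k
    induction n with
    | zero => exact ⟨k, by simp, by simp⟩
    | succ n ih =>
      obtain ⟨k', h1, h2⟩ := ih
      refine ⟨MulAut.conjNormal g k' * k'⁻¹, ?_, ?_⟩
      · rw [pow_succ', mul_smul, h1, hz, conjNormal_sub_eq]
      · rw [Subgroup.lowerCentralSeries_succ, Subgroup.commutator_comm]
        exact Subgroup.commutator_mem_commutator (Subgroup.mem_top g) h2
  refine ⟨N, fun b => ?_⟩
  obtain ⟨k, rfl⟩ := abMk_surjective b
  obtain ⟨k', h1, h2⟩ := key N k
  rw [hN, Subgroup.mem_bot] at h2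
  rw [h1, show k' = 1 from Subtype.ext h2, abMk_one]

/-- The submodule spanned by the commutator and the K-parts of finitely many generators of G has as
preimage in K a normal subgroup N of G. Modulo N the group is generated by the commuting images of x
and y, so no element of K survives. -/
theorem finite_abelianization [Group.IsNilpotent G] [Group.FG G] {x y : G}
    (hxy : IsZSqBasis K x y) [Module BiPoly (Additive (Abelianization K))]
    (hx : ∀ k : K, BiPoly.x • abMk k = abMk (MulAut.conjNormal x k) - abMk k)
    (hy : ∀ k : K, BiPoly.y • abMk k = abMk (MulAut.conjNormal y k) - abMk k) :
    Module.Finite BiPoly (Additive (Abelianization K)) := by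
  classical
  obtain ⟨S, hS⟩ := Group.fg_def.mp ‹Group.FG G›
  choose κ hκ i j hij using hxy.exists_eq
  let T : Finset (Additive (Abelianization K)) :=
    insert (abMk ⟨⁅x, y⁆, hxy.commutator_mem⟩) (S.image fun g => abMk ⟨κ g, hκ g⟩)
  let M := Submodule.span BiPoly (T : Set (Additive (Abelianization K)))
  let N : Subgroup G :=
    { carrier := {g | ∃ h : g ∈ K, abMk (⟨g, h⟩ : K) ∈ M}
      one_mem' := ⟨K.one_mem, M.zero_mem⟩
      mul_mem' := by
        rintro a b ⟨h1, h2⟩ ⟨h3, h4⟩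
        exact ⟨K.mul_mem h1 h3, M.add_mem h2 h4⟩
      inv_mem' := by
        rintro a ⟨h1, h2⟩
        exact ⟨K.inv_mem h1, M.neg_mem h2⟩ }
  have hnorm : ∀ (g : G) (z : BiPoly),
      (∀ k : K, z • abMk k = abMk (MulAut.conjNormal g k) - abMk k) →
      g ∈ Subgroup.normalizer (N : Set G) := by
    intro g z hz
    obtain ⟨n, hn⟩ := exists_pow_smul_eq_zero g z hz
    rw [Subgroup.mem_normalizer_iff]
    intro k
    constructor
    · rintro ⟨h1, h2⟩
      refine ⟨Subgroup.Normal.conj_mem inferInstance _ h1 g, ?_⟩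
      have h3 : abMk (MulAut.conjNormal g (⟨k, h1⟩ : K)) = abMk (⟨k, h1⟩ : K) + z • abMk ⟨k, h1⟩ := by
        rw [hz]; abel
      have h4 := M.add_mem h2 (M.smul_mem z h2)
      rw [← h3] at h4
      exact h4
    · rintro ⟨h1, h2⟩
      have h3 : k ∈ K := by
        have := Subgroup.Normal.conj_mem inferInstance _ h1 g⁻¹
        simpa [mul_assoc] using this
      refine ⟨h3, ?_⟩
      have h4 : abMk (⟨k, h3⟩ : K) + z • abMk ⟨k, h3⟩ ∈ M := by
        rw [hz, add_sub_cancel]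
        exact h2
      -- Inverts 1 + z without leaving M: descending from z ^ n = 0, each step subtracts z ^ (i + 1)
      -- k from z ^ i (1 + z) k.
      have h5 : ∀ m, z ^ (n - m) • abMk (⟨k, h3⟩ : K) ∈ M := by
        intro m
        induction m with
        | zero => rw [Nat.sub_zero, hn]; exact M.zero_mem
        | succ m ih =>
          rcases Nat.lt_or_ge m n with hlt | hge
          · have h6 : n - m = n - (m + 1) + 1 := by omega
            rw [h6] at ih
            have h7 := M.smul_mem (z ^ (n - (m + 1))) h4
            rw [smul_add, smul_smul, ← pow_succ] at h7
            exact (M.add_mem_iff_left ih).mp h7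
          · rwa [show n - (m + 1) = n - m by omega]
      simpa using h5 n
  have hNK : K ≤ Subgroup.normalizer (N : Set G) := by
    intro g hg
    refine hnorm g 0 fun k => ?_
    have := DFunLike.congr_fun (abConj_of_mem hg) (abMk k)
    rw [abConj_abMk] at this
    rw [this, zero_smul]
    simp
  have hN : N.Normal := by
    rw [← Subgroup.normalizer_eq_top_iff, eq_top_iff]
    intro g _
    rw [hij g]
    exact mul_mem (mul_mem (hNK (hκ g)) (zpow_mem (hnorm y _ hy) _)) (zpow_mem (hnorm x _ hx) _)
  let π := QuotientGroup.mk' N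
  have hπ : ∀ g ∈ N, π g = 1 := fun g hg => (QuotientGroup.eq_one_iff g).mpr hg
  have hcomm : Commute (π x) (π y) := by
    rw [commute_iff_eq, ← map_mul, ← map_mul]
    have h1 : x * y = ⁅x, y⁆ * (y * x) := by rw [commutatorElement_def]; group
    have h2 : ⁅x, y⁆ ∈ N := ⟨hxy.commutator_mem, Submodule.subset_span (by simp [T])⟩
    rw [h1, map_mul, hπ _ h2, one_mul]
  have hgen : ∀ g : G, ∃ a b : ℤ, π g = π y ^ b * π x ^ a := by
    intro g
    have hg : g ∈ Subgroup.closure (S : Set G) := hS ▸ trivial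
    induction hg using Subgroup.closure_induction with
    | mem g hg =>
      refine ⟨i g, j g, ?_⟩
      have h2 : κ g ∈ N := ⟨hκ g, Submodule.subset_span (by
        simp only [T, Finset.coe_insert, Finset.coe_image]
        exact Or.inr ⟨g, hg, rfl⟩)⟩
      conv_lhs => rw [hij g]
      rw [map_mul, map_mul, hπ _ h2, one_mul, map_zpow, map_zpow]
    | one => exact ⟨0, 0, by simp⟩
    | mul g h _ _ hg hh =>
      obtain ⟨a, b, h1⟩ := hg
      obtain ⟨c, d, h2⟩ := hh
      refine ⟨a + c, b + d, ?_⟩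
      have := (hcomm.zpow_zpow a d).eq
      rw [map_mul, h1, h2, zpow_add, zpow_add, mul_assoc, ← mul_assoc (π x ^ a), this]
      group
    | inv g _ hg =>
      obtain ⟨a, b, h1⟩ := hg
      refine ⟨-a, -b, ?_⟩
      have := (hcomm.zpow_zpow (-a) (-b)).eq
      rw [map_inv, h1, mul_inv_rev, ← zpow_neg, ← zpow_neg, this]
  refine ⟨⟨T, ?_⟩⟩
  rw [eq_top_iff]
  intro b _
  obtain ⟨k, rfl⟩ := abMk_surjective b
  obtain ⟨a, b, hab⟩ := hgen k
  rw [← map_zpow, ← map_zpow, ← map_mul] at hab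
  have h1 : (k : G)⁻¹ * (y ^ b * x ^ a) ∈ N := QuotientGroup.eq.mp hab
  have h2 : y ^ b * x ^ a ∈ K := by
    obtain ⟨h3, -⟩ := h1
    exact (K.mul_mem_cancel_left (K.inv_mem k.2)).mp h3
  obtain ⟨rfl, rfl⟩ := hxy.eq_zero _ _ h2
  simp only [zpow_zero, mul_one] at h1
  obtain ⟨h3, h4⟩ := N.inv_mem h1
  simpa using h4

theorem HomologicallyBalanced.torsionFree_abelianization {G : Type u} [Group G]
    [Group.IsNilpotent G] (hG : HomologicallyBalanced G) {K : Subgroup G} [K.Normal] {x y : G}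
    (hxy : IsZSqBasis K x y) (n : ℕ) (hn : n ≠ 0) (b : Additive (Abelianization K))
    (hb : n • b = 0) : b = 0 := by
  let _ := abModule hxy
  have hx := abModule_x hxy
  have hy := abModule_y hxy
  have := hG.1
  have := finite_abelianization hxy hx hy
  obtain ⟨N₁, h1⟩ := exists_pow_smul_eq_zero x _ hx
  obtain ⟨N₂, h2⟩ := exists_pow_smul_eq_zero y _ hy
  refine NilGrp.torsionFree_abelianization hG hxy hx hy (N := N₁ + N₂) ?_ ?_ n hn b hb
  · intro b; rw [pow_add, mul_smul, h1]
  · intro b; rw [pow_add, mul_smul, h2, smul_zero]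

/-- As x and y are nilpotent, finitely many monomials applied to the module generators span over ℤ.
-/
theorem finite_int_abelianization [Group.IsNilpotent G] [Group.FG G] {x y : G}
    (hxy : IsZSqBasis K x y) : Module.Finite ℤ (Additive (Abelianization K)) := by
  classical
  let _ := abModule hxy
  have hx := abModule_x hxy
  have hy := abModule_y hxy
  have := finite_abelianization hxy hx hy
  obtain ⟨N₁, h1⟩ := exists_pow_smul_eq_zero x _ hx
  obtain ⟨N₂, h2⟩ := exists_pow_smul_eq_zero y _ hy
  obtain ⟨S, hS⟩ := this
  let T := ((Finset.range N₁ ×ˢ Finset.range N₂) ×ˢ S).image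
    fun q => BiPoly.x ^ q.1.1 • BiPoly.y ^ q.1.2 • q.2
  let M := Submodule.span ℤ (T : Set (Additive (Abelianization K)))
  have hT : ∀ i j, ∀ s ∈ S, BiPoly.x ^ i • BiPoly.y ^ j • s ∈ M := by
    intro i j s hs
    rcases Nat.lt_or_ge i N₁ with hi | hi
    · rcases Nat.lt_or_ge j N₂ with hj | hj
      · refine Submodule.subset_span ?_
        simp only [T, Finset.coe_image]
        exact ⟨((i, j), s), by simp [hi, hj, hs], rfl⟩
      · have : BiPoly.y ^ j • s = 0 := by
          rw [← Nat.sub_add_cancel hj, pow_add, mul_smul, h2, smul_zero]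
        rw [this, smul_zero]; exact M.zero_mem
    · have : BiPoly.x ^ i • BiPoly.y ^ j • s = 0 := by
        rw [← Nat.sub_add_cancel hi, pow_add, mul_smul, h1, smul_zero]
      rw [this]; exact M.zero_mem
  have hstable : ∀ z : BiPoly, (∀ t ∈ T, z • t ∈ M) → ∀ m ∈ M, z • m ∈ M := by
    intro z hz m hm
    induction hm using Submodule.span_induction with
    | mem m hm => exact hz m hm
    | zero => rw [smul_zero]; exact M.zero_mem
    | add a b _ _ ha hb => rw [smul_add]; exact M.add_mem ha hb
    | smul c a _ ha => rw [smul_comm]; exact M.smul_mem c ha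
  have hMx := hstable BiPoly.x (by
    intro t ht
    simp only [T, Finset.mem_image, Finset.mem_product] at ht
    obtain ⟨q, ⟨-, hs⟩, rfl⟩ := ht
    rw [smul_smul, ← pow_succ']
    exact hT _ _ _ hs)
  have hMy := hstable BiPoly.y (by
    intro t ht
    simp only [T, Finset.mem_image, Finset.mem_product] at ht
    obtain ⟨q, ⟨-, hs⟩, rfl⟩ := ht
    rw [smul_comm BiPoly.y, smul_smul BiPoly.y, ← pow_succ']
    exact hT _ _ _ hs)
  have hM : ∀ z : BiPoly, ∀ m ∈ M, z • m ∈ M := by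
    intro z m hm
    induction z using Polynomial.induction_on with
    | C a =>
      induction a using Polynomial.induction_on with
      | C a =>
        have : (C (C a) : BiPoly) = (a : BiPoly) := by simp
        rw [this, Int.cast_smul_eq_zsmul]
        exact M.smul_mem a hm
      | add p q hp hq => rw [C_add, add_smul]; exact M.add_mem hp hq
      | monomial n a h =>
        have : (C (C a * X ^ (n + 1)) : BiPoly) = BiPoly.x * C (C a * X ^ n) := by
          simp only [BiPoly.x, ← C_mul]; congr 1; ring
        rw [this, mul_smul]
        exact hMx _ h
    | add p q hp hq => rw [add_smul]; exact M.add_mem hp hq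
    | monomial n a h =>
      have : (C a * X ^ (n + 1) : BiPoly) = BiPoly.y * (C a * X ^ n) := by
        simp only [BiPoly.y]; ring
      rw [this, mul_smul]
      exact hMy _ h
  refine ⟨⟨T, ?_⟩⟩
  rw [eq_top_iff]
  intro b _
  have hb : b ∈ Submodule.span BiPoly (S : Set (Additive (Abelianization K))) := hS ▸ trivial
  induction hb using Submodule.span_induction with
  | mem s hs => simpa using hT 0 0 s hs
  | zero => exact zero_mem _
  | add a b _ _ ha hb => exact add_mem (ha trivial) (hb trivial)
  | smul z a _ ha => exact hM z a (ha trivial)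

end Action

end NilGrp


/-! ### Extensions of an abelian kernel by biadditive cocycles. -/

namespace NilGrp

open scoped commutatorElement

/-- The central extension of `B` by `V` defined by a biadditive cocycle. -/
@[ext]
structure CocycleExt {B V : Type*} [AddCommGroup B] [AddCommGroup V] (c : B →+ B →+ V) where
  /-- The component in the base. -/
  fst : B
  /-- The component in the kernel. -/
  snd : V

namespace CocycleExt

variable {B V : Type*} [AddCommGroup B] [AddCommGroup V] {c : B →+ B →+ V}

instance : Group (CocycleExt c) where
  mul z w := ⟨z.fst + w.fst, z.snd + w.snd + c z.fst w.fst⟩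
  one := ⟨0, 0⟩
  inv z := ⟨-z.fst, -z.snd + c z.fst z.fst⟩
  mul_assoc z w v := by
    apply CocycleExt.ext
    · exact add_assoc _ _ _
    · change z.snd + w.snd + c z.fst w.fst + v.snd + c (z.fst + w.fst) v.fst =
        z.snd + (w.snd + v.snd + c w.fst v.fst) + c z.fst (w.fst + v.fst)
      simp only [map_add, AddMonoidHom.add_apply]
      abel
  one_mul z := by
    apply CocycleExt.ext
    · exact zero_add _
    · change 0 + z.snd + c 0 z.fst = z.snd
      simp
  mul_one z := by
    apply CocycleExt.ext
    · exact add_zero _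
    · change z.snd + 0 + c z.fst 0 = z.snd
      simp
  inv_mul_cancel z := by
    apply CocycleExt.ext
    · exact neg_add_cancel _
    · change -z.snd + c z.fst z.fst + z.snd + c (-z.fst) z.fst = 0
      simp

theorem mul_def (z w : CocycleExt c) :
    z * w = ⟨z.fst + w.fst, z.snd + w.snd + c z.fst w.fst⟩ := rfl

theorem inv_def (z : CocycleExt c) : z⁻¹ = ⟨-z.fst, -z.snd + c z.fst z.fst⟩ := rfl

theorem conj_def (z w : CocycleExt c) :
    z * w * z⁻¹ = ⟨w.fst, w.snd + c z.fst w.fst - c w.fst z.fst⟩ := by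
  rw [mul_def, mul_def, inv_def]
  apply CocycleExt.ext
  · simp
  · simp only [map_add, map_neg, AddMonoidHom.add_apply]
    abel

/-- The endomorphism of the extension given by an endomorphism of the base and a cochain. -/
def map (σ : B →+ B) (f : B → V)
    (hf : ∀ a b, c a b + f (a + b) = f a + f b + c (σ a) (σ b)) :
    CocycleExt c →* CocycleExt c where
  toFun z := ⟨σ z.fst, z.snd + f z.fst⟩
  map_one' := by
    have h := hf 0 0
    simp only [map_zero, add_zero, zero_add] at h
    apply CocycleExt.ext
    · exact map_zero σ
    · change 0 + f 0 = 0
      simpa using h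
  map_mul' z w := by
    apply CocycleExt.ext
    · exact map_add σ _ _
    · change z.snd + w.snd + c z.fst w.fst + f (z.fst + w.fst) =
        z.snd + f z.fst + (w.snd + f w.fst) + c (σ z.fst) (σ w.fst)
      rw [add_assoc _ (c _ _), hf]
      abel

end CocycleExt

/-- An additive group `B` together with an identification with the normal subgroup `K` of `G`. -/
structure AddModel {G : Type*} [Group G] (K : Subgroup G) (x y : G) (B : Type*)
    [AddCommGroup B] where
  /-- The identification of `B` with `K`. -/
  j : Multiplicative B →* G
  /-- The action of `x` on `B` by conjugation. -/
  σx : B →+ B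
  /-- The action of `y` on `B` by conjugation. -/
  σy : B →+ B
  /-- The element of `B` that corresponds to the commutator of `x` and `y`. -/
  τ : B
  j_inj : Function.Injective j
  range_j : j.range = K
  j_σx : ∀ b, j (.ofAdd (σx b)) = x * j (.ofAdd b) * x⁻¹
  j_σy : ∀ b, j (.ofAdd (σy b)) = y * j (.ofAdd b) * y⁻¹
  j_τ : j (.ofAdd τ) = ⁅x, y⁆

namespace AddModel

variable {G : Type*} [Group G] {K : Subgroup G} {x y : G} {B : Type*} [AddCommGroup B]

theorem j_comm (A : AddModel K x y B) (a b : Multiplicative B) : A.j a * A.j b = A.j b * A.j a := by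
  rw [← map_mul, mul_comm, map_mul]

/-- The commutator of x and y lies in the commutative group K, so conjugation by it is trivial
there. -/
theorem σ_comm (A : AddModel K x y B) (b : B) : A.σx (A.σy b) = A.σy (A.σx b) := by
  apply Multiplicative.ofAdd.injective
  apply A.j_inj
  rw [A.j_σx, A.j_σy, A.j_σy, A.j_σx]
  have h := A.j_comm (.ofAdd A.τ) (.ofAdd (A.σy (A.σx b)))
  rw [A.j_τ, A.j_σy, A.j_σx] at h
  have h2 : x * (y * A.j (.ofAdd b) * y⁻¹) * x⁻¹ =
      ⁅x, y⁆ * (y * (x * A.j (.ofAdd b) * x⁻¹) * y⁻¹) * ⁅x, y⁆⁻¹ := by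
    rw [commutatorElement_def]; group
  rw [h2, h]; group

/-- The central lift defined by a cocycle. -/
def centralLift (A : AddModel K x y B) {V : Type*} [AddCommGroup V] (c : B →+ B →+ V)
    (f g : B → V) (hf : ∀ a b, c a b + f (a + b) = f a + f b + c (A.σx a) (A.σx b))
    (hg : ∀ a b, c a b + g (a + b) = g a + g b + c (A.σy a) (A.σy b))
    (hfg : ∀ a, g a + f (A.σy a) = f a + g (A.σx a) + c A.τ (A.σy (A.σx a)) -
      c (A.σy (A.σx a)) A.τ) :
    CentralLift K x y V (CocycleExt c) where
  π :=
    { toFun := fun z => A.j (.ofAdd z.fst)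
      map_one' := map_one A.j
      map_mul' := fun z w => map_mul A.j _ _ }
  ι :=
    { toFun := fun v => ⟨0, v.toAdd⟩
      map_one' := rfl
      map_mul' := fun v w => by
        apply CocycleExt.ext
        · exact (add_zero _).symm
        · change v.toAdd + w.toAdd = v.toAdd + w.toAdd + c 0 0
          simp }
  α := CocycleExt.map A.σx f hf
  β := CocycleExt.map A.σy g hg
  τ := ⟨A.τ, 0⟩
  range_π := by
    refine le_antisymm ?_ fun k hk => ?_
    · rintro _ ⟨z, rfl⟩
      exact (SetLike.ext_iff.mp A.range_j _).mp ⟨_, rfl⟩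
    · obtain ⟨b, rfl⟩ := (SetLike.ext_iff.mp A.range_j _).mpr hk
      exact ⟨⟨b.toAdd, 0⟩, rfl⟩
  ι_inj := fun v w h => congrArg (fun z : CocycleExt c => Multiplicative.ofAdd z.snd) h
  range_ι := by
    apply le_antisymm
    · rintro _ ⟨v, rfl⟩
      exact map_one A.j
    · rintro ⟨b, v⟩ h
      have hb : b = 0 := A.j_inj (h.trans (map_one A.j).symm)
      subst hb
      exact ⟨.ofAdd v, rfl⟩
  ι_central := fun v z => by
    apply CocycleExt.ext
    · exact (zero_add _).trans (add_zero _).symm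
    · change v.toAdd + z.snd + c 0 z.fst = z.snd + v.toAdd + c z.fst 0
      simp [add_comm]
  α_ι := fun v => by
    have h := hf 0 0
    simp only [map_zero, add_zero, zero_add] at h
    apply CocycleExt.ext
    · exact map_zero A.σx
    · change v.toAdd + f 0 = v.toAdd
      simpa using h
  β_ι := fun v => by
    have h := hg 0 0
    simp only [map_zero, add_zero, zero_add] at h
    apply CocycleExt.ext
    · exact map_zero A.σy
    · change v.toAdd + g 0 = v.toAdd
      simpa using h
  π_α := fun k => A.j_σx _
  π_β := fun k => A.j_σy _
  π_τ := A.j_τ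
  comm := fun z => by
    rw [CocycleExt.conj_def]
    apply CocycleExt.ext
    · exact A.σ_comm _
    · change z.snd + g z.fst + f (A.σy z.fst) = z.snd + f z.fst + g (A.σx z.fst) +
        c A.τ (A.σy (A.σx z.fst)) - c (A.σy (A.σx z.fst)) A.τ
      rw [add_assoc, hfg]
      abel

/-- The map `(χ, ψ) ↦ χ ∘ (σy - 1) - ψ ∘ (σx - 1)`. -/
def koszulMap (A : AddModel K x y B) (F : Type*) [Field F] :
    ((B →ₗ[ℤ] F) × (B →ₗ[ℤ] F)) →ₗ[F] (B →ₗ[ℤ] F) where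
  toFun z := z.1.comp (A.σy.toIntLinearMap - LinearMap.id) -
    z.2.comp (A.σx.toIntLinearMap - LinearMap.id)
  map_add' z w := by
    ext b
    simp only [Prod.fst_add, Prod.snd_add, LinearMap.sub_apply, LinearMap.comp_apply,
      LinearMap.add_apply]
    ring
  map_smul' a z := by
    ext b
    simp only [Prod.smul_fst, Prod.smul_snd, LinearMap.sub_apply, LinearMap.comp_apply,
      LinearMap.smul_apply, RingHom.id_apply, smul_sub]

theorem koszulMap_apply (A : AddModel K x y B) {F : Type*} [Field F]
    (z : (B →ₗ[ℤ] F) × (B →ₗ[ℤ] F)) (b : B) :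
    A.koszulMap F z b = z.1 (A.σy b - b) - z.2 (A.σx b - b) := rfl

/-- The kernel Z of the Koszul map consists of the pairs of additive functions by which the two
conjugations can be lifted to a split extension; the dual of Z carries the universal pair. Extending
by this dual and by V at once, every invariant homomorphism vanishes on V because of commutators and
on the dual of Z because of the lifts, so it lives on B. Rank-nullity for the Koszul map turns the
resulting bound into the stated one. -/
theorem finrank_add_le {G : Type u} [Group G] (hG : HomologicallyBalanced G)
    {K : Subgroup G} [K.Normal] {x y : G} (hxy : IsZSqBasis K x y) (A : AddModel K x y B)
    {F : Type u} [Field F] (hF : ∀ a : F, ∃ n : ℕ, a = n) [FiniteDimensional F (B →ₗ[ℤ] F)]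
    {V : Type*} [AddCommGroup V] [Module F V] [FiniteDimensional F V] (c : B →+ B →+ V)
    (f g : B → V) (hf : ∀ a b, c a b + f (a + b) = f a + f b + c (A.σx a) (A.σx b))
    (hg : ∀ a b, c a b + g (a + b) = g a + g b + c (A.σy a) (A.σy b))
    (hfg : ∀ a, g a + f (A.σy a) = f a + g (A.σx a) + c A.τ (A.σy (A.σx a)) -
      c (A.σy (A.σx a)) A.τ)
    (hspan : ∀ μ : V →+ F, (∀ a b, μ (c a b - c b a) = 0) → μ = 0) :
    Module.finrank F (B →ₗ[ℤ] F) + Module.finrank F V ≤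
      Module.finrank F (LinearMap.range (A.koszulMap F)) + 1 := by
  let Z := LinearMap.ker (A.koszulMap F)
  let V' := Module.Dual F Z × V
  let c' : B →+ B →+ V' := c.compr₂ (AddMonoidHom.inr _ _)
  let e1 : B → Module.Dual F Z := fun b =>
    { toFun := fun z => z.1.1 b
      map_add' := fun _ _ => rfl
      map_smul' := fun _ _ => rfl }
  let e2 : B → Module.Dual F Z := fun b =>
    { toFun := fun z => z.1.2 b
      map_add' := fun _ _ => rfl
      map_smul' := fun _ _ => rfl }
  have e1_add : ∀ a b, e1 (a + b) = e1 a + e1 b := fun a b =>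
    LinearMap.ext fun z => map_add z.1.1 a b
  have e2_add : ∀ a b, e2 (a + b) = e2 a + e2 b := fun a b =>
    LinearMap.ext fun z => map_add z.1.2 a b
  have he : ∀ a, e2 a + e1 (A.σy a) = e1 a + e2 (A.σx a) := by
    intro a
    refine LinearMap.ext fun z => ?_
    have h := LinearMap.congr_fun (LinearMap.mem_ker.mp z.2) a
    rw [koszulMap_apply, map_sub, map_sub, LinearMap.zero_apply] at h
    change z.1.2 a + z.1.1 (A.σy a) = z.1.1 a + z.1.2 (A.σx a)
    linear_combination h
  let D := A.centralLift c' (fun b => (e1 b, f b)) (fun b => (e2 b, g b))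
    (fun a b => Prod.ext (by
      change 0 + e1 (a + b) = e1 a + e1 b + 0
      rw [zero_add, add_zero, e1_add]) (hf a b))
    (fun a b => Prod.ext (by
      change 0 + e2 (a + b) = e2 a + e2 b + 0
      rw [zero_add, add_zero, e2_add]) (hg a b))
    (fun a => Prod.ext (by
      change e2 a + e1 (A.σy a) = e1 a + e2 (A.σx a) + 0 - 0
      rw [sub_zero, add_zero, he]) (hfg a))
  have hμ : ∀ φ ∈ D.invariantHom F, ∃ μ : V' →+ F, ∀ v, φ ⟨0, v⟩ = μ v := by
    rintro φ ⟨hmul, -, -⟩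
    refine ⟨AddMonoidHom.mk' (fun v => φ ⟨0, v⟩) fun v w => ?_, fun v => rfl⟩
    rw [← hmul, CocycleExt.mul_def]
    simp
  have hvanish : ∀ φ ∈ D.invariantHom F, ∀ v : V, φ ⟨0, (0, v)⟩ = 0 := by
    intro φ hφ v
    obtain ⟨μ, h⟩ := hμ φ hφ
    rw [h]
    refine DFunLike.congr_fun (hspan (μ.comp (AddMonoidHom.inr _ _)) fun a b => ?_) v
    have h1 : ∀ z w : CocycleExt c', φ (z * w * z⁻¹) = φ w := by
      intro z w
      have h0 : φ 1 = 0 := by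
        have := hφ.1 1 1
        rw [one_mul] at this
        exact left_eq_add.mp this
      have h2 : φ z⁻¹ = -φ z := by
        have := hφ.1 z⁻¹ z
        rw [inv_mul_cancel, h0] at this
        linear_combination -this
      rw [hφ.1, hφ.1, h2]; ring
    have h2 := h1 ⟨a, 0⟩ ⟨b, 0⟩
    rw [CocycleExt.conj_def] at h2
    have h3 : (⟨b, 0 + c' a b - c' b a⟩ : CocycleExt c') =
        ⟨0, c' a b - c' b a⟩ * ⟨b, 0⟩ := by
      rw [CocycleExt.mul_def]; simp
    change φ ⟨b, 0 + c' a b - c' b a⟩ = _ at h2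
    rw [h3, hφ.1, h] at h2
    have h4 : c' a b - c' b a = (0, c a b - c b a) := Prod.ext (sub_zero _) rfl
    change μ (0, c a b - c b a) = 0
    rw [← h4]
    exact add_eq_right.mp h2
  have hsplit : ∀ φ ∈ D.invariantHom F, ∀ b v, φ ⟨b, v⟩ = φ ⟨b, 0⟩ + φ ⟨0, v⟩ := by
    rintro φ ⟨hmul, -, -⟩ b v
    rw [← hmul, CocycleExt.mul_def]
    simp
  let res : D.invariantHom F →ₗ[F] (B →ₗ[ℤ] F) :=
    { toFun := fun φ => (AddMonoidHom.mk' (fun b => φ.1 ⟨b, 0⟩) (fun a b => by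
          have h : (⟨a + b, c' a b⟩ : CocycleExt c') = ⟨a, 0⟩ * ⟨b, 0⟩ := by
            rw [CocycleExt.mul_def]; simp
          rw [← φ.2.1, ← h, hsplit φ.1 φ.2 (a + b) (c' a b)]
          have h2 : c' a b = (0, c a b) := rfl
          rw [h2, hvanish φ.1 φ.2, add_zero])).toIntLinearMap
      map_add' := fun _ _ => rfl
      map_smul' := fun _ _ => rfl }
  have hres : Function.Injective res := by
    rw [injective_iff_map_eq_zero]
    rintro ⟨φ, hφ⟩ h0
    have h1 : ∀ b, φ ⟨b, 0⟩ = 0 := fun b => LinearMap.congr_fun h0 b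
    obtain ⟨μ, hμ⟩ := hμ φ hφ
    have hμv : ∀ v : V, μ (0, v) = 0 := fun v => by rw [← hμ]; exact hvanish φ hφ v
    have hval : ∀ b v, φ ⟨b, v⟩ = μ v := fun b v => by
      rw [hsplit φ hφ, h1, hμ, zero_add]
    have hμsplit : ∀ (ξ : Module.Dual F Z) (v : V), μ (ξ, v) = μ (ξ, 0) := by
      intro ξ v
      have : ((ξ, v) : V') = (ξ, 0) + (0, v) := by simp
      rw [this, map_add, hμv, add_zero]
    have hx : ∀ b, μ (e1 b, 0) = 0 := by
      intro b
      have h2 := hφ.2.1 ⟨b, 0⟩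
      rw [h1] at h2
      have h3 : D.α ⟨b, 0⟩ = ⟨A.σx b, 0 + (e1 b, f b)⟩ := rfl
      rwa [h3, hval, zero_add, hμsplit] at h2
    have hy : ∀ b, μ (e2 b, 0) = 0 := by
      intro b
      have h2 := hφ.2.2 ⟨b, 0⟩
      rw [h1] at h2
      have h3 : D.β ⟨b, 0⟩ = ⟨A.σy b, 0 + (e2 b, g b)⟩ := rfl
      rwa [h3, hval, zero_add, hμsplit] at h2
    let ν : Module.Dual F (Module.Dual F Z) :=
      { toFun := fun ξ => μ (ξ, 0)
        map_add' := fun ξ ζ => by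
          have : ((ξ + ζ, 0) : V') = (ξ, 0) + (ζ, 0) := by simp
          rw [this, map_add]
        map_smul' := fun a ξ => by
          obtain ⟨n, rfl⟩ := hF a
          have : ((((n : F) • ξ, 0)) : V') = n • (ξ, 0) := by
            rw [Nat.cast_smul_eq_nsmul]; simp
          rw [this, map_nsmul, RingHom.id_apply, Nat.cast_smul_eq_nsmul] }
    -- By reflexivity ν is evaluation at some pair z in Z, and ν kills the universal pair, so both
    -- components of z vanish.
    obtain ⟨z, hz⟩ := (Module.evalEquiv F Z).surjective ν
    have hz0 : z = 0 := by
      apply Subtype.ext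
      apply Prod.ext
      · refine LinearMap.ext fun b => ?_
        have := LinearMap.congr_fun hz (e1 b)
        exact this.trans (hx b)
      · refine LinearMap.ext fun b => ?_
        have := LinearMap.congr_fun hz (e2 b)
        exact this.trans (hy b)
    rw [hz0, map_zero] at hz
    apply Subtype.ext
    funext ⟨b, ξ, v⟩
    change φ _ = 0
    rw [hval, hμsplit]
    exact (LinearMap.congr_fun hz ξ).symm
  have : FiniteDimensional F (D.invariantHom F) := FiniteDimensional.of_injective res hres
  have h1 := LinearMap.finrank_le_finrank_of_injective hres
  have h2 := D.finrank_le hG hxy hF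
  have h3 := LinearMap.finrank_range_add_finrank_ker (A.koszulMap F)
  have h4 : Module.finrank F V' = Module.finrank F Z + Module.finrank F V := by
    rw [Module.finrank_prod, Subspace.dual_finrank_eq]
  rw [Module.finrank_prod] at h3
  change _ + Module.finrank F Z = _ at h3
  omega

end AddModel

end NilGrp


/-! ### Nilpotence and the Koszul map: socle elements and the excluded quadratic cochains. -/

namespace NilGrp

open scoped commutatorElement

namespace AddModel

variable {G : Type*} [Group G] {K : Subgroup G} {x y : G} {B : Type*} [AddCommGroup B]

theorem j_σx_sub (A : AddModel K x y B) (b : B) :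
    A.j (.ofAdd (A.σx b - b)) = ⁅x, A.j (.ofAdd b)⁆ := by
  rw [ofAdd_sub, map_div, A.j_σx, div_eq_mul_inv, commutatorElement_def]

theorem j_σy_sub (A : AddModel K x y B) (b : B) :
    A.j (.ofAdd (A.σy b - b)) = ⁅y, A.j (.ofAdd b)⁆ := by
  rw [ofAdd_sub, map_div, A.j_σy, div_eq_mul_inv, commutatorElement_def]

theorem commutator_mem_lowerCentralSeries_succ {n : ℕ} (g : G) {h : G}
    (hh : h ∈ (⊤ : Subgroup G).lowerCentralSeries n) :
    ⁅g, h⁆ ∈ (⊤ : Subgroup G).lowerCentralSeries (n + 1) := by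
  rw [← commutatorElement_inv]
  exact inv_mem (Subgroup.commutator_mem_commutator hh (Subgroup.mem_top g))

/-- A subset of `B` that is stable under `σx - 1` and `σy - 1` and not contained in `E` has an
element outside of `E` that both operators map into `E`. -/
theorem exists_socle [Group.IsNilpotent G] (A : AddModel K x y B) {E P : B → Prop} (hE : E 0)
    (hPx : ∀ b, P b → P (A.σx b - b)) (hPy : ∀ b, P b → P (A.σy b - b))
    {b₀ : B} (hP : P b₀) (hb₀ : ¬E b₀) :
    ∃ b, P b ∧ ¬E b ∧ E (A.σx b - b) ∧ E (A.σy b - b) := by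
  by_contra! hcon
  obtain ⟨N, hN⟩ := (Subgroup.nilpotent_iff_lowerCentralSeries (G := G)).mp inferInstance
  have key : ∀ n, ∃ b, P b ∧ ¬E b ∧ A.j (.ofAdd b) ∈ (⊤ : Subgroup G).lowerCentralSeries n := by
    intro n
    induction n with
    | zero => exact ⟨b₀, hP, hb₀, by simp⟩
    | succ n ih =>
      obtain ⟨b, h1, h2, h3⟩ := ih
      by_cases h4 : E (A.σx b - b)
      · refine ⟨_, hPy b h1, hcon b h1 h2 h4, ?_⟩
        rw [j_σy_sub]
        exact commutator_mem_lowerCentralSeries_succ y h3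
      · refine ⟨_, hPx b h1, h4, ?_⟩
        rw [j_σx_sub]
        exact commutator_mem_lowerCentralSeries_succ x h3
  obtain ⟨b, -, h2, h3⟩ := key N
  rw [hN, Subgroup.mem_bot] at h3
  have : b = 0 := A.j_inj (h3.trans (map_one A.j).symm)
  exact h2 (this ▸ hE)

/-- The dual form of `exists_socle`, for additive functions on `B`. -/
theorem exists_dual_socle [Group.IsNilpotent G] (A : AddModel K x y B) {F : Type*} [Field F]
    {E : (B →ₗ[ℤ] F) → Prop} (hE : E 0) {φ₀ : B →ₗ[ℤ] F} (hφ₀ : ¬E φ₀) :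
    ∃ φ : B →ₗ[ℤ] F, ¬E φ ∧ E (φ ∘ₗ (A.σx.toIntLinearMap - LinearMap.id)) ∧
      E (φ ∘ₗ (A.σy.toIntLinearMap - LinearMap.id)) := by
  by_contra! hcon
  obtain ⟨N, hN⟩ := (Subgroup.nilpotent_iff_lowerCentralSeries (G := G)).mp inferInstance
  -- Composing with a commutator operator makes φ vanish on a larger term of the lower central
  -- series, until φ = 0.
  have key : ∀ n, n ≤ N → ∃ φ, ¬E φ ∧
      ∀ b, A.j (.ofAdd b) ∈ (⊤ : Subgroup G).lowerCentralSeries (N - n) → φ b = 0 := by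
    intro n hn
    induction n with
    | zero =>
      refine ⟨φ₀, hφ₀, fun b hb => ?_⟩
      rw [Nat.sub_zero, hN, Subgroup.mem_bot] at hb
      have : b = 0 := A.j_inj (hb.trans (map_one A.j).symm)
      rw [this, map_zero]
    | succ n ih =>
      obtain ⟨φ, h1, h2⟩ := ih (by omega)
      have hN' : N - n = N - (n + 1) + 1 := by omega
      by_cases h4 : E (φ ∘ₗ (A.σx.toIntLinearMap - LinearMap.id))
      · refine ⟨_, hcon φ h1 h4, fun b hb => h2 (A.σy b - b) ?_⟩
        rw [j_σy_sub, hN']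
        exact commutator_mem_lowerCentralSeries_succ y hb
      · refine ⟨_, h4, fun b hb => h2 (A.σx b - b) ?_⟩
        rw [j_σx_sub, hN']
        exact commutator_mem_lowerCentralSeries_succ x hb
  obtain ⟨φ, h1, h2⟩ := key N le_rfl
  have : φ = 0 := LinearMap.ext fun b => h2 b (by simp)
  exact h1 (this ▸ hE)

/-- Any nonzero element of the dual is detected, so the image of `koszulMap` is contained in a
hyperplane, which contains every additive function vanishing at a suitable socle element. -/
theorem exists_koszulMap_apply_eq_zero [Group.IsNilpotent G] (A : AddModel K x y B)
    {F : Type*} [Field F] {P : B → Prop}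
    (hPx : ∀ b, P b → P (A.σx b - b)) (hPy : ∀ b, P b → P (A.σy b - b))
    {b₀ : B} (hP : P b₀) {φ₀ : B →ₗ[ℤ] F} (hb₀ : φ₀ b₀ ≠ 0) :
    ∃ b, P b ∧ (∃ φ : B →ₗ[ℤ] F, φ b ≠ 0) ∧ ∀ z, A.koszulMap F z b = 0 := by
  obtain ⟨b, h1, h2, h3, h4⟩ := A.exists_socle (E := fun b => ∀ φ : B →ₗ[ℤ] F, φ b = 0)
    (fun φ => map_zero φ) hPx hPy hP (fun h => hb₀ (h φ₀))
  refine ⟨b, h1, by simpa using h2, fun z => ?_⟩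
  rw [koszulMap_apply, h3, h4, sub_zero]

/-- The case V = 0: the Koszul map has corank at most one. -/
theorem finrank_le_range {G : Type u} [Group G] (hG : HomologicallyBalanced G)
    {K : Subgroup G} [K.Normal] {x y : G} (hxy : IsZSqBasis K x y) (A : AddModel K x y B)
    {F : Type u} [Field F] (hF : ∀ a : F, ∃ n : ℕ, a = n) [FiniteDimensional F (B →ₗ[ℤ] F)] :
    Module.finrank F (B →ₗ[ℤ] F) ≤ Module.finrank F (LinearMap.range (A.koszulMap F)) + 1 := by
  have := A.finrank_add_le hG hxy hF (V := PUnit.{1}) 0 0 0 (by simp) (by simp) (by simp)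
    (fun μ _ => by ext v; exact map_zero μ)
  rwa [Module.finrank_zero_of_subsingleton (M := PUnit.{1}), add_zero] at this

/-- There is no quadratic cochain with a nonzero alternating part. -/
theorem no_quadratic {G : Type u} [Group G] [Group.IsNilpotent G] (hG : HomologicallyBalanced G)
    {K : Subgroup G} [K.Normal] {x y : G} (hxy : IsZSqBasis K x y) (A : AddModel K x y B)
    {F : Type u} [Field F] (hF : ∀ a : F, ∃ n : ℕ, a = n) [FiniteDimensional F (B →ₗ[ℤ] F)]
    (ε l : B →ₗ[ℤ] F) (f g : B → F)
    (hf : ∀ a b, ε a * l b + f (a + b) = f a + f b + ε (A.σx a) * l (A.σx b))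
    (hg : ∀ a b, ε a * l b + g (a + b) = g a + g b + ε (A.σy a) * l (A.σy b))
    (hfg : ∀ a, g a + f (A.σy a) = f a + g (A.σx a) + ε A.τ * l (A.σy (A.σx a)) -
      ε (A.σy (A.σx a)) * l A.τ)
    {a₀ b₀ : B} (hω : ε a₀ * l b₀ - ε b₀ * l a₀ ≠ 0) : False := by
  let c : B →+ B →+ F :=
    { toFun := fun a => (AddMonoidHom.mulLeft (ε a)).comp l.toAddMonoidHom
      map_zero' := by ext; simp
      map_add' := fun a b => by ext; simp [add_mul] }
  have hspan : ∀ μ : F →+ F, (∀ a b, μ (c a b - c b a) = 0) → μ = 0 := by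
    intro μ hμ
    ext v
    obtain ⟨n, hn⟩ := hF (v / (ε a₀ * l b₀ - ε b₀ * l a₀))
    rw [div_eq_iff hω] at hn
    rw [hn, ← nsmul_eq_mul, map_nsmul]
    have := hμ a₀ b₀
    change μ (ε a₀ * l b₀ - ε b₀ * l a₀) = 0 at this
    rw [this, smul_zero]
    rfl
  have h1 := A.finrank_add_le hG hxy hF c f g hf hg hfg hspan
  rw [Module.finrank_self] at h1
  have hex : ∃ φ : B →ₗ[ℤ] F, ∃ b, φ b ≠ 0 := by
    by_contra! h
    simp [h] at hω
  obtain ⟨φ, b, hb⟩ := hex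
  obtain ⟨b', -, ⟨φ', hφ'⟩, hb'⟩ := A.exists_koszulMap_apply_eq_zero (P := fun _ => True)
    (fun _ _ => trivial) (fun _ _ => trivial) trivial hb
  -- The extra dimension V = F would force the Koszul map to be onto, but its image vanishes at a
  -- socle element seen by the dual.
  have hlt : LinearMap.range (A.koszulMap F) < ⊤ := by
    refine lt_top_iff_ne_top.mpr fun h => ?_
    obtain ⟨z, hz⟩ := LinearMap.range_eq_top.mp h φ'
    exact hφ' (hz ▸ hb' z)
  have := Submodule.finrank_lt hlt.ne
  omega

end AddModel

end NilGrp


/-! ### The dual of K has dimension at most two modulo large primes. -/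

namespace NilGrp

open scoped commutatorElement

namespace AddModel

/-- In dimension at least three, take ε invariant with ε(τ) = 1 and l invariant modulo ε with l(τ) =
0. The cocycle ε(a)l(b) has an invariant alternating part, and its lifting conditions reduce to one
linear equation, solvable because the image of the Koszul map is a known hyperplane. This
contradicts `no_quadratic`. -/
theorem finrank_dual_le_two {G : Type u} [Group G] [Group.IsNilpotent G]
    (hG : HomologicallyBalanced G) {K : Subgroup G} [K.Normal] {x y : G}
    (hxy : IsZSqBasis K x y) {B : Type*} [AddCommGroup B] (A : AddModel K x y B)
    {F : Type u} [Field F] (hF : ∀ a : F, ∃ n : ℕ, a = n) [FiniteDimensional F (B →ₗ[ℤ] F)]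
    (h2 : (2 : F) ≠ 0) {n : ℕ} (hn : (n : F) ≠ 0)
    (hspan : ∀ b, ∃ (k : ℤ) (b₁ b₂ : B), n • b = k • A.τ + (A.σx b₁ - b₁) + (A.σy b₂ - b₂)) :
    Module.finrank F (B →ₗ[ℤ] F) ≤ 2 := by
  by_contra! hlt
  -- invariant additive functions are determined by their value at `τ`
  have hinv : ∀ φ : B →ₗ[ℤ] F, (∀ b, φ (A.σx b - b) = 0) → (∀ b, φ (A.σy b - b) = 0) →
      φ A.τ = 0 → φ = 0 := by
    intro φ hx hy hτ
    ext b
    obtain ⟨k, b₁, b₂, h⟩ := hspan b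
    have h' := congrArg φ h
    rw [map_add, map_add, hx, hy, map_zsmul, hτ, map_nsmul, smul_zero, add_zero, add_zero,
      nsmul_eq_mul] at h'
    exact (mul_eq_zero.mp h').resolve_left hn
  have : Nontrivial (B →ₗ[ℤ] F) := Module.nontrivial_of_finrank_pos (R := F) (by omega)
  obtain ⟨φ₀, hφ₀⟩ := exists_ne (0 : B →ₗ[ℤ] F)
  obtain ⟨φ, hφ, hφx, hφy⟩ := A.exists_dual_socle (E := fun φ => φ = 0) rfl hφ₀
  have hφx' : ∀ b, φ (A.σx b - b) = 0 := LinearMap.congr_fun hφx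
  have hφy' : ∀ b, φ (A.σy b - b) = 0 := LinearMap.congr_fun hφy
  have hφτ : φ A.τ ≠ 0 := fun h => hφ (hinv φ hφx' hφy' h)
  let ε : B →ₗ[ℤ] F := (φ A.τ)⁻¹ • φ
  have hε : ∀ b, ε b = (φ A.τ)⁻¹ * φ b := fun b => rfl
  have hεx : ∀ b, ε (A.σx b - b) = 0 := fun b => by rw [hε, hφx', mul_zero]
  have hεy : ∀ b, ε (A.σy b - b) = 0 := fun b => by rw [hε, hφy', mul_zero]
  have hετ : ε A.τ = 1 := by rw [hε, inv_mul_cancel₀ hφτ]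
  have hsmall : ∀ W : Submodule F (B →ₗ[ℤ] F), (∀ w ∈ W, ∃ a : F, w = a • ε) →
      Module.finrank F W ≤ 1 := by
    intro W hW
    have hle : W ≤ F ∙ ε := fun w hw => by
      obtain ⟨a, rfl⟩ := hW w hw
      exact Submodule.smul_mem _ _ (Submodule.mem_span_singleton_self ε)
    exact (Submodule.finrank_mono hle).trans (by
      rw [finrank_span_singleton fun h => by simp [h] at hετ])
  -- a second function, invariant modulo `ε`
  have hex : ∃ ψ : B →ₗ[ℤ] F, ¬∃ a : F, ψ = a • ε := by
    by_contra! h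
    have := hsmall ⊤ (fun w _ => h w)
    rw [finrank_top] at this
    omega
  obtain ⟨ψ₀, hψ₀⟩ := hex
  obtain ⟨ψ, hψ, ⟨u, hu⟩, ⟨v, hv⟩⟩ := A.exists_dual_socle (E := fun φ => ∃ a : F, φ = a • ε)
    ⟨0, (zero_smul F ε).symm⟩ hψ₀
  let l : B →ₗ[ℤ] F := ψ - ψ A.τ • ε
  have hl : ∀ b, l b = ψ b - ψ A.τ * ε b := fun b => rfl
  have hlx : ∀ b, l (A.σx b - b) = u * ε b := fun b => by
    rw [hl, hεx, mul_zero, sub_zero]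
    exact LinearMap.congr_fun hu b
  have hly : ∀ b, l (A.σy b - b) = v * ε b := fun b => by
    rw [hl, hεy, mul_zero, sub_zero]
    exact LinearMap.congr_fun hv b
  have hlτ : l A.τ = 0 := by rw [hl, hετ, mul_one, sub_self]
  have hl0 : l ≠ 0 := fun h => hψ ⟨ψ A.τ, sub_eq_zero.mp h⟩
  have hbh := A.finrank_le_range hG hxy hF
  -- an element of `(σ - 1)² B` with a nonzero value
  have hb₀ : ∃ b₀, (l b₀ = 0 ∧ ε b₀ = 0) ∧ ∃ χ : B →ₗ[ℤ] F, χ b₀ ≠ 0 := by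
    by_contra! h
    have hxx : ∀ (χ : B →ₗ[ℤ] F) b, χ (A.σx (A.σx b - b) - (A.σx b - b)) = 0 := fun χ b =>
      h _ ⟨by rw [hlx, hεx, mul_zero], hεx _⟩ χ
    have hxy : ∀ (χ : B →ₗ[ℤ] F) b, χ (A.σx (A.σy b - b) - (A.σy b - b)) = 0 := fun χ b =>
      h _ ⟨by rw [hlx, hεy, mul_zero], hεx _⟩ χ
    have hyx : ∀ (χ : B →ₗ[ℤ] F) b, χ (A.σy (A.σx b - b) - (A.σx b - b)) = 0 := fun χ b =>
      h _ ⟨by rw [hly, hεx, mul_zero], hεy _⟩ χ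
    have hyy : ∀ (χ : B →ₗ[ℤ] F) b, χ (A.σy (A.σy b - b) - (A.σy b - b)) = 0 := fun χ b =>
      h _ ⟨by rw [hly, hεy, mul_zero], hεy _⟩ χ
    -- If all second differences were invisible to the dual, the Koszul image would consist of
    -- invariant functions, that is, multiples of ε, and corank one would give dimension at most
    -- two.
    have := hsmall (LinearMap.range (A.koszulMap F)) (by
      rintro _ ⟨z, rfl⟩
      refine ⟨A.koszulMap F z A.τ, sub_eq_zero.mp (hinv _ (fun b => ?_) (fun b => ?_) ?_)⟩
      · rw [LinearMap.sub_apply, LinearMap.smul_apply, hεx, smul_zero, sub_zero,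
          koszulMap_apply, hyx, hxx, sub_zero]
      · rw [LinearMap.sub_apply, LinearMap.smul_apply, hεy, smul_zero, sub_zero,
          koszulMap_apply, hyy, hxy, sub_zero]
      · rw [LinearMap.sub_apply, LinearMap.smul_apply, hετ, smul_eq_mul, mul_one, sub_self])
    omega
  obtain ⟨b₀, hb₀P, χ, hχ⟩ := hb₀
  obtain ⟨b, ⟨hlb, hεb⟩, ⟨φ', hφ'⟩, hb⟩ := A.exists_koszulMap_apply_eq_zero
    (P := fun b => l b = 0 ∧ ε b = 0)
    (fun b hb => ⟨by rw [hlx, hb.2, mul_zero], hεx b⟩)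
    (fun b hb => ⟨by rw [hly, hb.2, mul_zero], hεy b⟩) hb₀P hχ
  -- the image of `koszulMap` is the hyperplane of functions vanishing at `b`
  let ev : (B →ₗ[ℤ] F) →ₗ[F] F :=
    { toFun := fun φ => φ b
      map_add' := fun _ _ => rfl
      map_smul' := fun _ _ => rfl }
  have hev : Module.finrank F (LinearMap.ker ev) + 1 = Module.finrank F (B →ₗ[ℤ] F) := by
    have hsurj : LinearMap.range ev = ⊤ := by
      rw [LinearMap.range_eq_top]
      intro c
      refine ⟨(c * (φ' b)⁻¹) • φ', ?_⟩
      change c * (φ' b)⁻¹ * φ' b = c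
      rw [mul_assoc, inv_mul_cancel₀ hφ', mul_one]
    have := LinearMap.finrank_range_add_finrank_ker ev
    rw [hsurj, finrank_top, Module.finrank_self] at this
    omega
  have hrange : LinearMap.range (A.koszulMap F) = LinearMap.ker ev := by
    apply Submodule.eq_of_le_of_finrank_le
    · rintro _ ⟨z, rfl⟩
      exact hb z
    · omega
  -- This is the function that remains when the quadratic cochains below are substituted into the
  -- commutation condition.
  have hmem : l + (u + v) • ε ∈ LinearMap.range (A.koszulMap F) := by
    rw [hrange, LinearMap.mem_ker]
    change l b + (u + v) * ε b = 0
    rw [hlb, hεb, mul_zero, add_zero]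
  obtain ⟨⟨χ₀, ω₀⟩, hz⟩ := hmem
  have hz' : ∀ a, χ₀ (A.σy a - a) - ω₀ (A.σx a - a) = l a + (u + v) * ε a :=
    LinearMap.congr_fun hz
  have eεx : ∀ b, ε (A.σx b) = ε b := fun b => by
    have := hεx b; rwa [map_sub, sub_eq_zero] at this
  have eεy : ∀ b, ε (A.σy b) = ε b := fun b => by
    have := hεy b; rwa [map_sub, sub_eq_zero] at this
  have elx : ∀ b, l (A.σx b) = l b + u * ε b := fun b => by
    have := hlx b; rw [map_sub] at this; linear_combination this
  have ely : ∀ b, l (A.σy b) = l b + v * ε b := fun b => by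
    have := hly b; rw [map_sub] at this; linear_combination this
  obtain ⟨b₁, hb₁⟩ : ∃ b₁, l b₁ ≠ 0 := by
    by_contra! h
    exact hl0 (LinearMap.ext h)
  -- Lifting σx requires f(a + b) − f(a) − f(b) = u ε(a) ε(b), hence u ε² / 2 plus an additive term;
  -- likewise for g with v.
  refine A.no_quadratic hG hxy hF ε l (fun a => u * ε a ^ 2 / 2 + χ₀ a)
    (fun a => v * ε a ^ 2 / 2 + ω₀ a) (fun a b => ?_) (fun a b => ?_) (fun a => ?_)
    (a₀ := A.τ) (b₀ := b₁) ?_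
  · simp only [eεx, elx, map_add]
    field_simp
    ring
  · simp only [eεy, ely, map_add]
    field_simp
    ring
  · have h := hz' a
    rw [map_sub, map_sub] at h
    simp only [eεx, eεy, elx, ely, hετ, hlτ]
    linear_combination h
  · rw [hετ, hlτ, mul_zero, sub_zero, one_mul]
    exact hb₁

end AddModel

end NilGrp


/-! ### Normal forms in the presented groups and recognition of ℤ², Γ_q and Ω. -/

namespace NilGrp

open scoped commutatorElement

theorem IsZSqBasis.eq_zero_of_eq_one {G : Type*} [Group G] {K : Subgroup G} {x y : G}
    (h : IsZSqBasis K x y) {k : G} (hk : k ∈ K) {i j : ℤ} (h1 : k * y ^ j * x ^ i = 1) :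
    i = 0 ∧ j = 0 ∧ k = 1 := by
  have h2 : y ^ j * x ^ i = k⁻¹ := by rw [eq_inv_iff_mul_eq_one, ← mul_eq_one_comm, ← mul_assoc, h1]
  obtain ⟨rfl, rfl⟩ := h.eq_zero i j (h2 ▸ inv_mem hk)
  exact ⟨rfl, rfl, by simpa using h1⟩

theorem conj_zpow_mul {H : Type*} [Group H] (t : H) {a b : H} {n : ℤ} (h : t * a * t⁻¹ = b) :
    t * a ^ n = b ^ n * t := by
  rw [← h, conj_zpow]; group

/-- The normal words are stable under left multiplication by generators and their inverses.
Uniqueness is not needed: it is read off in the target group. -/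
theorem GammaGrp.exists_eq (q : ℕ) (h : GammaGrp q) : ∃ k i j : ℤ, h =
    (PresentedGroup.of 2 : GammaGrp q) ^ k * (PresentedGroup.of 1) ^ j *
      (PresentedGroup.of 0) ^ i := by
  set x : GammaGrp q := PresentedGroup.of 0 with hx
  set y : GammaGrp q := PresentedGroup.of 1 with hy
  set z : GammaGrp q := PresentedGroup.of 2 with hz
  have r1 : ⁅x, y⁆ * (z ^ q)⁻¹ = 1 := PresentedGroup.one_of_mem (rels := gammaRels q)
    (x := ⁅FreeGroup.of (0 : Fin 3), FreeGroup.of 1⁆ * (FreeGroup.of 2 ^ q)⁻¹) (by simp [gammaRels])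
  have r2 : ⁅x, z⁆ = 1 := PresentedGroup.one_of_mem (rels := gammaRels q)
    (x := ⁅FreeGroup.of (0 : Fin 3), FreeGroup.of 2⁆) (by simp [gammaRels])
  have r3 : ⁅y, z⁆ = 1 := PresentedGroup.one_of_mem (rels := gammaRels q)
    (x := ⁅FreeGroup.of (1 : Fin 3), FreeGroup.of 2⁆) (by simp [gammaRels])
  have c1 : Commute x z := commutatorElement_eq_one_iff_commute.mp r2
  have c2 : Commute y z := commutatorElement_eq_one_iff_commute.mp r3
  have hconj : x * y * x⁻¹ = z ^ q * y := by
    rw [← mul_inv_eq_one.mp r1, commutatorElement_def]; group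
  have hxm : ∀ k i j : ℤ, x * (z ^ k * y ^ j * x ^ i) =
      z ^ (k + q * j) * y ^ j * x ^ (i + 1) := by
    intro k i j
    have h1 : x * z ^ k = z ^ k * x := c1.zpow_right k
    have h2 : x * y ^ j = (z ^ q * y) ^ j * x := conj_zpow_mul x hconj
    have h3 : (z ^ q * y) ^ j = z ^ (q * j : ℤ) * y ^ j := by
      rw [(c2.symm.pow_left q).mul_zpow, ← zpow_natCast, zpow_mul]
    rw [← mul_assoc, ← mul_assoc, h1, mul_assoc (z ^ k), h2, h3, zpow_add, add_comm i, zpow_add,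
      zpow_one]
    simp only [mul_assoc]
  have hym : ∀ k i j : ℤ, y * (z ^ k * y ^ j * x ^ i) = z ^ k * y ^ (j + 1) * x ^ i := by
    intro k i j
    have h1 : y * z ^ k = z ^ k * y := c2.zpow_right k
    rw [← mul_assoc, ← mul_assoc, h1, add_comm j, zpow_add, zpow_one]
    simp only [mul_assoc]
  have hzm : ∀ k i j : ℤ, z * (z ^ k * y ^ j * x ^ i) = z ^ (k + 1) * y ^ j * x ^ i := by
    intro k i j
    rw [← mul_assoc, ← mul_assoc, add_comm k, zpow_add, zpow_one]
  have hmem : h ∈ Subgroup.closure (Set.range (PresentedGroup.of (rels := gammaRels q))) := by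
    rw [PresentedGroup.closure_range_of]; trivial
  induction hmem using Subgroup.closure_induction_left with
  | one => exact ⟨0, 0, 0, by simp⟩
  | mul_left a ha b hb ih =>
    obtain ⟨c, rfl⟩ := ha
    obtain ⟨k, i, j, rfl⟩ := ih
    fin_cases c
    · exact ⟨_, _, _, hxm k i j⟩
    · exact ⟨_, _, _, hym k i j⟩
    · exact ⟨_, _, _, hzm k i j⟩
  | inv_mul_cancel a ha b hb ih =>
    obtain ⟨c, rfl⟩ := ha
    obtain ⟨k, i, j, rfl⟩ := ih
    fin_cases c
    · refine ⟨k - q * j, i - 1, j, inv_mul_eq_iff_eq_mul.mpr ((hxm _ _ _).trans ?_).symm⟩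
      simp
    · refine ⟨k, i, j - 1, inv_mul_eq_iff_eq_mul.mpr ((hym _ _ _).trans ?_).symm⟩
      simp
    · refine ⟨k - 1, i, j, inv_mul_eq_iff_eq_mul.mpr ((hzm _ _ _).trans ?_).symm⟩
      simp

/-- A group with a free abelian quotient of rank two and a central infinite cyclic kernel
generated by a root of the commutator is one of the groups `Γ_q`. -/
theorem nonempty_mulEquiv_gammaGrp {G : Type*} [Group G] {K : Subgroup G} {x y : G}
    (hxy : IsZSqBasis K x y) (q : ℕ) {z : G} (hz : ∀ k, k ∈ K ↔ ∃ n : ℤ, k = z ^ n)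
    (hz0 : ∀ n : ℤ, z ^ n = 1 → n = 0) (hxz : Commute x z) (hyz : Commute y z)
    (hq : ⁅x, y⁆ = z ^ q) : Nonempty (G ≃* GammaGrp q) := by
  let f : Fin 3 → G := ![x, y, z]
  have hf : ∀ r ∈ gammaRels q, FreeGroup.lift f r = 1 := by
    rintro r (rfl | rfl | rfl)
    · simp [f, hq, map_commutatorElement]
    · simpa [f, map_commutatorElement, commutatorElement_eq_one_iff_commute] using hxz
    · simpa [f, map_commutatorElement, commutatorElement_eq_one_iff_commute] using hyz
  let φ : GammaGrp q →* G := PresentedGroup.toGroup hf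
  have hφ : ∀ k i j : ℤ, φ ((PresentedGroup.of 2 : GammaGrp q) ^ k * (PresentedGroup.of 1) ^ j *
      (PresentedGroup.of 0) ^ i) = z ^ k * y ^ j * x ^ i := by
    intro k i j
    simp only [map_mul, map_zpow, φ, PresentedGroup.toGroup.of]
    rfl
  refine ⟨(MulEquiv.ofBijective φ ⟨?_, fun g => ?_⟩).symm⟩
  · rw [injective_iff_map_eq_one]
    intro h h1
    obtain ⟨k, i, j, rfl⟩ := GammaGrp.exists_eq q h
    rw [hφ] at h1
    obtain ⟨rfl, rfl, h2⟩ := hxy.eq_zero_of_eq_one ((hz _).mpr ⟨k, rfl⟩) h1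
    simp [hz0 k h2]
  · obtain ⟨k, hk, i, j, rfl⟩ := hxy.exists_eq g
    obtain ⟨n, rfl⟩ := (hz k).mp hk
    exact ⟨_, hφ n i j⟩

theorem OmegaGrp.exists_eq (h : OmegaGrp) :
    let t : OmegaGrp := PresentedGroup.of 0
    let v : OmegaGrp := PresentedGroup.of 1
    ∃ k l i j : ℤ, h = ⁅t, ⁅t, v⁆⁆ ^ k * ⁅t, v⁆ ^ l * v ^ j * t ^ i := by
  intro t v
  have r1 : ⁅t, ⁅t, ⁅t, v⁆⁆⁆ = 1 := PresentedGroup.one_of_mem (rels := omegaRels)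
    (x := ⁅FreeGroup.of (0 : Fin 2),
      ⁅FreeGroup.of (0 : Fin 2), ⁅FreeGroup.of (0 : Fin 2), FreeGroup.of 1⁆⁆⁆)
    (by simp [omegaRels])
  have r2 : ⁅v, ⁅t, v⁆⁆ = 1 := PresentedGroup.one_of_mem (rels := omegaRels)
    (x := ⁅FreeGroup.of (1 : Fin 2), ⁅FreeGroup.of (0 : Fin 2), FreeGroup.of 1⁆⁆) (by simp [omegaRels])
  have hv : t * v * t⁻¹ = ⁅t, v⁆ * v := by rw [commutatorElement_def]; group
  generalize ⁅t, v⁆ = a at *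
  have ha : t * a * t⁻¹ = ⁅t, a⁆ * a := by rw [commutatorElement_def]; group
  generalize ⁅t, a⁆ = b at *
  have c1 : Commute t b := commutatorElement_eq_one_iff_commute.mp r1
  have c2 : Commute v a := commutatorElement_eq_one_iff_commute.mp r2
  have hb : t * b * t⁻¹ = b := by rw [c1.eq]; group
  -- With a = [t, v] and b = [t, a], conjugating the relation that v commutes with a by t shows that
  -- av commutes with b; conjugating again shows the same for ba(av). Dividing, a and then v commute
  -- with b.
  have conj : ∀ {g h : OmegaGrp}, Commute g h → Commute (t * g * t⁻¹) (t * h * t⁻¹) := by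
    intro g h hgh
    have := hgh.map (MulAut.conj t).toMonoidHom
    simpa using this
  have c3 : Commute (a * v) b := by
    have h1 := conj c2
    rw [hv, ha] at h1
    have h2 : Commute (a * v) a := (Commute.refl a).mul_left c2
    simpa using h1.mul_right h2.inv_right
  have c4 : Commute (b * a * (a * v)) b := by
    have h1 := conj c3
    rw [hb] at h1
    have h2 : t * (a * v) * t⁻¹ = (t * a * t⁻¹) * (t * v * t⁻¹) := by group
    rwa [h2, ha, hv] at h1
  have c5 : Commute a b := by
    have h1 := ((Commute.refl b).inv_left.mul_left c4).mul_left c3.inv_left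
    simpa [mul_assoc] using h1
  have c6 : Commute v b := by
    have h1 := c5.inv_left.mul_left c3
    simpa using h1
  have htm : ∀ k l i j : ℤ, t * (b ^ k * a ^ l * v ^ j * t ^ i) =
      b ^ (k + l) * a ^ (l + j) * v ^ j * t ^ (i + 1) := by
    intro k l i j
    have h1 : t * b ^ k = b ^ k * t := c1.zpow_right k
    have h2 : t * a ^ l = (b * a) ^ l * t := conj_zpow_mul t ha
    have h3 : t * v ^ j = (a * v) ^ j * t := conj_zpow_mul t hv
    rw [c5.symm.mul_zpow] at h2
    rw [c2.symm.mul_zpow] at h3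
    calc t * (b ^ k * a ^ l * v ^ j * t ^ i) = t * b ^ k * a ^ l * v ^ j * t ^ i := by
          simp only [mul_assoc]
      _ = b ^ k * (t * a ^ l) * v ^ j * t ^ i := by rw [h1]; simp only [mul_assoc]
      _ = b ^ k * (b ^ l * a ^ l) * (t * v ^ j) * t ^ i := by rw [h2]; simp only [mul_assoc]
      _ = b ^ (k + l) * a ^ (l + j) * v ^ j * t ^ (i + 1) := by
        rw [h3, zpow_add, zpow_add, add_comm i, zpow_add, zpow_one]; simp only [mul_assoc]
  have hvm : ∀ k l i j : ℤ, v * (b ^ k * a ^ l * v ^ j * t ^ i) =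
      b ^ k * a ^ l * v ^ (j + 1) * t ^ i := by
    intro k l i j
    have h1 : v * (b ^ k * a ^ l) = b ^ k * a ^ l * v :=
      (c6.zpow_right k).mul_right (c2.zpow_right l)
    rw [← mul_assoc, ← mul_assoc, h1, add_comm j, zpow_add, zpow_one]
    simp only [mul_assoc]
  have hmem : h ∈ Subgroup.closure (Set.range (PresentedGroup.of (rels := omegaRels))) := by
    rw [PresentedGroup.closure_range_of]; trivial
  induction hmem using Subgroup.closure_induction_left with
  | one => exact ⟨0, 0, 0, 0, by simp⟩
  | mul_left c hc d hd ih =>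
    obtain ⟨s, rfl⟩ := hc
    obtain ⟨k, l, i, j, rfl⟩ := ih
    fin_cases s
    · exact ⟨_, _, _, _, htm k l i j⟩
    · exact ⟨_, _, _, _, hvm k l i j⟩
  | inv_mul_cancel c hc d hd ih =>
    obtain ⟨s, rfl⟩ := hc
    obtain ⟨k, l, i, j, rfl⟩ := ih
    fin_cases s
    · refine ⟨k - (l - j), l - j, i - 1, j,
        inv_mul_eq_iff_eq_mul.mpr ((htm _ _ _ _).trans ?_).symm⟩
      simp
    · refine ⟨k, l, i, j - 1, inv_mul_eq_iff_eq_mul.mpr ((hvm _ _ _ _).trans ?_).symm⟩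
      simp

theorem nonempty_mulEquiv_omegaGrp {G : Type*} [Group G] {K : Subgroup G} {t v : G}
    (htv : IsZSqBasis K t v)
    (hK : ∀ k, k ∈ K ↔ ∃ m n : ℤ, k = ⁅t, ⁅t, v⁆⁆ ^ m * ⁅t, v⁆ ^ n)
    (hK0 : ∀ m n : ℤ, ⁅t, ⁅t, v⁆⁆ ^ m * ⁅t, v⁆ ^ n = 1 → m = 0 ∧ n = 0)
    (ht : ⁅t, ⁅t, ⁅t, v⁆⁆⁆ = 1) (hv : ⁅v, ⁅t, v⁆⁆ = 1) : Nonempty (G ≃* OmegaGrp) := by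
  let f : Fin 2 → G := ![t, v]
  have hf : ∀ r ∈ omegaRels, FreeGroup.lift f r = 1 := by
    rintro r (rfl | rfl)
    · simpa [f, map_commutatorElement] using ht
    · simpa [f, map_commutatorElement] using hv
  let φ : OmegaGrp →* G := PresentedGroup.toGroup hf
  have hφ0 : φ (PresentedGroup.of 0) = t := by
    simp only [φ, PresentedGroup.toGroup.of]
    rfl
  have hφ1 : φ (PresentedGroup.of 1) = v := by
    simp only [φ, PresentedGroup.toGroup.of]
    rfl
  refine ⟨(MulEquiv.ofBijective φ ⟨?_, fun g => ?_⟩).symm⟩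
  · rw [injective_iff_map_eq_one]
    intro h h1
    obtain ⟨k, l, i, j, rfl⟩ := OmegaGrp.exists_eq h
    simp only [map_mul, map_zpow, map_commutatorElement, hφ0, hφ1] at h1
    obtain ⟨rfl, rfl, h2⟩ := htv.eq_zero_of_eq_one ((hK _).mpr ⟨k, l, rfl⟩) h1
    obtain ⟨rfl, rfl⟩ := hK0 k l h2
    simp
  · obtain ⟨k, hk, i, j, rfl⟩ := htv.exists_eq g
    obtain ⟨m, n, rfl⟩ := (hK k).mp hk
    let t' : OmegaGrp := PresentedGroup.of 0
    let v' : OmegaGrp := PresentedGroup.of 1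
    refine ⟨⁅t', ⁅t', v'⁆⁆ ^ m * ⁅t', v'⁆ ^ n * v' ^ j * t' ^ i, ?_⟩
    simp only [map_mul, map_zpow, map_commutatorElement, t', v', hφ0, hφ1]

theorem nonempty_mulEquiv_zSq {G : Type*} [Group G] {x y : G} (hxy : IsZSqBasis ⊥ x y) :
    Nonempty (G ≃* ZSq) := by
  have hc : Commute x y :=
    commutatorElement_eq_one_iff_commute.mp (Subgroup.mem_bot.mp hxy.commutator_mem)
  let φ : ZSq →* G :=
    { toFun := fun z => y ^ z.toAdd.2 * x ^ z.toAdd.1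
      map_one' := by simp
      map_mul' := fun z w => by
        have h : Commute (x ^ z.toAdd.1) (y ^ w.toAdd.2) := hc.zpow_zpow _ _
        rw [toAdd_mul, Prod.snd_add, Prod.fst_add, zpow_add, zpow_add, mul_assoc, mul_assoc,
          ← mul_assoc (x ^ z.toAdd.1) (y ^ w.toAdd.2), h.eq]
        simp only [mul_assoc] }
  refine ⟨(MulEquiv.ofBijective φ ⟨?_, fun g => ?_⟩).symm⟩
  · rw [injective_iff_map_eq_one]
    intro z hz
    obtain ⟨h1, h2⟩ := hxy.eq_zero _ _ (Subgroup.mem_bot.mpr hz)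
    exact Multiplicative.toAdd.injective (Prod.ext h1 h2)
  · obtain ⟨k, hk, i, j, rfl⟩ := hxy.exists_eq g
    refine ⟨.ofAdd (i, j), ?_⟩
    rw [Subgroup.mem_bot.mp hk, one_mul]
    rfl

end NilGrp


/-! ### Kernel of rank two: normalising the action and the commutator. -/

namespace NilGrp

open scoped commutatorElement

/-- A unimodular change of basis of the quotient. -/
theorem IsZSqBasis.change {G : Type*} [Group G] {K : Subgroup G} [K.Normal] {x y : G}
    (h : IsZSqBasis K x y) {i j r s : ℤ} (hdet : i * r + j * s = 1) :
    IsZSqBasis K (y ^ j * x ^ i) (y ^ r * x ^ (-s)) := by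
  have hc : Commute (x : G ⧸ K) (y : G ⧸ K) := by
    rw [← commutatorElement_eq_one_iff_commute]
    exact (QuotientGroup.eq_one_iff _).mpr h.commutator_mem
  have hpow : ∀ m n a b : ℤ, ((y : G ⧸ K) ^ n * (x : G ⧸ K) ^ m) ^ b *
      ((y : G ⧸ K) ^ j * (x : G ⧸ K) ^ i) ^ a =
        (y : G ⧸ K) ^ (n * b + j * a) * (x : G ⧸ K) ^ (m * b + i * a) := by
    intro m n a b
    rw [(hc.symm.zpow_zpow n m).mul_zpow, (hc.symm.zpow_zpow j i).mul_zpow, ← zpow_mul,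
      ← zpow_mul, ← zpow_mul, ← zpow_mul, zpow_add, zpow_add, mul_assoc, mul_assoc,
      ← mul_assoc ((x : G ⧸ K) ^ _), (hc.zpow_zpow (m * b) (j * a)).eq]
    simp only [mul_assoc]
  refine ⟨?_, fun g => ?_, fun a b hab => ?_⟩
  · have h1 : Commute ((y : G ⧸ K) ^ j * (x : G ⧸ K) ^ i)
        ((y : G ⧸ K) ^ r * (x : G ⧸ K) ^ (-s)) :=
      (((Commute.refl _).zpow_zpow _ _).mul_right (hc.symm.zpow_zpow _ _)).mul_left
        ((hc.zpow_zpow _ _).mul_right ((Commute.refl _).zpow_zpow _ _))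
    exact (QuotientGroup.eq_one_iff _).mp (commutatorElement_eq_one_iff_commute.mpr h1)
  · obtain ⟨k, hk, m, n, rfl⟩ := h.exists_eq g
    -- The exponents are the coordinates (m, n) transformed by the inverse of the unimodular matrix.
    refine ⟨k * y ^ n * x ^ m * ((y ^ r * x ^ (-s)) ^ (i * n - j * m) *
      (y ^ j * x ^ i) ^ (r * m + s * n))⁻¹, ?_, r * m + s * n, i * n - j * m, by group⟩
    rw [← QuotientGroup.eq_one_iff]
    have hk' : (k : G ⧸ K) = 1 := (QuotientGroup.eq_one_iff k).mpr hk
    simp only [QuotientGroup.mk_mul, QuotientGroup.mk_inv, QuotientGroup.mk_zpow, hk', one_mul]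
    rw [hpow, mul_inv_eq_one]
    congr 2
    · linear_combination (-n) * hdet
    · linear_combination (-m) * hdet
  · rw [← QuotientGroup.eq_one_iff] at hab
    simp only [QuotientGroup.mk_mul, QuotientGroup.mk_zpow] at hab
    rw [hpow] at hab
    obtain ⟨h1, h2⟩ := h.eq_zero _ _ ((QuotientGroup.eq_one_iff _).mp hab)
    exact ⟨by linear_combination r * h1 + s * h2 - a * hdet,
      by linear_combination i * h2 - j * h1 - b * hdet⟩

namespace AddModel

variable {G : Type*} [Group G] {K : Subgroup G} {x y : G} {B : Type*} [AddCommGroup B]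

/-- Transport of a model along an isomorphism. -/
def congr (A : AddModel K x y B) {B' : Type*} [AddCommGroup B'] (e : B' ≃+ B) :
    AddModel K x y B' where
  j := A.j.comp e.toMultiplicative.toMonoidHom
  σx := (e.symm.toAddMonoidHom.comp A.σx).comp e.toAddMonoidHom
  σy := (e.symm.toAddMonoidHom.comp A.σy).comp e.toAddMonoidHom
  τ := e.symm A.τ
  j_inj := A.j_inj.comp e.toMultiplicative.injective
  range_j := by
    refine Eq.trans ?_ A.range_j
    ext g
    constructor
    · rintro ⟨b, rfl⟩
      exact ⟨_, rfl⟩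
    · rintro ⟨b, rfl⟩
      exact ⟨.ofAdd (e.symm b.toAdd), congrArg A.j
        (congrArg Multiplicative.ofAdd (e.apply_symm_apply b.toAdd))⟩
  j_σx b := by
    change A.j (.ofAdd (e (e.symm (A.σx (e b))))) = x * A.j (.ofAdd (e b)) * x⁻¹
    rw [e.apply_symm_apply, A.j_σx]
  j_σy b := by
    change A.j (.ofAdd (e (e.symm (A.σy (e b))))) = y * A.j (.ofAdd (e b)) * y⁻¹
    rw [e.apply_symm_apply, A.j_σy]
  j_τ := by
    change A.j (.ofAdd (e (e.symm A.τ))) = ⁅x, y⁆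
    rw [e.apply_symm_apply, A.j_τ]

theorem mem_iff (A : AddModel K x y B) (k : G) : k ∈ K ↔ ∃ b, A.j (.ofAdd b) = k := by
  refine (SetLike.ext_iff.mp A.range_j k).symm.trans ?_
  exact ⟨fun ⟨b, h⟩ => ⟨b.toAdd, h⟩, fun ⟨b, h⟩ => ⟨_, h⟩⟩

theorem j_eq_one (A : AddModel K x y B) {b : B} : A.j (.ofAdd b) = 1 ↔ b = 0 :=
  ⟨fun h => A.j_inj (h.trans (map_one A.j).symm), fun h => h ▸ map_one A.j⟩

theorem finrank_dual [Module.Free ℤ B] [Module.Finite ℤ B] (F : Type*) [Field F] :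
    FiniteDimensional F (B →ₗ[ℤ] F) ∧
      Module.finrank F (B →ₗ[ℤ] F) = Module.finrank ℤ B := by
  let e := (Module.finBasis ℤ B).constr F (M' := F)
  refine ⟨Module.Finite.equiv e, ?_⟩
  rw [← e.finrank_eq, Module.finrank_fin_fun]

theorem uliftZMod_eq_natCast (p : ℕ) [Fact p.Prime] (c : ULift.{u} (ZMod p)) : ∃ n : ℕ, c = n :=
  ⟨c.down.val, ULift.ext _ _ (ZMod.natCast_zmod_val c.down).symm⟩

theorem uliftZMod_intCast_eq_zero {p : ℕ} {n : ℤ} :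
    (n : ULift.{u} (ZMod p)) = 0 ↔ (p : ℤ) ∣ n := by
  rw [← ZMod.intCast_zmod_eq_zero_iff_dvd, ← ULift.down_inj]
  rfl

/-- Change of the basis of the quotient. -/
def change (A : AddModel K x y B) {x' y' : G} (σx σy : B →+ B) (τ : B)
    (hx : ∀ b, A.j (.ofAdd (σx b)) = x' * A.j (.ofAdd b) * x'⁻¹)
    (hy : ∀ b, A.j (.ofAdd (σy b)) = y' * A.j (.ofAdd b) * y'⁻¹)
    (hτ : A.j (.ofAdd τ) = ⁅x', y'⁆) : AddModel K x' y' B where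
  j := A.j
  σx := σx
  σy := σy
  τ := τ
  j_inj := A.j_inj
  range_j := A.range_j
  j_σx := hx
  j_σy := hy
  j_τ := hτ

/-- The shear `(m, n) ↦ (m, n + r m)` of `ℤ²`. -/
def shear (r : ℤ) : ℤ × ℤ →+ ℤ × ℤ where
  toFun b := (b.1, b.2 + r * b.1)
  map_zero' := by simp
  map_add' a b := by
    apply Prod.ext
    · rfl
    · change a.2 + b.2 + r * (a.1 + b.1) = a.2 + r * a.1 + (b.2 + r * b.1)
      ring

theorem shear_apply (r : ℤ) (b : ℤ × ℤ) : shear r b = (b.1, b.2 + r * b.1) := rfl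

/-- The pairs of group elements and shears that have the same action. -/
def shearSubgroup (j : Multiplicative (ℤ × ℤ) →* G) : Subgroup (G × Multiplicative ℤ) where
  carrier := {z | ∀ b, j (.ofAdd (shear z.2.toAdd b)) = z.1 * j (.ofAdd b) * z.1⁻¹}
  one_mem' b := by
    change j (.ofAdd (b.1, b.2 + 0 * b.1)) = 1 * j (.ofAdd b) * 1⁻¹
    simp
  mul_mem' := by
    intro z w hz hw b
    have h : shear (z * w).2.toAdd b = shear z.2.toAdd (shear w.2.toAdd b) := by
      simp only [shear_apply, Prod.snd_mul, toAdd_mul]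
      apply Prod.ext
      · rfl
      · ring
    rw [h, hz, hw, Prod.fst_mul]
    group
  inv_mem' := by
    intro z hz b
    have h := hz (shear (z⁻¹).2.toAdd b)
    have h2 : shear z.2.toAdd (shear (z⁻¹).2.toAdd b) = b := by
      simp only [shear_apply, Prod.snd_inv, toAdd_inv]
      apply Prod.ext
      · rfl
      · ring
    rw [h2] at h
    rw [h, Prod.fst_inv]
    group

theorem shearSubgroup_mem {j : Multiplicative (ℤ × ℤ) →* G} {g : G} {r : ℤ} :
    (g, Multiplicative.ofAdd r) ∈ shearSubgroup j ↔
      ∀ b, j (.ofAdd (shear r b)) = g * j (.ofAdd b) * g⁻¹ := Iff.rfl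

theorem shearSubgroup_mul_zpow {j : Multiplicative (ℤ × ℤ) →* G} {g h : G} {r s : ℤ}
    (hg : ∀ b, j (.ofAdd (shear r b)) = g * j (.ofAdd b) * g⁻¹)
    (hh : ∀ b, j (.ofAdd (shear s b)) = h * j (.ofAdd b) * h⁻¹) (m n : ℤ) (b : ℤ × ℤ) :
    j (.ofAdd (shear (n * s + m * r) b)) = h ^ n * g ^ m * j (.ofAdd b) * (h ^ n * g ^ m)⁻¹ :=
  shearSubgroup_mem.mp
    (mul_mem (zpow_mem (shearSubgroup_mem.mpr hh) n) (zpow_mem (shearSubgroup_mem.mpr hg) m)) b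

/-- Commuting unipotent operators fix a nonzero vector; divided by its content it is primitive and
becomes the second basis vector. A second socle argument shows that they act trivially on the
quotient. -/
theorem exists_fixed_basis [Group.IsNilpotent G] (A : AddModel K x y (ℤ × ℤ)) :
    ∃ (A' : AddModel K x y (ℤ × ℤ)) (r s : ℤ), A'.σx = shear r ∧ A'.σy = shear s := by
  obtain ⟨b, -, hb, hbx, hby⟩ := A.exists_socle (E := fun b => b = 0) (P := fun _ => True) rfl
    (fun _ _ => trivial) (fun _ _ => trivial) (b₀ := (1, 0)) trivial (by simp)
  have hd : Int.gcd b.1 b.2 ≠ 0 := by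
    intro h
    rw [Int.gcd_eq_zero_iff] at h
    exact hb (Prod.ext h.1 h.2)
  obtain ⟨c₁, c₂, hc, h1, h2⟩ := Int.exists_gcd_one (Nat.pos_of_ne_zero hd)
  obtain ⟨s, t, hst⟩ := Int.isCoprime_iff_gcd_eq_one.mpr hc
  have hbc : b = (Int.gcd b.1 b.2 : ℤ) • ((c₁, c₂) : ℤ × ℤ) := by
    apply Prod.ext
    · exact h1.trans (mul_comm _ _)
    · exact h2.trans (mul_comm _ _)
  have hfix : ∀ σ : ℤ × ℤ →+ ℤ × ℤ, σ b - b = 0 → σ (c₁, c₂) = (c₁, c₂) := by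
    intro σ hσ
    rw [hbc, map_zsmul, ← smul_sub, smul_eq_zero] at hσ
    exact sub_eq_zero.mp (hσ.resolve_left (Int.natCast_ne_zero.mpr hd))
  let e : ℤ × ℤ ≃+ ℤ × ℤ :=
    { toFun := fun z => (z.1 * t + z.2 * c₁, -z.1 * s + z.2 * c₂)
      invFun := fun z => (z.1 * c₂ - z.2 * c₁, z.1 * s + z.2 * t)
      left_inv := fun z => by
        apply Prod.ext
        · change (z.1 * t + z.2 * c₁) * c₂ - (-z.1 * s + z.2 * c₂) * c₁ = z.1
          linear_combination z.1 * hst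
        · change (z.1 * t + z.2 * c₁) * s + (-z.1 * s + z.2 * c₂) * t = z.2
          linear_combination z.2 * hst
      right_inv := fun z => by
        apply Prod.ext
        · change (z.1 * c₂ - z.2 * c₁) * t + (z.1 * s + z.2 * t) * c₁ = z.1
          linear_combination z.1 * hst
        · change -(z.1 * c₂ - z.2 * c₁) * s + (z.1 * s + z.2 * t) * c₂ = z.2
          linear_combination z.2 * hst
      map_add' := fun z w => by
        apply Prod.ext
        · change (z.1 + w.1) * t + (z.2 + w.2) * c₁ = z.1 * t + z.2 * c₁ + (w.1 * t + w.2 * c₁)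
          ring
        · change -(z.1 + w.1) * s + (z.2 + w.2) * c₂ =
            -z.1 * s + z.2 * c₂ + (-w.1 * s + w.2 * c₂)
          ring }
  have he : e (0, 1) = (c₁, c₂) := by
    change ((0 * t + 1 * c₁, -0 * s + 1 * c₂) : ℤ × ℤ) = _
    simp
  let A' := A.congr e
  have hx1 : A'.σx (0, 1) = (0, 1) := by
    change e.symm (A.σx (e (0, 1))) = (0, 1)
    rw [he, hfix _ hbx, ← he, e.symm_apply_apply]
  have hy1 : A'.σy (0, 1) = (0, 1) := by
    change e.symm (A.σy (e (0, 1))) = (0, 1)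
    rw [he, hfix _ hby, ← he, e.symm_apply_apply]
  obtain ⟨d, -, hd, hdx, hdy⟩ := A'.exists_socle (E := fun b => b.1 = 0) (P := fun _ => True) rfl
    (fun _ _ => trivial) (fun _ _ => trivial) (b₀ := (1, 0)) trivial (by simp)
  have hdec : ∀ d : ℤ × ℤ, d = d.1 • ((1, 0) : ℤ × ℤ) + d.2 • ((0, 1) : ℤ × ℤ) := by
    intro d
    simp
  have hshear : ∀ σ : ℤ × ℤ →+ ℤ × ℤ, σ (0, 1) = (0, 1) → (σ d - d).1 = 0 →
      σ = shear (σ (1, 0)).2 := by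
    intro σ h01 hσ
    have hval : ∀ b, σ b = (b.1 * (σ (1, 0)).1, b.1 * (σ (1, 0)).2 + b.2) := by
      intro b
      conv_lhs => rw [hdec b, map_add, map_zsmul, map_zsmul, h01]
      apply Prod.ext <;> simp
    have h10 : (σ (1, 0)).1 = 1 := by
      rw [hval] at hσ
      have h3 : d.1 * ((σ (1, 0)).1 - 1) = 0 := by
        have h4 : d.1 * (σ (1, 0)).1 - d.1 = 0 := hσ
        linear_combination h4
      exact sub_eq_zero.mp ((mul_eq_zero.mp h3).resolve_left hd)
    refine AddMonoidHom.ext fun b => ?_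
    rw [hval, shear_apply, h10, mul_one, add_comm, mul_comm]
  exact ⟨A', _, _, hshear _ hx1 hdx, hshear _ hy1 hdy⟩

theorem exists_prime_dvd {n : ℤ} (hn : n.natAbs ≠ 1) : ∃ p : ℕ, p.Prime ∧ (p : ℤ) ∣ n := by
  obtain ⟨p, hp, hdvd⟩ := Nat.exists_prime_and_dvd hn
  exact ⟨p, hp, Int.natCast_dvd.mpr hdvd⟩

/-- A common prime factor would make both actions trivial modulo p, so the Koszul map would vanish
on a two-dimensional dual and have corank two. -/
theorem isCoprime_of_shear {G : Type u} [Group G] (hG : HomologicallyBalanced G)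
    {K : Subgroup G} [K.Normal] {x y : G} (hxy : IsZSqBasis K x y)
    (A : AddModel K x y (ℤ × ℤ)) {r s : ℤ} (hr : A.σx = shear r) (hs : A.σy = shear s) :
    IsCoprime r s := by
  rw [Int.isCoprime_iff_gcd_eq_one]
  by_contra hgcd
  obtain ⟨p, hp, hdvd⟩ := Nat.exists_prime_and_dvd hgcd
  have : Fact p.Prime := ⟨hp⟩
  have hpr : (p : ℤ) ∣ r := (Int.natCast_dvd_natCast.mpr hdvd).trans (Int.gcd_dvd_left r s)
  have hps : (p : ℤ) ∣ s := (Int.natCast_dvd_natCast.mpr hdvd).trans (Int.gcd_dvd_right r s)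
  obtain ⟨hfin, hrank⟩ := finrank_dual (B := ℤ × ℤ) (ULift.{u} (ZMod p))
  have hle := A.finrank_le_range hG hxy (uliftZMod_eq_natCast p)
  have hzero : A.koszulMap (ULift.{u} (ZMod p)) = 0 := by
    refine LinearMap.ext fun z => LinearMap.ext fun b => ?_
    have h0 : ∀ (χ : ℤ × ℤ →ₗ[ℤ] ULift.{u} (ZMod p)) (q : ℤ), (p : ℤ) ∣ q →
        χ (shear q b - b) = 0 := by
      intro χ q hq
      have h1 : shear q b - b = q • ((0, b.1) : ℤ × ℤ) := by
        apply Prod.ext <;> simp [shear_apply]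
      rw [h1, map_zsmul, zsmul_eq_mul, uliftZMod_intCast_eq_zero.mpr hq, zero_mul]
    rw [koszulMap_apply, hr, hs, h0 _ _ hpr, h0 _ _ hps, sub_zero]
    rfl
  rw [hzero, LinearMap.range_zero, finrank_bot, hrank, Module.finrank_prod,
    Module.finrank_self] at hle
  omega

/-- If p divided the first coordinate of τ, the determinant form modulo p would come from an
excluded cocycle. -/
theorem natAbs_fst_τ_eq_one {G : Type u} [Group G] [Group.IsNilpotent G]
    (hG : HomologicallyBalanced G) {K : Subgroup G} [K.Normal] {x y : G}
    (hxy : IsZSqBasis K x y) (A : AddModel K x y (ℤ × ℤ)) (hx : A.σx = shear 1)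
    (hy : A.σy = shear 0) : A.τ.1.natAbs = 1 := by
  by_contra hk
  obtain ⟨p, hp, hdvd⟩ := exists_prime_dvd hk
  have : Fact p.Prime := ⟨hp⟩
  obtain ⟨hfin, -⟩ := finrank_dual (B := ℤ × ℤ) (ULift.{u} (ZMod p))
  let ε : ℤ × ℤ →ₗ[ℤ] ULift.{u} (ZMod p) :=
    ((Int.castAddHom _).comp (AddMonoidHom.fst ℤ ℤ)).toIntLinearMap
  let l : ℤ × ℤ →ₗ[ℤ] ULift.{u} (ZMod p) :=
    ((Int.castAddHom _).comp (AddMonoidHom.snd ℤ ℤ)).toIntLinearMap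
  have hε : ∀ b, ε b = (b.1 : ULift.{u} (ZMod p)) := fun b => rfl
  have hl : ∀ b, l b = (b.2 : ULift.{u} (ZMod p)) := fun b => rfl
  have hτ : ε A.τ = 0 := uliftZMod_intCast_eq_zero.mpr hdvd
  -- T is the binomial coefficient n(n − 1)/2; used in place of n²/2, it also covers p = 2.
  have hbin : ∀ n : ℤ, ∃ m : ℤ, n * (n - 1) = 2 * m := fun n => by
    obtain ⟨m, hm⟩ := Int.even_mul_pred_self n
    exact ⟨m, by rw [hm]; ring⟩
  choose T hT using hbin
  have hTadd : ∀ m n : ℤ, T (m + n) = T m + T n + m * n := by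
    intro m n
    have h1 := hT (m + n)
    have h2 := hT m
    have h3 := hT n
    apply mul_left_cancel₀ (two_ne_zero (α := ℤ))
    linear_combination h2 + h3 - h1
  refine A.no_quadratic hG hxy (uliftZMod_eq_natCast p) ε l (fun b => (T b.1 : ULift.{u} (ZMod p)))
    (fun b => l A.τ * l b) (fun a b => ?_) (fun a b => ?_) (fun a => ?_)
    (a₀ := (1, 0)) (b₀ := (0, 1)) ?_
  · rw [hx, shear_apply, shear_apply]
    simp only [hε, hl, Prod.fst_add, hTadd]
    push_cast
    ring
  · rw [hy, shear_apply, shear_apply]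
    simp only [hε, hl, Prod.snd_add]
    push_cast
    ring
  · rw [hx, hy, hτ]
    simp only [shear_apply, hε, hl]
    push_cast
    ring
  · simp [hε, hl]

theorem nonempty_mulEquiv_omegaGrp_of_shear (hxy : IsZSqBasis K x y)
    (A : AddModel K x y (ℤ × ℤ)) (hx : A.σx = shear 1) (hy : A.σy = shear 0)
    (hτ : A.τ.1.natAbs = 1) : Nonempty (G ≃* OmegaGrp) := by
  obtain ⟨k, l, hkl⟩ : ∃ k l, A.τ = (k, l) := ⟨_, _, rfl⟩
  have hk : k * k = 1 := by
    rw [hkl] at hτ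
    rcases Int.natAbs_eq k with h | h <;> rw [h, hτ] <;> rfl
  have h1 : ⁅x, y⁆ = A.j (.ofAdd (k, l)) := by rw [← hkl, A.j_τ]
  have h2 : ⁅x, ⁅x, y⁆⁆ = A.j (.ofAdd (0, k)) := by
    rw [h1, ← A.j_σx_sub, hx, shear_apply]
    congr 2
    apply Prod.ext <;> simp
  have hpow : ∀ m n : ℤ, ⁅x, ⁅x, y⁆⁆ ^ m * ⁅x, y⁆ ^ n =
      A.j (.ofAdd (n * k, m * k + n * l)) := by
    intro m n
    rw [h2, h1]
    refine ((map_mul A.j _ _).trans (congrArg₂ _ (map_zpow A.j _ m) (map_zpow A.j _ n))).symm.trans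
      (congrArg A.j ?_)
    apply Multiplicative.toAdd.injective
    apply Prod.ext <;> simp
  refine NilGrp.nonempty_mulEquiv_omegaGrp hxy (fun g => ?_) (fun m n h => ?_) ?_ ?_
  · rw [A.mem_iff]
    constructor
    · rintro ⟨b, rfl⟩
      refine ⟨k * (b.2 - b.1 * k * l), b.1 * k, ?_⟩
      rw [hpow]
      congr 2
      apply Prod.ext
      · change b.1 = b.1 * k * k
        linear_combination (-b.1) * hk
      · change b.2 = k * (b.2 - b.1 * k * l) * k + b.1 * k * l
        linear_combination (-b.2 + b.1 * k * l) * hk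
    · rintro ⟨m, n, rfl⟩
      exact ⟨_, (hpow m n).symm⟩
  · rw [hpow, A.j_eq_one, Prod.mk_eq_zero] at h
    obtain ⟨h3, h4⟩ := h
    have hn : n = 0 := by linear_combination k * h3 - n * hk
    subst hn
    exact ⟨by linear_combination k * h4 - m * hk, rfl⟩
  · rw [h2, ← A.j_σx_sub, A.j_eq_one, hx, shear_apply]
    simp
  · rw [h1, ← A.j_σy_sub, A.j_eq_one, hy, shear_apply]
    simp

/-- The Bézout coefficients of the two shears give a basis of the quotient ℤ² in which one element
acts by the unit shear and the other trivially; then τ and its bracket with the first element form a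
basis of K. -/
theorem nonempty_mulEquiv_omegaGrp_of_finrank_eq_two {G : Type u} [Group G]
    [Group.IsNilpotent G] (hG : HomologicallyBalanced G) {K : Subgroup G} [K.Normal] {x y : G}
    (hxy : IsZSqBasis K x y) {B : Type*} [AddCommGroup B] (A : AddModel K x y B)
    [Module.Free ℤ B] [Module.Finite ℤ B] (h2 : Module.finrank ℤ B = 2) :
    Nonempty (G ≃* OmegaGrp) := by
  have h2' : Module.finrank ℤ (ℤ × ℤ) = Module.finrank ℤ B := by
    rw [Module.finrank_prod, Module.finrank_self, h2]
  obtain ⟨A₁, r, s, hr, hs⟩ :=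
    (A.congr (LinearEquiv.ofFinrankEq _ _ h2').toAddEquiv).exists_fixed_basis
  obtain ⟨i, j, hij⟩ := A₁.isCoprime_of_shear hG hxy hr hs
  have hxy' := hxy.change hij
  obtain ⟨τ, hτ⟩ := (A₁.mem_iff _).mp hxy'.commutator_mem
  have hx : ∀ b, A₁.j (.ofAdd (shear r b)) = x * A₁.j (.ofAdd b) * x⁻¹ := hr ▸ A₁.j_σx
  have hy : ∀ b, A₁.j (.ofAdd (shear s b)) = y * A₁.j (.ofAdd b) * y⁻¹ := hs ▸ A₁.j_σy
  let A₂ : AddModel K (y ^ j * x ^ i) (y ^ r * x ^ (-s)) (ℤ × ℤ) :=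
    A₁.change (shear 1) (shear 0) τ
      (fun b => by rw [← shearSubgroup_mul_zpow hx hy, ← hij, add_comm])
      (fun b => by rw [← shearSubgroup_mul_zpow hx hy]; congr 4; ring) hτ
  exact A₂.nonempty_mulEquiv_omegaGrp_of_shear hxy' rfl rfl
    (A₂.natAbs_fst_τ_eq_one hG hxy' rfl rfl)

end AddModel

end NilGrp


/-! ### Rank bound and trichotomy for an abelian kernel. -/

namespace NilGrp

open scoped commutatorElement

namespace AddModel

variable {G : Type*} [Group G] {K : Subgroup G} {x y : G} {B : Type*} [AddCommGroup B]

/-- The image in `B` of the commutator subgroup of `G`. -/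
def commutatorSubmodule (A : AddModel K x y B) : Submodule ℤ B :=
  Submodule.span ℤ {A.τ} ⊔ LinearMap.range (A.σx.toIntLinearMap - LinearMap.id) ⊔
    LinearMap.range (A.σy.toIntLinearMap - LinearMap.id)

theorem mem_commutatorSubmodule (A : AddModel K x y B) {b : B} : b ∈ A.commutatorSubmodule ↔
    ∃ (k : ℤ) (b₁ b₂ : B), b = k • A.τ + (A.σx b₁ - b₁) + (A.σy b₂ - b₂) := by
  simp only [commutatorSubmodule, Submodule.mem_sup, Submodule.mem_span_singleton,
    LinearMap.mem_range]
  constructor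
  · rintro ⟨_, ⟨_, ⟨k, rfl⟩, _, ⟨b₁, rfl⟩, rfl⟩, _, ⟨b₂, rfl⟩, rfl⟩
    exact ⟨k, b₁, b₂, rfl⟩
  · rintro ⟨k, b₁, b₂, rfl⟩
    exact ⟨_, ⟨_, ⟨k, rfl⟩, _, ⟨b₁, rfl⟩, rfl⟩, _, ⟨b₂, rfl⟩, rfl⟩

theorem τ_mem (A : AddModel K x y B) : A.τ ∈ A.commutatorSubmodule :=
  A.mem_commutatorSubmodule.mpr ⟨1, 0, 0, by simp⟩

theorem σx_sub_mem (A : AddModel K x y B) (b : B) : A.σx b - b ∈ A.commutatorSubmodule :=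
  A.mem_commutatorSubmodule.mpr ⟨0, b, 0, by simp⟩

theorem σy_sub_mem (A : AddModel K x y B) (b : B) : A.σy b - b ∈ A.commutatorSubmodule :=
  A.mem_commutatorSubmodule.mpr ⟨0, 0, b, by simp⟩

/-- The image of the submodule is normal, and modulo it x, y and K commute with one another, so the
quotient is abelian. -/
theorem commutator_le [K.Normal] (hxy : IsZSqBasis K x y) (A : AddModel K x y B) {g : G}
    (hg : g ∈ commutator G) : ∃ b ∈ A.commutatorSubmodule, A.j (.ofAdd b) = g := by
  let L : Subgroup G := A.commutatorSubmodule.toAddSubgroup.toSubgroup.map A.j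
  have hL : ∀ g, g ∈ L ↔ ∃ b ∈ A.commutatorSubmodule, A.j (.ofAdd b) = g := fun g =>
    ⟨fun ⟨b, hb, h⟩ => ⟨b.toAdd, hb, h⟩, fun ⟨b, hb, h⟩ => ⟨_, hb, h⟩⟩
  have hLK : ∀ b, A.j (.ofAdd b) ∈ L ↔ b ∈ A.commutatorSubmodule := fun b => by
    rw [hL]
    exact ⟨fun ⟨c, hc, h⟩ => by
      have : c = b := A.j_inj h
      exact this ▸ hc, fun hb => ⟨b, hb, rfl⟩⟩
  have hnormalizes : ∀ (z : G) (σ : B →+ B), (∀ b, A.j (.ofAdd (σ b)) = z * A.j (.ofAdd b) * z⁻¹) →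
      (∀ b, σ b - b ∈ A.commutatorSubmodule) → z ∈ Subgroup.normalizer (L : Set G) := by
    intro z σ hσ hmem
    have h1 : ∀ b, σ b ∈ A.commutatorSubmodule ↔ b ∈ A.commutatorSubmodule := by
      intro b
      have h2 : σ b = σ b - b + b := (sub_add_cancel _ _).symm
      rw [h2]
      exact Submodule.add_mem_iff_right _ (hmem b)
    rw [Subgroup.mem_normalizer_iff]
    intro h
    constructor
    · intro hh
      obtain ⟨b, hb, rfl⟩ := (hL h).mp hh
      exact (hL _).mpr ⟨σ b, (h1 b).mpr hb, hσ b⟩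
    · intro hh
      obtain ⟨b, hb, h3⟩ := (hL _).mp hh
      have hK : h ∈ K := by
        have h4 : z * h * z⁻¹ ∈ K := (A.mem_iff _).mpr ⟨b, h3⟩
        have h5 := (inferInstance : K.Normal).conj_mem _ h4 z⁻¹
        have h6 : z⁻¹ * (z * h * z⁻¹) * z⁻¹⁻¹ = h := by group
        rwa [h6] at h5
      obtain ⟨c, rfl⟩ := (A.mem_iff h).mp hK
      rw [← hσ, hLK, h1] at hh
      exact (hLK c).mpr hh
  have hx := hnormalizes x A.σx A.j_σx A.σx_sub_mem
  have hy := hnormalizes y A.σy A.j_σy A.σy_sub_mem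
  have hk : ∀ k ∈ K, k ∈ Subgroup.normalizer (L : Set G) := by
    intro k hk
    obtain ⟨c, rfl⟩ := (A.mem_iff k).mp hk
    refine hnormalizes _ (AddMonoidHom.id B) (fun b => ?_) (fun b => by simp)
    rw [A.j_comm, mul_inv_cancel_right]
    rfl
  have hLn : L.Normal := by
    rw [← Subgroup.normalizer_eq_top_iff, eq_top_iff]
    intro g _
    obtain ⟨k, hk', i, j, rfl⟩ := hxy.exists_eq g
    exact mul_mem (mul_mem (hk k hk') (zpow_mem hy j)) (zpow_mem hx i)
  have cxy : Commute (x : G ⧸ L) (y : G ⧸ L) := by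
    rw [← commutatorElement_eq_one_iff_commute]
    exact (QuotientGroup.eq_one_iff _).mpr ((hL _).mpr ⟨A.τ, A.τ_mem, A.j_τ⟩)
  have cxk : ∀ k ∈ K, Commute (x : G ⧸ L) (k : G ⧸ L) := by
    intro k hk
    obtain ⟨b, rfl⟩ := (A.mem_iff k).mp hk
    rw [← commutatorElement_eq_one_iff_commute]
    exact (QuotientGroup.eq_one_iff _).mpr ((hL _).mpr ⟨_, A.σx_sub_mem b, A.j_σx_sub b⟩)
  have cyk : ∀ k ∈ K, Commute (y : G ⧸ L) (k : G ⧸ L) := by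
    intro k hk
    obtain ⟨b, rfl⟩ := (A.mem_iff k).mp hk
    rw [← commutatorElement_eq_one_iff_commute]
    exact (QuotientGroup.eq_one_iff _).mpr ((hL _).mpr ⟨_, A.σy_sub_mem b, A.j_σy_sub b⟩)
  have ckk : ∀ k ∈ K, ∀ k' ∈ K, Commute (k : G ⧸ L) (k' : G ⧸ L) := by
    intro k hk k' hk'
    obtain ⟨b, rfl⟩ := (A.mem_iff k).mp hk
    obtain ⟨b', rfl⟩ := (A.mem_iff k').mp hk'
    exact congrArg QuotientGroup.mk (A.j_comm _ _)
  have hall : ∀ g : G ⧸ L, (∀ k ∈ K, Commute g (k : G ⧸ L)) → Commute g (x : G ⧸ L) →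
      Commute g (y : G ⧸ L) → ∀ h : G, Commute g (h : G ⧸ L) := by
    intro g h1 h2 h3 h
    obtain ⟨k, hk', i, j, rfl⟩ := hxy.exists_eq h
    exact ((h1 k hk').mul_right (h3.zpow_right j)).mul_right (h2.zpow_right i)
  have hab : ∀ g h : G, Commute (g : G ⧸ L) (h : G ⧸ L) := by
    intro g h
    refine (hall _ (fun k hk' => (hall _ (fun k' hk'' => ckk k hk' k' hk'')
      (cxk k hk').symm (cyk k hk').symm g).symm) ?_ ?_ h)
    · exact (hall _ cxk (Commute.refl _) cxy g).symm
    · exact (hall _ cyk cxy.symm (Commute.refl _) g).symm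
  refine (hL g).mp ?_
  have hle : commutator G ≤ L := by
    rw [commutator_def, Subgroup.commutator_le]
    intro g _ h _
    rw [← QuotientGroup.eq_one_iff]
    exact commutatorElement_eq_one_iff_commute.mpr (hab g h)
  exact hle hg

theorem exists_uniform_multiple [Module.Finite ℤ B] (S : Submodule ℤ B)
    (h : ∀ b : B, ∃ n : ℕ, n ≠ 0 ∧ n • b ∈ S) : ∃ n : ℕ, n ≠ 0 ∧ ∀ b : B, n • b ∈ S := by
  choose n hn hS using h
  obtain ⟨s, hs⟩ := Module.finite_def.mp ‹Module.Finite ℤ B›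
  refine ⟨∏ b ∈ s, n b, Finset.prod_ne_zero_iff.mpr fun b _ => hn b, fun b => ?_⟩
  have hle : Submodule.span ℤ (s : Set B) ≤
      S.comap (((∏ b ∈ s, n b : ℕ) : ℤ) • (LinearMap.id : B →ₗ[ℤ] B)) := by
    rw [Submodule.span_le]
    intro c hc
    obtain ⟨m, hm⟩ := Finset.dvd_prod_of_mem n hc
    change ((∏ b ∈ s, n b : ℕ) : ℤ) • c ∈ S
    rw [natCast_zsmul, hm, mul_comm, mul_smul]
    exact S.smul_of_tower_mem m (hS c)
  have := hle (hs ▸ Submodule.mem_top : b ∈ _)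
  rw [← natCast_zsmul]
  exact this

theorem finrank_le_two {G : Type u} [Group G] [Group.IsNilpotent G]
    (hG : HomologicallyBalanced G) {K : Subgroup G} [K.Normal] {x y : G}
    (hxy : IsZSqBasis K x y) (A : AddModel K x y B) [Module.Free ℤ B] [Module.Finite ℤ B]
    (htors : ∀ b : B, ∃ n : ℕ, n ≠ 0 ∧ n • b ∈ A.commutatorSubmodule) :
    Module.finrank ℤ B ≤ 2 := by
  obtain ⟨n, hn, hmem⟩ := exists_uniform_multiple _ htors
  -- A prime above n + 2 keeps both 2 and n invertible.
  obtain ⟨p, hle, hp⟩ := Nat.exists_infinite_primes (n + 3)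
  have : Fact p.Prime := ⟨hp⟩
  obtain ⟨hfin, hrank⟩ := finrank_dual (B := B) (ULift.{u} (ZMod p))
  rw [← hrank]
  have hne : ∀ m : ℕ, m ≠ 0 → m < p → (m : ULift.{u} (ZMod p)) ≠ 0 := by
    intro m hm hlt h
    have h1 : ((m : ℤ) : ULift.{u} (ZMod p)) = 0 := by exact_mod_cast h
    rw [uliftZMod_intCast_eq_zero, Int.natCast_dvd_natCast] at h1
    exact absurd (Nat.le_of_dvd (Nat.pos_of_ne_zero hm) h1) (by omega)
  exact A.finrank_dual_le_two hG hxy (uliftZMod_eq_natCast p)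
    (by exact_mod_cast hne 2 (by omega) (by omega)) (hne n hn (by omega))
    (fun b => A.mem_commutatorSubmodule.mp (hmem b))

/-- A fixed nonzero element of ℤ makes both conjugations trivial, so K is central. The commutator is
then a q-th power of a generator up to sign, with q ≠ 0 because K is torsion modulo commutators. -/
theorem nonempty_mulEquiv_gammaGrp_of_finrank_eq_one [Group.IsNilpotent G]
    (hxy : IsZSqBasis K x y) (A : AddModel K x y B) [Module.Free ℤ B] [Module.Finite ℤ B]
    (htors : ∀ b : B, ∃ n : ℕ, n ≠ 0 ∧ n • b ∈ A.commutatorSubmodule)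
    (h1 : Module.finrank ℤ B = 1) : ∃ q : ℕ, 1 ≤ q ∧ Nonempty (G ≃* GammaGrp q) := by
  let e : ℤ ≃+ B := (LinearEquiv.ofFinrankEq ℤ B (by rw [Module.finrank_self, h1])).toAddEquiv
  obtain ⟨b, -, hb, hbx, hby⟩ := A.exists_socle (E := fun b => b = 0) (P := fun _ => True) rfl
    (fun _ _ => trivial) (fun _ _ => trivial) (b₀ := e 1) trivial (by simp)
  have hmul : ∀ n : ℤ, e n = n • e 1 := fun n => by
    rw [← map_zsmul]; simp
  have hfix : ∀ σ : B →+ B, σ b - b = 0 → ∀ c, σ c = c := by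
    intro σ hσ c
    obtain ⟨n, rfl⟩ := e.surjective b
    obtain ⟨m, rfl⟩ := e.surjective c
    have hn : n ≠ 0 := fun h => hb (by rw [h, map_zero])
    rw [hmul n, map_zsmul, ← smul_sub] at hσ
    have h2 := (smul_eq_zero.mp hσ).resolve_left hn
    rw [hmul m, map_zsmul, sub_eq_zero.mp h2]
  have hx := hfix _ hbx
  have hy := hfix _ hby
  obtain ⟨q, hq⟩ := e.surjective A.τ
  have hq0 : q ≠ 0 := by
    rintro rfl
    obtain ⟨n, hn, hmem⟩ := htors (e 1)
    obtain ⟨k, b₁, b₂, h2⟩ := A.mem_commutatorSubmodule.mp hmem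
    rw [hx, hy, sub_self, sub_self, ← hq, map_zero, smul_zero, add_zero, add_zero] at h2
    have h3 : e (n : ℤ) = 0 := by rw [hmul, natCast_zsmul, h2]
    rw [EmbeddingLike.map_eq_zero_iff] at h3
    exact hn (by exact_mod_cast h3)
  have hsign : q.sign * q.sign = 1 := by
    rw [← Int.sign_mul, Int.sign_eq_one_of_pos (mul_self_pos.mpr hq0)]
  let z : G := A.j (.ofAdd (e q.sign))
  have hz : ∀ n : ℤ, z ^ n = A.j (.ofAdd (e (n * q.sign))) := by
    intro n
    rw [← smul_eq_mul, map_zsmul]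
    exact (map_zpow A.j _ n).symm
  refine ⟨q.natAbs, Int.natAbs_pos.mpr hq0, nonempty_mulEquiv_gammaGrp hxy q.natAbs (z := z)
    (fun k => ?_) (fun n hn => ?_) ?_ ?_ ?_⟩
  · rw [A.mem_iff]
    constructor
    · rintro ⟨c, rfl⟩
      obtain ⟨m, rfl⟩ := e.surjective c
      refine ⟨m * q.sign, ?_⟩
      rw [hz, mul_assoc, hsign, mul_one]
    · rintro ⟨n, rfl⟩
      exact ⟨_, (hz n).symm⟩
  · rw [hz, A.j_eq_one, EmbeddingLike.map_eq_zero_iff] at hn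
    exact (mul_eq_zero.mp hn).resolve_right fun h => hq0 (Int.sign_eq_zero_iff_zero.mp h)
  · rw [← commutatorElement_eq_one_iff_commute, ← A.j_σx_sub, A.j_eq_one, hx, sub_self]
  · rw [← commutatorElement_eq_one_iff_commute, ← A.j_σy_sub, A.j_eq_one, hy, sub_self]
  · rw [← A.j_τ, ← hq, ← zpow_natCast, hz, mul_comm, Int.sign_mul_natAbs]

/-- The classification when the kernel is free abelian. -/
theorem trichotomy {G : Type u} [Group G] [Group.IsNilpotent G]
    (hG : HomologicallyBalanced G) {K : Subgroup G} [K.Normal] {x y : G}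
    (hxy : IsZSqBasis K x y) (A : AddModel K x y B) [Module.Free ℤ B] [Module.Finite ℤ B]
    (htors : ∀ k ∈ K, ∃ n : ℕ, n ≠ 0 ∧ k ^ n ∈ commutator G) :
    (Module.finrank ℤ B = 0 ∧ Nonempty (G ≃* ZSq)) ∨
    (Module.finrank ℤ B = 1 ∧ ∃ q : ℕ, 1 ≤ q ∧ Nonempty (G ≃* GammaGrp q)) ∨
    (Module.finrank ℤ B = 2 ∧ Nonempty (G ≃* OmegaGrp)) := by
  have htors' : ∀ b : B, ∃ n : ℕ, n ≠ 0 ∧ n • b ∈ A.commutatorSubmodule := by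
    intro b
    obtain ⟨n, hn, h⟩ := htors _ ((A.mem_iff _).mpr ⟨b, rfl⟩)
    obtain ⟨c, hc, h2⟩ := A.commutator_le hxy h
    refine ⟨n, hn, ?_⟩
    have h3 : c = n • b := A.j_inj (h2.trans (map_pow A.j _ n).symm)
    exact h3 ▸ hc
  have hle := A.finrank_le_two hG hxy htors'
  rcases hm : Module.finrank ℤ B with _ | _ | _ | m
  · refine Or.inl ⟨rfl, ?_⟩
    have hsub : Subsingleton B := Module.finrank_zero_iff.mp hm
    have hK : K = ⊥ := by
      rw [eq_bot_iff]
      intro k hk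
      obtain ⟨b, rfl⟩ := (A.mem_iff k).mp hk
      rw [Subsingleton.elim b 0]
      exact map_one A.j
    rw [hK] at hxy
    exact nonempty_mulEquiv_zSq hxy
  · exact Or.inr (Or.inl ⟨rfl, A.nonempty_mulEquiv_gammaGrp_of_finrank_eq_one hxy htors' hm⟩)
  · exact Or.inr (Or.inr ⟨rfl, A.nonempty_mulEquiv_omegaGrp_of_finrank_eq_two hG hxy hm⟩)
  · omega

end AddModel

end NilGrp


/-! ### From the first rational Betti number to a surjection onto ℤ². -/

namespace NilGrp

open scoped commutatorElement

section

open groupHomology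

/-- The reverse of `rank_H1_le`: homomorphisms kill boundaries and are detected on single group
elements, which are cycles for trivial coefficients. -/
theorem finrank_hom_le_H1 (F G : Type u) [Field F] [Group G]
    [Module.Finite F (groupHomology (Rep.trivial F G F) 1)] :
    Module.finrank F (Additive G →+ F) ≤
      Module.finrank F (groupHomology (Rep.trivial F G F) 1) := by
  let A := Rep.trivial F G F
  let L : (Additive G →+ F) →ₗ[F] (G →₀ F) →ₗ[F] F :=
    { toFun := fun φ => Finsupp.lsum F fun g => φ (Additive.ofMul g) • LinearMap.id
      map_add' := fun φ ψ => by ext g; simp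
      map_smul' := fun a φ => by ext g; simp }
  have hL : ∀ φ g a, L φ (Finsupp.single g a) = φ (Additive.ofMul g) * a := by
    intro φ g a
    simp [L]
  have hLb : ∀ φ, ∀ z ∈ boundaries₁ A, L φ z = 0 := by
    rintro φ _ ⟨z, rfl⟩
    have : (L φ) ∘ₗ (d₂₁ A).hom = 0 := by
      apply Finsupp.lhom_ext
      rintro ⟨g, h⟩ a
      have h3 := d₂₁_single (A := A) (g, h) a
      simp only [LinearMap.comp_apply]
      erw [h3]
      simp only [map_add, map_sub]
      erw [hL, hL, hL]
      have h4 : A.ρ g⁻¹ a = a := rfl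
      simp only [h4, LinearMap.zero_apply, ofMul_mul, map_add]
      ring
    exact LinearMap.congr_fun this z
  have hsurj : Function.Surjective (H1π A).hom := by
    intro z
    induction z using H1_induction_on with
    | h x => exact ⟨x, rfl⟩
  obtain ⟨σ, hσ⟩ := (H1π A).hom.exists_rightInverse_of_surjective (LinearMap.range_eq_top.mpr hsurj)
  let Ψ : (Additive G →+ F) →ₗ[F] Module.Dual F (H1 A) :=
    (LinearMap.lcomp F F ((cycles₁ A).subtype ∘ₗ σ)) ∘ₗ L
  have hΨ : Function.Injective Ψ := by
    rw [injective_iff_map_eq_zero]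
    intro φ hφ
    refine AddMonoidHom.ext fun g => ?_
    have hz : Finsupp.single g.toMul (1 : F) ∈ cycles₁ A := by
      rw [cycles₁_eq_top_of_isTrivial]; trivial
    have h1 : (H1π A).hom (⟨_, hz⟩ - σ ((H1π A).hom ⟨_, hz⟩)) = 0 := by
      rw [map_sub, sub_eq_zero]
      exact (LinearMap.congr_fun hσ ((H1π A).hom ⟨_, hz⟩)).symm
    have h2 := hLb φ _ ((H1π_eq_zero_iff _).mp h1)
    have h3 : L φ (σ ((H1π A).hom ⟨_, hz⟩)).1 = 0 :=
      LinearMap.congr_fun hφ ((H1π A).hom ⟨_, hz⟩)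
    have h4 := map_sub (L φ) (Finsupp.single g.toMul (1 : F)) (σ ((H1π A).hom ⟨_, hz⟩)).1
    rw [h3, sub_zero] at h4
    have h5 := h4.symm.trans h2
    rw [hL, mul_one] at h5
    exact h5
  have h := LinearMap.finrank_le_finrank_of_injective hΨ
  rwa [Subspace.dual_finrank_eq] at h

end

theorem finrank_hom_eq_two {F G : Type u} [Field F] [Group G] [Group.FG G]
    (h : bettiNumber F G 1 = 2) : Module.finrank F (Additive G →+ F) = 2 := by
  have := finiteDimensional_hom F G
  have h1 := rank_H1_le F G
  rw [h] at h1
  have hfin : Module.Finite F (groupHomology (Rep.trivial F G F) 1) := by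
    refine Module.rank_lt_aleph0_iff.mp ?_
    change bettiNumber F G 1 < _
    rw [h]
    exact_mod_cast Cardinal.natCast_lt_aleph0 (n := 2)
  have h2 := finrank_hom_le_H1 F G
  rw [bettiNumber, ← Module.finrank_eq_rank] at h
  have h3 : Module.finrank F (groupHomology (Rep.trivial F G F) 1) = 2 := by exact_mod_cast h
  have h4 : 2 ≤ Module.finrank F (Additive G →+ F) := by exact_mod_cast h1
  omega

/-- A finitely generated group with first rational Betti number two has a free abelian quotient of
rank two whose kernel is torsion modulo the commutator subgroup. -/
theorem exists_hom_zSq {G : Type u} [Group G] [Group.FG G]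
    (h : bettiNumber (ULift.{u} ℚ) G 1 = 2) :
    Module.rank ℤ (Additive (Abelianization G)) = 2 ∧
      ∃ f : G →* ZSq, Function.Surjective f ∧
        ∀ g, f g = 1 → ∃ n : ℕ, n ≠ 0 ∧ g ^ n ∈ commutator G := by
  let F := ULift.{u} ℚ
  let M := Additive (Abelianization G)
  let N := M ⧸ Submodule.torsion ℤ M
  have hF : CharZero F := ⟨fun m n h => by
    have h' : (m : ℚ) = n := congrArg ULift.down h
    exact_mod_cast h'⟩
  have hM : Module.Finite ℤ M := by
    have : Group.FG (Abelianization G) := QuotientGroup.fg _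
    rw [Module.Finite.iff_addGroup_fg]
    exact GroupFG.iff_add_fg.mp this
  have hNfree : Module.Free ℤ N := inferInstance
  obtain ⟨hfin, hrank⟩ := AddModel.finrank_dual (B := N) F
  let q : G → N := fun g => Submodule.Quotient.mk (abMk g)
  have hqmul : ∀ g g', q (g * g') = q g + q g' := fun _ _ => rfl
  have hqsurj : Function.Surjective q :=
    (Submodule.Quotient.mk_surjective _).comp abMk_surjective
  have hq0 : ∀ g, q g = 0 ↔ ∃ n : ℕ, n ≠ 0 ∧ g ^ n ∈ commutator G := by
    intro g
    have hpow : ∀ n : ℕ, abMk (g ^ n) = n • abMk g := fun n => rfl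
    rw [Submodule.Quotient.mk_eq_zero, Submodule.mem_torsion_iff]
    constructor
    · rintro ⟨⟨a, ha⟩, h1⟩
      have h1 : a • abMk g = 0 := h1
      refine ⟨a.natAbs, Int.natAbs_ne_zero.mpr (nonZeroDivisors.ne_zero ha), ?_⟩
      rw [← abMk_eq_zero, hpow, ← natCast_zsmul]
      rcases Int.natAbs_eq a with h2 | h2
      · rwa [← h2]
      · rw [← neg_eq_zero, ← neg_smul, ← h2, h1]
    · rintro ⟨n, hn, h1⟩
      refine ⟨⟨n, mem_nonZeroDivisors_of_ne_zero (Int.natCast_ne_zero.mpr hn)⟩, ?_⟩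
      rw [← abMk_eq_zero, hpow, ← natCast_zsmul] at h1
      exact h1
  -- In characteristic zero homomorphisms to F ignore torsion, so Θ is an isomorphism and computes
  -- the rank of N.
  let Θ : (N →ₗ[ℤ] F) →ₗ[F] (Additive G →+ F) :=
    { toFun := fun φ => AddMonoidHom.mk' (fun g => φ (q g.toMul)) fun g g' => by
        rw [toMul_add, hqmul, map_add]
      map_add' := fun _ _ => rfl
      map_smul' := fun _ _ => rfl }
  have hΘinj : Function.Injective Θ := by
    rw [injective_iff_map_eq_zero]
    intro φ hφ
    refine LinearMap.ext fun b => ?_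
    obtain ⟨g, rfl⟩ := hqsurj b
    exact DFunLike.congr_fun hφ (Additive.ofMul g)
  have hΘsurj : Function.Surjective Θ := by
    intro ψ
    have hψ : ∀ g g', q g = q g' → ψ (Additive.ofMul g) = ψ (Additive.ofMul g') := by
      intro g g' hgg
      have h1 : q (g * g'⁻¹) = 0 := by
        have h2 : q (g * g'⁻¹ * g') = q (g * g'⁻¹) + q g' := hqmul _ _
        rw [inv_mul_cancel_right, hgg] at h2
        exact right_eq_add.mp h2
      obtain ⟨n, hn, h2⟩ := (hq0 _).mp h1
      have h3 : ∀ c ∈ commutator G, ψ (Additive.ofMul c) = 0 := by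
        intro c hc
        have h4 : commutator G ≤ (AddMonoidHom.toMultiplicativeRight ψ).ker :=
          Abelianization.commutator_subset_ker _
        exact h4 hc
      have h4 := h3 _ h2
      rw [ofMul_pow, map_nsmul, nsmul_eq_mul] at h4
      have h5 := (mul_eq_zero.mp h4).resolve_left (Nat.cast_ne_zero.mpr hn)
      rw [ofMul_mul, map_add, ofMul_inv, map_neg] at h5
      exact add_neg_eq_zero.mp h5
    choose s hs using hqsurj
    refine ⟨(AddMonoidHom.mk' (fun b => ψ (Additive.ofMul (s b))) fun b b' => ?_).toIntLinearMap,
      AddMonoidHom.ext fun g => hψ _ _ (hs _)⟩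
    rw [← map_add, ← ofMul_mul]
    exact hψ _ _ (by rw [hs, hqmul, hs, hs])
  have h2 : Module.finrank ℤ N = 2 := by
    rw [← hrank, (LinearEquiv.ofBijective Θ ⟨hΘinj, hΘsurj⟩).finrank_eq, finrank_hom_eq_two h]
  constructor
  · rw [← rank_quotient_eq_of_le_torsion (le_refl (Submodule.torsion ℤ M)),
      ← Module.finrank_eq_rank, h2]
    rfl
  · let e : N ≃ₗ[ℤ] ℤ × ℤ := LinearEquiv.ofFinrankEq _ _
      (by rw [h2, Module.finrank_prod, Module.finrank_self])
    refine ⟨MonoidHom.mk' (fun g => .ofAdd (e (q g))) fun g g' => ?_, fun z => ?_, fun g hg => ?_⟩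
    · rw [hqmul, map_add, ofAdd_add]
    · obtain ⟨g, hg⟩ := hqsurj (e.symm z.toAdd)
      refine ⟨g, ?_⟩
      change Multiplicative.ofAdd (e (q g)) = z
      rw [hg, e.apply_symm_apply]
      rfl
    · exact (hq0 g).mp (e.map_eq_zero_iff.mp hg)

/-- All surjections to `ℤ²` have the same kernel. -/
theorem mem_ker_iff_of_surjective {G : Type*} [Group G] {f f' : G →* ZSq}
    (hf : Function.Surjective f) (hf' : Function.Surjective f')
    (htors : ∀ g, f g = 1 → ∃ n : ℕ, n ≠ 0 ∧ g ^ n ∈ commutator G) (g : G) :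
    f' g = 1 ↔ f g = 1 := by
  have h1 : ∀ g, f g = 1 → f' g = 1 := by
    intro g hg
    obtain ⟨n, hn, h2⟩ := htors g hg
    have h3 : f' (g ^ n) = 1 := Abelianization.commutator_subset_ker f' h2
    rw [map_pow] at h3
    have h4 : n • (f' g).toAdd = 0 := h3
    exact (smul_eq_zero.mp h4).resolve_left hn
  refine ⟨fun hg => ?_, h1 g⟩
  -- The second map factors through the first by a surjective endomorphism of ℤ², which is
  -- injective.
  let e : ZSq →* ZSq := f.liftOfSurjective hf ⟨f', h1⟩
  have he : ∀ g, e (f g) = f' g := fun g => MonoidHom.liftOfRightInverse_comp_apply _ _ _ _ g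
  let e' : ℤ × ℤ →ₗ[ℤ] ℤ × ℤ := (MonoidHom.toAdditive e).toIntLinearMap
  have hsurj : Function.Surjective e' := by
    intro z
    obtain ⟨g, hg⟩ := hf' (.ofAdd z)
    exact ⟨(f g).toAdd, (he g).trans hg⟩
  have hinj := OrzechProperty.injective_of_surjective_endomorphism e' hsurj
  rw [← he] at hg
  exact hinj (hg.trans (map_zero e').symm)

theorem isZSqBasis_ker {G : Type*} [Group G] {f : G →* ZSq} {x y : G}
    (hx : f x = .ofAdd (1, 0)) (hy : f y = .ofAdd (0, 1)) : IsZSqBasis f.ker x y := by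
  have hval : ∀ i j : ℤ, f (y ^ j * x ^ i) = .ofAdd (i, j) := by
    intro i j
    rw [map_mul, map_zpow, map_zpow, hx, hy, ← ofAdd_zsmul, ← ofAdd_zsmul, ← ofAdd_add]
    simp
  refine ⟨?_, fun g => ?_, fun i j h => ?_⟩
  · rw [MonoidHom.mem_ker, map_commutatorElement, commutatorElement_eq_one_iff_mul_comm, mul_comm]
  · refine ⟨g * (y ^ (f g).toAdd.2 * x ^ (f g).toAdd.1)⁻¹, ?_, (f g).toAdd.1, (f g).toAdd.2,
      by group⟩
    rw [MonoidHom.mem_ker, map_mul, map_inv, hval, mul_inv_eq_one]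
    rfl
  · rw [MonoidHom.mem_ker, hval] at h
    exact Prod.mk_eq_zero.mp h

end NilGrp


/-! ### Commutativity of the kernel and the Hirsch length. -/

namespace NilGrp

open scoped commutatorElement

/-- Induction along central quotients: modulo its centre K is commutative by induction, hence equal
to its cyclic abelianization, and a group that is cyclic modulo its centre is commutative. -/
theorem comm_of_isCyclic_abelianization (K : Type*) [Group K]
    [Group.IsNilpotent K] (h : IsCyclic (Abelianization K)) (a b : K) : a * b = b * a := by
  revert h a b
  apply @Group.nilpotent_center_quotient_ind
    (fun K _ _ => IsCyclic (Abelianization K) → ∀ a b : K, a * b = b * a) K _ _ <;> clear! K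
  · intro K _ _ _ a b
    exact Subsingleton.elim _ _
  · intro K _ _ ih h
    let Q := K ⧸ Subgroup.center K
    have hQ : IsCyclic (Abelianization Q) :=
      isCyclic_of_surjective (Abelianization.map (QuotientGroup.mk' (Subgroup.center K))) <| by
        intro z
        obtain ⟨w, rfl⟩ := QuotientGroup.mk_surjective z
        obtain ⟨k, rfl⟩ := QuotientGroup.mk_surjective w
        exact ⟨Abelianization.of k, rfl⟩
    have hcomm := ih hQ
    have hinj : Function.Injective (Abelianization.of : Q →* Abelianization Q) := by
      rw [← MonoidHom.ker_eq_bot_iff, Abelianization.ker_of, commutator_def,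
        Subgroup.commutator_eq_bot_iff_le_centralizer]
      intro a _ b _
      exact hcomm b a
    have hQ' : IsCyclic Q := isCyclic_of_injective Abelianization.of hinj
    exact ((QuotientGroup.mk' (Subgroup.center K)).isMulCommutative_of_isCyclic_of_ker_le_center
      (by rw [QuotientGroup.ker_mk'])).is_comm.comm

theorem commutator_eq_bot_of_comm {K : Type*} [Group K] (h : ∀ a b : K, a * b = b * a) :
    commutator K = ⊥ := by
  rw [commutator_def, Subgroup.commutator_eq_bot_iff_le_centralizer]
  intro a _ b _
  exact h b a

/-- The identification of a commutative normal subgroup with its abelianization. -/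
noncomputable def abModel {G : Type*} [Group G] {K : Subgroup G} [K.Normal] {x y : G}
    (hxy : IsZSqBasis K x y) (hK : ∀ a b : K, a * b = b * a) :
    AddModel K x y (Additive (Abelianization K)) :=
  let e : K ≃* Abelianization K := MulEquiv.ofBijective Abelianization.of
    ⟨by rw [← MonoidHom.ker_eq_bot_iff, Abelianization.ker_of, commutator_eq_bot_of_comm hK],
      QuotientGroup.mk_surjective⟩
  have he : ∀ k : K, e.symm (abMk k).toMul = k := e.symm_apply_apply
  { j :=
      { toFun := fun b => (e.symm b.toAdd.toMul : G)
        map_one' := congrArg Subtype.val (map_one e.symm)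
        map_mul' := fun a b => congrArg Subtype.val (map_mul e.symm a.toAdd.toMul b.toAdd.toMul) }
    σx := abConj K x
    σy := abConj K y
    τ := abMk ⟨⁅x, y⁆, hxy.commutator_mem⟩
    j_inj := Subtype.val_injective.comp e.symm.injective
    range_j := by
      ext k
      constructor
      · rintro ⟨b, rfl⟩
        exact (e.symm b.toAdd.toMul).2
      · intro hk
        exact ⟨.ofAdd (abMk ⟨k, hk⟩), congrArg Subtype.val (he ⟨k, hk⟩)⟩
    j_σx := fun b => by
      obtain ⟨k, rfl⟩ := abMk_surjective b
      change (e.symm (abConj K x (abMk k)).toMul : G) = x * e.symm (abMk k).toMul * x⁻¹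
      rw [abConj_abMk, he, he]
      rfl
    j_σy := fun b => by
      obtain ⟨k, rfl⟩ := abMk_surjective b
      change (e.symm (abConj K y (abMk k)).toMul : G) = y * e.symm (abMk k).toMul * y⁻¹
      rw [abConj_abMk, he, he]
      rfl
    j_τ := congrArg Subtype.val (he ⟨⁅x, y⁆, hxy.commutator_mem⟩) }

section HirschLength

variable {G : Type u} [Group G]

theorem rank_abelianization_le_of_torsion {H K : Subgroup G} (hle : H ≤ K)
    (htors : ∀ k ∈ K, ∃ n : ℕ, n ≠ 0 ∧ k ^ n ∈ H) :
    Module.rank ℤ (Additive (Abelianization K)) ≤ Module.rank ℤ (Additive (Abelianization H)) := by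
  let f : Additive (Abelianization H) →ₗ[ℤ] Additive (Abelianization K) :=
    (MonoidHom.toAdditive (Abelianization.map (Subgroup.inclusion hle))).toIntLinearMap
  have h1 := rank_quotient_add_rank_of_isDomain (LinearMap.range f)
  have h2 : Module.rank ℤ (Additive (Abelianization K) ⧸ LinearMap.range f) = 0 := by
    rw [rank_eq_zero_iff]
    intro z
    obtain ⟨b, rfl⟩ := Submodule.Quotient.mk_surjective _ z
    obtain ⟨k, rfl⟩ := abMk_surjective b
    obtain ⟨n, hn, hk⟩ := htors k k.2
    refine ⟨n, Int.natCast_ne_zero.mpr hn, ?_⟩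
    rw [← Submodule.Quotient.mk_smul, Submodule.Quotient.mk_eq_zero, natCast_zsmul]
    exact ⟨abMk ⟨_, hk⟩, rfl⟩
  rw [← h1, h2, zero_add]
  simpa using! lift_rank_range_le f

theorem rank_abelianization_le_of_comm {H K : Subgroup G} (hle : H ≤ K)
    (hK : ∀ a b : K, a * b = b * a) :
    Module.rank ℤ (Additive (Abelianization H)) ≤ Module.rank ℤ (Additive (Abelianization K)) := by
  let f : Additive (Abelianization H) →ₗ[ℤ] Additive (Abelianization K) :=
    (MonoidHom.toAdditive (Abelianization.map (Subgroup.inclusion hle))).toIntLinearMap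
  refine LinearMap.rank_le_of_injective f ?_
  rw [injective_iff_map_eq_zero]
  intro b hb
  obtain ⟨h, rfl⟩ := abMk_surjective b
  have h1 : abMk (Subgroup.inclusion hle h) = 0 := hb
  rw [abMk_eq_zero, commutator_eq_bot_of_comm hK, Subgroup.mem_bot] at h1
  have h2 : h = 1 := Subgroup.inclusion_injective hle (h1.trans (map_one _).symm)
  rw [h2, abMk_one]

/-- The Hirsch length without the contribution of the abelianization. -/
noncomputable def hirschTail (G : Type u) [Group G] : Cardinal.{u} :=
  Cardinal.sum fun i : ℕ => Module.rank ℤ (Additive (Abelianization (derivedSeries G (i + 1))))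

theorem hirschLength_eq (h : Module.rank ℤ (Additive (Abelianization G)) = 2) :
    hirschLength G = 2 + hirschTail G := by
  rw [hirschLength, Cardinal.sum_nat_eq_add_sum_succ, ← h]
  congr 1
  exact (MulEquiv.toAdditive
    (Subgroup.topEquiv (G := G)).abelianizationCongr).toIntLinearEquiv.rank_eq

/-- The abelianization of the commutator subgroup is the first summand of the tail, and its image
has torsion cokernel in that of K. -/
theorem le_hirschTail {K : Subgroup G} (hle : commutator G ≤ K)
    (htors : ∀ k ∈ K, ∃ n : ℕ, n ≠ 0 ∧ k ^ n ∈ commutator G) :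
    Module.rank ℤ (Additive (Abelianization K)) ≤ hirschTail G :=
  (rank_abelianization_le_of_torsion (H := derivedSeries G 1) hle htors).trans
    (Cardinal.le_sum (fun i : ℕ => Module.rank ℤ
      (Additive (Abelianization (derivedSeries G (i + 1))))) 0)

/-- The commutator subgroup is commutative, so the derived series stops at step two and only one
summand remains. -/
theorem hirschTail_le {K : Subgroup G} (hle : commutator G ≤ K)
    (hK : ∀ a b : K, a * b = b * a) :
    hirschTail G ≤ Module.rank ℤ (Additive (Abelianization K)) := by
  have hbot : ∀ i, derivedSeries G (i + 2) = ⊥ := by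
    intro i
    have h2 : derivedSeries G 2 = ⊥ := by
      rw [derivedSeries_succ, Subgroup.commutator_eq_bot_iff_le_centralizer]
      intro a ha b hb
      exact congrArg Subtype.val (hK ⟨b, hle hb⟩ ⟨a, hle ha⟩)
    exact eq_bot_iff.mpr ((derivedSeries_antitone G (by omega)).trans h2.le)
  have hzero : ∀ i : ℕ,
      Module.rank ℤ (Additive (Abelianization (derivedSeries G (i + 1 + 1)))) = 0 := by
    intro i
    have hs : Subsingleton (derivedSeries G (i + 1 + 1)) := by
      rw [hbot i]; infer_instance
    have : Subsingleton (Additive (Abelianization (derivedSeries G (i + 1 + 1)))) :=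
      abMk_surjective.subsingleton
    exact rank_subsingleton' ..
  rw [hirschTail, Cardinal.sum_nat_eq_add_sum_succ]
  simp only [hzero]
  rw [Cardinal.sum_const, Cardinal.lift_zero, mul_zero, add_zero]
  exact rank_abelianization_le_of_comm (H := derivedSeries G 1) hle hK

end HirschLength

theorem comm_of_finrank_le_one {G : Type*} [Group G] [Group.IsNilpotent G] {K : Subgroup G}
    [Module.Free ℤ (Additive (Abelianization K))] [Module.Finite ℤ (Additive (Abelianization K))]
    (h : Module.finrank ℤ (Additive (Abelianization K)) ≤ 1) (a b : K) : a * b = b * a := by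
  obtain ⟨v, hv⟩ := finrank_le_one_iff.mp h
  exact comm_of_isCyclic_abelianization K
    ⟨v.toMul, fun w => (hv (Additive.ofMul w)).imp fun _ h => h⟩ a b

/-- If a nilpotent group `K` with torsion-free abelianization is generated by elements of finite
order and a commutative normal subgroup, then `K` is commutative. -/
theorem comm_of_eq_sup_torsionSubgroup {G : Type u} [Group G] [Group.IsNilpotent G]
    {A K : Subgroup G} [A.Normal] (hA : ∀ x ∈ A, ∀ y ∈ A, x * y = y * x)
    (hK : K = A ⊔ torsionSubgroup G)
    (htf : ∀ n : ℕ, n ≠ 0 → ∀ b : Additive (Abelianization K), n • b = 0 → b = 0) :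
    ∀ a b : K, a * b = b * a := by
  have hAK : A ≤ K := hK ▸ le_sup_left
  have hTK : torsionSubgroup G ≤ K := hK ▸ le_sup_right
  let q := QuotientGroup.mk' (A.subgroupOf K)
  have hT : torsionSubgroup G ≤ (commutator K).map K.subtype := by
    rw [torsionSubgroup, Subgroup.closure_le]
    intro t ht
    have htK : t ∈ K := hTK (Subgroup.subset_closure ht)
    obtain ⟨n, hn, h1⟩ := ht.exists_pow_eq_one
    refine ⟨⟨t, htK⟩, ?_, rfl⟩
    rw [SetLike.mem_coe, ← abMk_eq_zero]
    refine htf n hn.ne' _ ?_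
    have h2 : (⟨t, htK⟩ : K) ^ n = 1 := Subtype.ext h1
    change abMk ((⟨t, htK⟩ : K) ^ n) = 0
    rw [h2, abMk_one]
  -- Elements of finite order lie in [K, K], so modulo A every element is a product of commutators;
  -- a nilpotent perfect group is trivial.
  have hperf : commutator (K ⧸ A.subgroupOf K) = ⊤ := by
    rw [eq_top_iff]
    intro z _
    obtain ⟨k, rfl⟩ := QuotientGroup.mk_surjective z
    obtain ⟨a, ha, t, ht, hat⟩ := Subgroup.mem_sup_of_normal_left.mp (hK.le k.2)
    obtain ⟨c, hc, hct⟩ := hT ht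
    have hk : k = ⟨a, hAK ha⟩ * c := Subtype.ext (by rw [← hat, ← hct]; rfl)
    have h1 : (QuotientGroup.mk k : K ⧸ A.subgroupOf K) = q c := by
      rw [hk, QuotientGroup.mk_mul]
      have : (QuotientGroup.mk (⟨a, hAK ha⟩ : K) : K ⧸ A.subgroupOf K) = 1 :=
        (QuotientGroup.eq_one_iff _).mpr ha
      rw [this, one_mul]
      rfl
    rw [h1]
    have h2 : (commutator K).map q ≤ commutator (K ⧸ A.subgroupOf K) := by
      rw [commutator_def, Subgroup.map_commutator, commutator_def]
      exact Subgroup.commutator_mono le_top le_top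
    exact h2 ⟨c, hc, rfl⟩
  have hsub : Subsingleton (K ⧸ A.subgroupOf K) := by
    by_contra h
    rw [not_subsingleton_iff_nontrivial] at h
    exact (Group.IsSolvable.commutator_lt_top_of_nontrivial (K ⧸ A.subgroupOf K)).ne hperf
  have hmem : ∀ k : K, (k : G) ∈ A := fun k =>
    (QuotientGroup.eq_one_iff k).mp (Subsingleton.elim (QuotientGroup.mk k : K ⧸ A.subgroupOf K) 1)
  exact fun a b => Subtype.ext (hA a (hmem a) b (hmem b))

end NilGrp

/-! ### The theorem and its corollary. -/

theorem theoremB15 {G : Type u} [Group G] [Group.IsNilpotent G]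
    (hbal : NilGrp.HomologicallyBalanced G)
    (hβ : NilGrp.bettiNumber (ULift.{u} ℚ) G 1 = 2) :
    (NilGrp.hirschLength G = 2 →
      (∀ x ∈ NilGrp.torsionSubgroup G, ∀ y ∈ NilGrp.torsionSubgroup G, x * y = y * x) →
      Nonempty (G ≃* NilGrp.ZSq)) ∧
    (NilGrp.hirschLength G = 3 →
      (∃ (f : G →* NilGrp.ZSq)
        (g : NilGrp.ZSq →* NilGrp.OuterAut (NilGrp.torsionSubgroup G)),
        NilGrp.outerAction (NilGrp.torsionSubgroup G) = g.comp f) →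
      ∃ q : ℕ, 1 ≤ q ∧ Nonempty (G ≃* NilGrp.GammaGrp q)) ∧
    (NilGrp.hirschLength G = 4 →
      (∃ (A : Subgroup G) (_ : A.Normal), (∀ x ∈ A, ∀ y ∈ A, x * y = y * x) ∧
        Nonempty (G ⧸ (A ⊔ NilGrp.torsionSubgroup G) ≃* NilGrp.ZSq)) →
      Nonempty (G ≃* NilGrp.OmegaGrp)) ∧
    ((∃ (A : Subgroup G) (_ : A.Normal), (∀ x ∈ A, ∀ y ∈ A, x * y = y * x) ∧
        Nonempty (G ⧸ A ≃* NilGrp.ZSq)) →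
      Nonempty (G ≃* NilGrp.ZSq) ∨
      (∃ q : ℕ, 1 ≤ q ∧ Nonempty (G ≃* NilGrp.GammaGrp q)) ∨
      Nonempty (G ≃* NilGrp.OmegaGrp)) := by
  have := hbal.1
  obtain ⟨hr, f, hf, htors⟩ := NilGrp.exists_hom_zSq hβ
  obtain ⟨x, hx⟩ := hf (.ofAdd (1, 0))
  obtain ⟨y, hy⟩ := hf (.ofAdd (0, 1))
  have hxy := NilGrp.isZSqBasis_ker hx hy
  have hle : commutator G ≤ f.ker := Abelianization.commutator_subset_ker f
  have htf := hbal.torsionFree_abelianization hxy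
  have hfin := NilGrp.finite_int_abelianization hxy
  have hatf : IsAddTorsionFree (Additive (Abelianization f.ker)) := by
    refine ⟨fun n hn a b hab => ?_⟩
    have h1 : n • a = n • b := hab
    rw [← sub_eq_zero, ← smul_sub] at h1
    exact sub_eq_zero.mp (htf n hn _ h1)
  have hfree : Module.Free ℤ (Additive (Abelianization f.ker)) := inferInstance
  have hlow := NilGrp.le_hirschTail hle htors
  rw [← Module.finrank_eq_rank] at hlow
  have hlen := NilGrp.hirschLength_eq hr
  have htail : ∀ n : ℕ, NilGrp.hirschLength G = ((2 + n : ℕ) : Cardinal) →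
      NilGrp.hirschTail G = n := by
    intro n hn
    rw [hlen, Nat.cast_add] at hn
    exact Cardinal.eq_of_add_eq_add_left hn (Cardinal.natCast_lt_aleph0 (n := 2))
  have hcomm := NilGrp.comm_of_finrank_le_one (K := f.ker)
  have hupp : (∀ a b : f.ker, a * b = b * a) → NilGrp.hirschTail G ≤
      (Module.finrank ℤ (Additive (Abelianization f.ker)) : Cardinal) := by
    rw [Module.finrank_eq_rank]
    exact NilGrp.hirschTail_le hle
  have htri : (∀ a b : f.ker, a * b = b * a) → _ := fun hK =>
    (NilGrp.abModel hxy hK).trichotomy hbal hxy htors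
  -- Identifies AT in the third part, and A in the corollary, with the kernel studied above.
  have hkernel : ∀ (N : Subgroup G) [N.Normal], Nonempty (G ⧸ N ≃* NilGrp.ZSq) → f.ker = N := by
    rintro N _ ⟨e⟩
    ext g
    rw [MonoidHom.mem_ker, ← NilGrp.mem_ker_iff_of_surjective hf
      (f' := e.toMonoidHom.comp (QuotientGroup.mk' N))
      (e.surjective.comp (QuotientGroup.mk'_surjective N)) htors g, ← QuotientGroup.eq_one_iff]
    exact e.map_eq_one_iff
  refine ⟨fun h _ => ?_, fun h _ => ?_, ?_, ?_⟩
  · rw [htail 0 (by rw [h]; norm_num)] at hlow hupp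
    have hm : Module.finrank ℤ (Additive (Abelianization f.ker)) ≤ 0 := by exact_mod_cast hlow
    rcases htri (hcomm (by omega)) with ⟨-, h1⟩ | ⟨h1, -⟩ | ⟨h1, -⟩
    · exact h1
    · omega
    · omega
  · rw [htail 1 (by rw [h]; norm_num)] at hlow hupp
    have hm : Module.finrank ℤ (Additive (Abelianization f.ker)) ≤ 1 := by exact_mod_cast hlow
    have hm' : 1 ≤ Module.finrank ℤ (Additive (Abelianization f.ker)) := by
      exact_mod_cast hupp (hcomm hm)
    rcases htri (hcomm hm) with ⟨h1, -⟩ | ⟨-, h1⟩ | ⟨h1, -⟩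
    · omega
    · exact h1
    · omega
  · rintro h ⟨A, hAn, hA, he⟩
    have hK := NilGrp.comm_of_eq_sup_torsionSubgroup hA (hkernel _ he) htf
    rw [htail 2 (by rw [h]; norm_num)] at hupp
    have hm : 2 ≤ Module.finrank ℤ (Additive (Abelianization f.ker)) := by
      exact_mod_cast hupp hK
    rcases htri hK with ⟨h1, -⟩ | ⟨h1, -⟩ | ⟨-, h1⟩
    · omega
    · omega
    · exact h1
  · rintro ⟨A, hAn, hA, he⟩
    have hAK := hkernel A he
    have hmem : ∀ a : f.ker, (a : G) ∈ A := fun a => hAK ▸ a.2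
    rcases htri fun a b => Subtype.ext (hA a (hmem a) b (hmem b)) with
      ⟨-, h1⟩ | ⟨-, h1⟩ | ⟨-, h1⟩
    · exact Or.inl h1
    · exact Or.inr (Or.inl h1)
    · exact Or.inr (Or.inr h1)
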